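/- **Setting.** Let $A\in\mathbb R^{m\times m}$, $B\in\mathbb R^{m\times p}$ with $(A,B)$ stabilizable, $W\succ0$, $X_0\succeq0$, $Q\succeq0$ in $\mathbb R^{m\times m}$, $R\succ0$ in $\mathbb R^{p\times p}$, and $\gamma\in\mathbb R$. The plant is $x_{t+1}=Ax_t+Bu_t+w_t$ with $x_0\sim\mathcal N(0,X_0)$ and $w_t\sim\mathcal N(0,W)$ i.i.d. Let $S$ be a (symmetric) stabilizing solution of $A^{\mathsf T}SA-S-A^{\mathsf T}SB(B^{\mathsf T}SB+R)^{-1}B^{\mathsf T}SA+Q=0$, i.e. $A+BK$ has spectral radius $<1$, where $K=-(B^{\mathsf T}SB+R)^{-1}B^{\mathsf T}SA$, and put $\Theta=K^{\mathsf T}(B^{\mathsf T}SB+R)K$. Let $$\mathcal R(\gamma)=\inf_{P,\Pi\succeq0}\tfrac12\left(-\log_2\det\Pi+\log_2\det W\right)$$ subject to $\operatorname{Tr}(\Theta P)+\operatorname{Tr}(WS)\le\gamma$, $P\preceq APA^{\mathsf T}+W$ and $\begin{bmatrix}P-\Pi&PA^{\mathsf T}\\AP&APA^{\mathsf T}+W\end{bmatrix}\succeq0$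 (the objective is $+\infty$ if $\det\Pi=0$). Suppose the infimum is attained at $(\hat P,\hat\Pi)$, that $\hat P\succ0$, and that $C\in\mathbb R^{m\times m}$ and $V=vI_{m\times m}$, $v>0$, satisfy $\hat P^{-1}-(A\hat PA^{\mathsf T}+W)^{-1}=C^{\mathsf T}V^{-1}C$. Put $\hat P_+=A\hat PA^{\mathsf T}+W$, $J=\hat P_+C^{\mathsf T}(C\hat P_+C^{\mathsf T}+V)^{-1}$ and $\Delta=\sqrt{12v}$. *Test channel.* $y_t=Cx_t+v_t$ with $v_t\sim\mathcal N(0,V)$ i.i.d., independent of $(x_0,\{w_t\})$; $\bar x_{0|-1}=0$, $\bar x_{t|t}=\bar x_{t|t-1}+J(y_t-C\bar x_{t|t-1})$, $u_t=K\bar x_{t|t}$, $\bar x_{t+1|t}=A\bar x_{t|t}+Bu_t$. *Dithered architecture.* The dither $d_t\in\mathbb R^m$ has i.i.d. entries uniform on $[-\Delta/2,\Delta/2]$, is i.i.d. over time, and $x_0,\{w_t\},\{d_t\}$ are independent. Let $Q_\Delta$ round each entry $z_i$ to $k\Delta$ ($k\in\mathbb Z$) when $z_i\in[k\Delta-\Delta/2,k\Delta+\Delta/2)$.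 With $\bar x_{0|-1}=0$: $q_t=Q_\Delta(C(x_t-\bar x_{t|t-1})+d_t)$, $y_t=q_t-d_t+C\bar x_{t|t-1}$, $\bar x_{t|t}=\bar x_{t|t-1}+J(y_t-C\bar x_{t|t-1})$, $u_t=K\bar x_{t|t}$, $\bar x_{t+1|t}=(A+BK)\bar x_{t|t}$. *Sorted Shannon–Fano–Elias (SFE) code.* For a probability mass function $\mathbb P$ on a countable set, index its support by an initial segment of $\mathbb N$ in order of non-increasing probability (ties broken arbitrarily); the codeword of $q$ is the binary expansion of the total probability of the symbols preceding $q$, truncated to $\lceil-\log_2\mathbb P[q]\rceil$ bits. Write $\ell(a)$ for the length of $a\in\{0,1\}^*$. **Theorem.** 1. *(Control.)* In both the test channel and the dithered architecture, the expectations below are finite and $$\lim_{T\to\infty}\frac1{T+1}\sum_{t=0}^{T}\mathbb E\left[x_{t+1}^{\mathsf T}Qx_{t+1}+u_t^{\mathsf T}Ru_t\right]=\operatorname{Tr}(SW)+\operatorname{Tr}(\hat P\Theta)\le\gamma .$$ 2. *(Code using the dither.)* At each $t$ and each $\delta$ let $q\mapsto C_t(q|\delta)$ be a sorted SFE code for the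 conditional law of $q_t$ given $d_t=\delta$, with the sorting chosen measurably in $\delta$ (such a choice exists), and let $a_t=C_t(q_t|d_t)$. Then $q_t$ is almost surely a measurable function of $(a_t,d_t)$. Prefix Constraint 1 holds: for each $t$ and almost every realization of $(a_0^{t-1},d_0^{t},u_0^{t-1})$, if $a\ne a'$ both have positive conditional probability as values of $a_t$ given this realization, then $a$ is not a prefix of $a'$. Moreover $$\limsup_{T\to\infty}\frac1{T+1}\sum_{t=0}^{T}\mathbb E[\ell(a_t)]\le\mathcal R(\gamma)+1+\frac m2\log_2\left(\frac{2\pi e}{12}\right).$$ 3. *(Code ignoring the dither.)* At each $t$ let $C_t$ be a sorted SFE code for the marginal law of $q_t$ (one exists), and let $a_t=C_t(q_t)$. Then $q_t$ is almost surely a function of $a_t$. Prefix Constraint 2 holds: for each $t$, if $a\ne a'$ both have positive probability as values of $a_t$, then $a$ is not a prefix of $a'$. Moreover $$\limsup_{T\to\infty}\frac1{T+1}\sum_{t=0}^{T}\mathbb E[\ell(a_t)]\le\mathcal R(\gamma)+1+m\left(1+\frac12\log_2\left(\frac{2\pi e}{12}\right)\right).$$ -/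

import Mathlib

open MeasureTheory ProbabilityTheory Filter Topology
open scoped Matrix ENNReal

noncomputable section

namespace LQG

/-! ### Plant, Riccati equation, log-det program -/

/-- Real `m × m` (or `m × p`) data of the plant `x⁺ = A x + B u + w`, with process noise covariance
`W`, initial covariance `X₀` and LQG weights `Q`, `R`. -/
structure Plant (m p : ℕ) where
  A : Matrix (Fin m) (Fin m) ℝ
  B : Matrix (Fin m) (Fin p) ℝ
  W : Matrix (Fin m) (Fin m) ℝ
  X₀ : Matrix (Fin m) (Fin m) ℝ
  Q : Matrix (Fin m) (Fin m) ℝ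
  R : Matrix (Fin p) (Fin p) ℝ

variable {m p : ℕ}

/-- All complex eigenvalues lie in the open unit disc. -/
def IsSchurStable (M : Matrix (Fin m) (Fin m) ℝ) : Prop :=
  ∀ z ∈ spectrum ℂ (M.map (algebraMap ℝ ℂ)), ‖z‖ < 1

/-- Standing assumptions on the plant. -/
structure Plant.IsAdmissible (Sys : Plant m p) : Prop where
  W_posDef : Sys.W.PosDef
  X₀_posSemidef : Sys.X₀.PosSemidef
  Q_posSemidef : Sys.Q.PosSemidef
  R_posDef : Sys.R.PosDef
  stabilizable : ∃ F : Matrix (Fin p) (Fin m) ℝ, IsSchurStable (Sys.A + Sys.B * F)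

/-- `K = -(Bᵀ S B + R)⁻¹ Bᵀ S A`. -/
def Plant.gain (Sys : Plant m p) (S : Matrix (Fin m) (Fin m) ℝ) : Matrix (Fin p) (Fin m) ℝ :=
  -((Sys.Bᵀ * S * Sys.B + Sys.R)⁻¹ * Sys.Bᵀ * S * Sys.A)

/-- `Θ = Kᵀ (Bᵀ S B + R) K`. -/
def Plant.theta (Sys : Plant m p) (S : Matrix (Fin m) (Fin m) ℝ) : Matrix (Fin m) (Fin m) ℝ :=
  (Sys.gain S)ᵀ * (Sys.Bᵀ * S * Sys.B + Sys.R) * Sys.gain S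

/-- `S` is a stabilizing (symmetric) solution of the discrete algebraic Riccati equation. -/
structure Plant.IsStabilizingDARE (Sys : Plant m p) (S : Matrix (Fin m) (Fin m) ℝ) : Prop where
  symm : S.IsSymm
  dare : Sys.Aᵀ * S * Sys.A - S
    - Sys.Aᵀ * S * Sys.B * (Sys.Bᵀ * S * Sys.B + Sys.R)⁻¹ * Sys.Bᵀ * S * Sys.A + Sys.Q = 0
  stable : IsSchurStable (Sys.A + Sys.B * Sys.gain S)

/-- `P₊ = A P Aᵀ + W`. -/
def Plant.pred (Sys : Plant m p) (P : Matrix (Fin m) (Fin m) ℝ) : Matrix (Fin m) (Fin m) ℝ :=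
  Sys.A * P * Sys.Aᵀ + Sys.W

/-- Constraints of the log-det program at distortion level `γ`. -/
structure Plant.Feasible (Sys : Plant m p) (S : Matrix (Fin m) (Fin m) ℝ) (γ : ℝ)
    (P Pi : Matrix (Fin m) (Fin m) ℝ) : Prop where
  P_posSemidef : P.PosSemidef
  Pi_posSemidef : Pi.PosSemidef
  cost_le : (Sys.theta S * P).trace + (Sys.W * S).trace ≤ γ
  le_pred : (Sys.pred P - P).PosSemidef
  lmi : (Matrix.fromBlocks (P - Pi) (P * Sys.Aᵀ) (Sys.A * P) (Sys.pred P)).PosSemidef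

/-- The objective `½ (log₂ det W - log₂ det Π)`, equal to `+∞` when `det Π = 0`. -/
def Plant.objective (Sys : Plant m p) (Pi : Matrix (Fin m) (Fin m) ℝ) : EReal :=
  if 0 < Pi.det then
    (((1 / 2 : ℝ) * (-Real.logb 2 Pi.det + Real.logb 2 Sys.W.det) : ℝ) : EReal)
  else ⊤

/-- The rate-distortion function: the infimum of the log-det program. -/
def Plant.rate (Sys : Plant m p) (S : Matrix (Fin m) (Fin m) ℝ) (γ : ℝ) : EReal :=
  sInf {r | ∃ P Pi, Sys.Feasible S γ P Pi ∧ r = Sys.objective Pi}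

/-- `(P, Π)` attains the infimum of the log-det program. -/
structure Plant.IsMinimizer (Sys : Plant m p) (S : Matrix (Fin m) (Fin m) ℝ) (γ : ℝ)
    (P Pi : Matrix (Fin m) (Fin m) ℝ) : Prop where
  feasible : Sys.Feasible S γ P Pi
  optimal : Sys.objective Pi = Sys.rate S γ

/-- The measurement matrix `C` and the noise covariance `V` realize the posterior covariance `P`:
`P⁻¹ - (A P Aᵀ + W)⁻¹ - Cᵀ V⁻¹ C = 0`. -/
structure Plant.Realizes (Sys : Plant m p) (P C V : Matrix (Fin m) (Fin m) ℝ) : Prop where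
  P_posDef : P.PosDef
  V_posDef : V.PosDef
  eq : P⁻¹ - (Sys.pred P)⁻¹ - Cᵀ * V⁻¹ * C = 0

/-- The filter gain `J = P₊ Cᵀ (C P₊ Cᵀ + V)⁻¹`. -/
def Plant.filterGain (Sys : Plant m p) (P C V : Matrix (Fin m) (Fin m) ℝ) :
    Matrix (Fin m) (Fin m) ℝ :=
  Sys.pred P * Cᵀ * (C * Sys.pred P * Cᵀ + V)⁻¹

/-! ### Driving noise -/

/-- The centred Gaussian law with covariance `Sig` on `ℝᵐ`. -/
def gaussianVec (Sig : Matrix (Fin m) (Fin m) ℝ) : Measure (Fin m → ℝ) :=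
  (multivariateGaussian 0 Sig).map WithLp.ofLp

/-- The law of a vector with i.i.d. entries uniform on `[-Δ/2, Δ/2]`. -/
def uniformVec (m : ℕ) (Δ : ℝ) : Measure (Fin m → ℝ) :=
  Measure.pi fun _ => ProbabilityTheory.cond volume (Set.Icc (-Δ / 2) (Δ / 2))

/-- `x₀ ∼ N(0, X₀)`, `w` is i.i.d. `N(0, W)`, `n` is i.i.d. with law `ν`, and `x₀`, the process
`w` and the process `n` are mutually independent. -/
structure Plant.IsDriving (Sys : Plant m p) (ν : Measure (Fin m → ℝ))
    {Ω : Type*} [MeasurableSpace Ω] (μ : Measure Ω)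
    (x₀ : Ω → Fin m → ℝ) (w n : ℕ → Ω → Fin m → ℝ) : Prop where
  measurable_x₀ : Measurable x₀
  measurable_w : ∀ t, Measurable (w t)
  measurable_n : ∀ t, Measurable (n t)
  law_x₀ : μ.map x₀ = gaussianVec Sys.X₀
  law_w : ∀ t, μ.map (w t) = gaussianVec Sys.W
  law_n : ∀ t, μ.map (n t) = ν
  indep_w : iIndepFun w μ
  indep_n : iIndepFun n μ
  indep_w_n : IndepFun (fun ω t => w t ω) (fun ω t => n t ω) μ
  indep_x₀ : IndepFun x₀ (fun ω => ((fun t => w t ω), (fun t => n t ω))) μ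

/-! ### The two closed loops

Both are written pathwise. A loop state is the pair `(x_t, x̄_{t|t-1})`, started at `(x₀, 0)`. -/

/-- Posterior estimate `x̄_{t|t} = x̄_{t|t-1} + J (y_t - C x̄_{t|t-1})`. -/
def filterUpdate (J C : Matrix (Fin m) (Fin m) ℝ) (xbar y : Fin m → ℝ) : Fin m → ℝ :=
  xbar + J *ᵥ (y - C *ᵥ xbar)

/-- Test channel: `y_t = C x_t + v_t`, posterior estimate. -/
def testPosterior (J C : Matrix (Fin m) (Fin m) ℝ) (s : (Fin m → ℝ) × (Fin m → ℝ))
    (v : Fin m → ℝ) : Fin m → ℝ :=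
  filterUpdate J C s.2 (C *ᵥ s.1 + v)

/-- Loop state of the three-stage test channel. -/
def Plant.testState (Sys : Plant m p) (K : Matrix (Fin p) (Fin m) ℝ)
    (J C : Matrix (Fin m) (Fin m) ℝ) (x₀ : Fin m → ℝ) (w v : ℕ → Fin m → ℝ) :
    ℕ → (Fin m → ℝ) × (Fin m → ℝ)
  | 0 => (x₀, 0)
  | t + 1 =>
    let s := Sys.testState K J C x₀ w v t
    let xhat := testPosterior J C s (v t)
    let u := K *ᵥ xhat
    (Sys.A *ᵥ s.1 + Sys.B *ᵥ u + w t, Sys.A *ᵥ xhat + Sys.B *ᵥ u)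

/-- Control input `u_t = K x̄_{t|t}` in the test channel. -/
def Plant.testInput (Sys : Plant m p) (K : Matrix (Fin p) (Fin m) ℝ)
    (J C : Matrix (Fin m) (Fin m) ℝ) (x₀ : Fin m → ℝ) (w v : ℕ → Fin m → ℝ) (t : ℕ) :
    Fin p → ℝ :=
  K *ᵥ testPosterior J C (Sys.testState K J C x₀ w v t) (v t)

/-- Index `k` of the cell `∏ᵢ [kᵢΔ - Δ/2, kᵢΔ + Δ/2)` that contains `z`. -/
def quantIndex (Δ : ℝ) (z : Fin m → ℝ) : Fin m → ℤ := fun i => ⌊z i / Δ + 1 / 2⌋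

/-- The point `Δ k` of the lattice `Δ ℤᵐ`. -/
def latticePoint (Δ : ℝ) (k : Fin m → ℤ) : Fin m → ℝ := fun i => (k i : ℝ) * Δ

/-- Index of the quantized innovation `q_t = Q_Δ(C (x_t - x̄_{t|t-1}) + d_t)`. -/
def innovIndex (C : Matrix (Fin m) (Fin m) ℝ) (Δ : ℝ) (s : (Fin m → ℝ) × (Fin m → ℝ))
    (d : Fin m → ℝ) : Fin m → ℤ :=
  quantIndex Δ (C *ᵥ (s.1 - s.2) + d)

/-- Posterior estimate computed from the recovered quantization `q_t` and the dither, with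
centred measurement `y_t = (q_t - d_t) + C x̄_{t|t-1}`. -/
def ditherPosterior (J C : Matrix (Fin m) (Fin m) ℝ) (Δ : ℝ) (xbar : Fin m → ℝ)
    (k : Fin m → ℤ) (d : Fin m → ℝ) : Fin m → ℝ :=
  filterUpdate J C xbar ((latticePoint Δ k - d) + C *ᵥ xbar)

/-- Loop state of the dithered-quantizer architecture. -/
def Plant.ditherState (Sys : Plant m p) (K : Matrix (Fin p) (Fin m) ℝ)
    (J C : Matrix (Fin m) (Fin m) ℝ) (Δ : ℝ) (x₀ : Fin m → ℝ) (w d : ℕ → Fin m → ℝ) :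
    ℕ → (Fin m → ℝ) × (Fin m → ℝ)
  | 0 => (x₀, 0)
  | t + 1 =>
    let s := Sys.ditherState K J C Δ x₀ w d t
    let xhat := ditherPosterior J C Δ s.2 (innovIndex C Δ s (d t)) (d t)
    (Sys.A *ᵥ s.1 + Sys.B *ᵥ (K *ᵥ xhat) + w t, (Sys.A + Sys.B * K) *ᵥ xhat)

/-- Quantizer output at time `t` (as an element of `ℤᵐ`, the lattice index). -/
def Plant.ditherIndex (Sys : Plant m p) (K : Matrix (Fin p) (Fin m) ℝ)
    (J C : Matrix (Fin m) (Fin m) ℝ) (Δ : ℝ) (x₀ : Fin m → ℝ) (w d : ℕ → Fin m → ℝ) (t : ℕ) :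
    Fin m → ℤ :=
  innovIndex C Δ (Sys.ditherState K J C Δ x₀ w d t) (d t)

/-- Control input `u_t = K x̄_{t|t}` in the dithered-quantizer architecture. -/
def Plant.ditherInput (Sys : Plant m p) (K : Matrix (Fin p) (Fin m) ℝ)
    (J C : Matrix (Fin m) (Fin m) ℝ) (Δ : ℝ) (x₀ : Fin m → ℝ) (w d : ℕ → Fin m → ℝ) (t : ℕ) :
    Fin p → ℝ :=
  K *ᵥ ditherPosterior J C Δ (Sys.ditherState K J C Δ x₀ w d t).2
    (Sys.ditherIndex K J C Δ x₀ w d t) (d t)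

/-- `‖x‖²_Q + ‖u‖²_R`. -/
def Plant.stageCost (Sys : Plant m p) (x : Fin m → ℝ) (u : Fin p → ℝ) : ℝ :=
  x ⬝ᵥ (Sys.Q *ᵥ x) + u ⬝ᵥ (Sys.R *ᵥ u)

/-- The stage costs `‖x_{t+1}‖²_Q + ‖u_t‖²_R` are integrable and their time-averaged expectations
converge to `c`. -/
def Plant.HasLQGCost (Sys : Plant m p) {Ω : Type*} [MeasurableSpace Ω] (μ : Measure Ω)
    (x : ℕ → Ω → Fin m → ℝ) (u : ℕ → Ω → Fin p → ℝ) (c : ℝ) : Prop :=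
  (∀ t, Integrable (fun ω => Sys.stageCost (x (t + 1) ω) (u t ω)) μ) ∧
  Tendsto (fun T : ℕ => (1 / ((T : ℝ) + 1)) *
    ∑ t ∈ Finset.range (T + 1), ∫ ω, Sys.stageCost (x (t + 1) ω) (u t ω) ∂μ) atTop (𝓝 c)

/-! ### Sorted Shannon–Fano–Elias codes -/

instance : MeasurableSpace (List Bool) := ⊤

instance : DiscreteMeasurableSpace (List Bool) := ⟨fun _ => trivial⟩

/-- The first `n` binary digits after the point of `x ∈ [0, 1)`. -/
def binaryDigits (x : ℝ) (n : ℕ) : List Bool :=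
  (List.range n).map fun i => decide (⌊2 ^ (i + 1) * x⌋ % 2 = 1)

/-- `s` re-indexes the support of the probability `P` on a countable alphabet by an initial segment
of `ℕ`, in order of non-increasing probability. -/
structure IsSorting {α : Type*} [MeasurableSpace α] (P : Measure α) (s : α → ℕ) : Prop where
  injOn : Set.InjOn s {a | P {a} ≠ 0}
  initial : ∀ a, P {a} ≠ 0 → ∀ n < s a, ∃ b, P {b} ≠ 0 ∧ s b = n
  sorted : ∀ a b, P {a} ≠ 0 → P {b} ≠ 0 → s a < s b → P {b} ≤ P {a}

/-- Sorted Shannon–Fano–Elias code: the binary expansion of `P[s(q) < s(a)]`, truncated to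
`⌈-log₂ P[a]⌉` bits. -/
def shannonCode {α : Type*} [MeasurableSpace α] (P : Measure α) (s : α → ℕ) (a : α) : List Bool :=
  binaryDigits (P.real {b | s b < s a}) ⌈-Real.logb 2 (P.real {a})⌉₊

/-! ### Prefix constraints and communication cost -/

/-- Prefix constraint with side information: for almost every realization of the decoder's knowledge
`(a_0^{t-1}, d_0^t, u_0^{t-1})`, no codeword of positive conditional probability is a prefix of
another one. -/
def PrefixConstraint1 {Ω : Type*} [MeasurableSpace Ω] (μ : Measure Ω) [IsFiniteMeasure μ]
    (a : ℕ → Ω → List Bool) (d : ℕ → Ω → Fin m → ℝ) (u : ℕ → Ω → Fin p → ℝ) : Prop :=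
  ∀ t : ℕ,
    let hist : Ω → (Fin t → List Bool) × (Fin (t + 1) → Fin m → ℝ) × (Fin t → Fin p → ℝ) :=
      fun ω => (fun i => a i ω, fun i => d i ω, fun i => u i ω)
    ∀ᵐ h ∂(μ.map hist), ∀ a₁ a₂ : List Bool, a₁ ≠ a₂ →
      0 < condDistrib (a t) hist μ h {a₁} → 0 < condDistrib (a t) hist μ h {a₂} → ¬ a₁ <+: a₂

/-- Prefix constraint without side information: at each time, no codeword of positive probability is
a prefix of another one. -/
def PrefixConstraint2 {Ω : Type*} [MeasurableSpace Ω] (μ : Measure Ω)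
    (a : ℕ → Ω → List Bool) : Prop :=
  ∀ t : ℕ, ∀ a₁ a₂ : List Bool, a₁ ≠ a₂ →
    0 < μ.map (a t) {a₁} → 0 < μ.map (a t) {a₂} → ¬ a₁ <+: a₂

/-- `limsup_T (1/(T+1)) ∑_{t ≤ T} E[ℓ(a_t)]`. -/
def commCost {Ω : Type*} [MeasurableSpace Ω] (μ : Measure Ω) (a : ℕ → Ω → List Bool) : ℝ≥0∞ :=
  limsup (fun T : ℕ =>
    (∑ t ∈ Finset.range (T + 1), ∫⁻ ω, ((a t ω).length : ℝ≥0∞) ∂μ) / ((T : ℝ≥0∞) + 1)) atTop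

/-- `s t δ` sorts the conditional law of `q_t` given `d_t = δ`, measurably in `δ`. -/
structure IsSideInfoSorting {Ω : Type*} [MeasurableSpace Ω] (μ : Measure Ω) [IsFiniteMeasure μ]
    (q : ℕ → Ω → Fin m → ℤ) (d : ℕ → Ω → Fin m → ℝ)
    (s : ℕ → (Fin m → ℝ) → (Fin m → ℤ) → ℕ) : Prop where
  measurable : ∀ t k, Measurable fun δ => s t δ k
  sorting : ∀ t δ, IsSorting (condDistrib (q t) (d t) μ δ) (s t δ)

/-- `s t` sorts the marginal law of `q_t`. -/
def IsMarginalSorting {Ω : Type*} [MeasurableSpace Ω] (μ : Measure Ω)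
    (q : ℕ → Ω → Fin m → ℤ) (s : ℕ → (Fin m → ℤ) → ℕ) : Prop :=
  ∀ t, IsSorting (μ.map (q t)) (s t)

/-- Codewords of the time-varying sorted code designed per the conditional law of `q_t` given
`d_t`. -/
def sideInfoCodeword {Ω : Type*} [MeasurableSpace Ω] (μ : Measure Ω) [IsFiniteMeasure μ]
    (q : ℕ → Ω → Fin m → ℤ) (d : ℕ → Ω → Fin m → ℝ)
    (s : ℕ → (Fin m → ℝ) → (Fin m → ℤ) → ℕ) (t : ℕ) (ω : Ω) : List Bool :=
  shannonCode (condDistrib (q t) (d t) μ (d t ω)) (s t (d t ω)) (q t ω)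

/-- Codewords of the time-varying sorted code designed per the marginal law of `q_t`. -/
def marginalCodeword {Ω : Type*} [MeasurableSpace Ω] (μ : Measure Ω)
    (q : ℕ → Ω → Fin m → ℤ) (s : ℕ → (Fin m → ℤ) → ℕ) (t : ℕ) (ω : Ω) : List Bool :=
  shannonCode (μ.map (q t)) (s t) (q t ω)

end LQG

end

namespace LQG

variable {m p : ℕ}

/-! ### Matrix inequalities -/

/-! Only second moments of the noise matter, for the control cost and for the code lengths alike. By
`Plant.ditherState_eq_testState`, the dithered loop is the test-channel loop with the Gaussian noise
replaced by the subtractive quantization error. Given the state, the uniform dither makes that error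
centred with covariance (Δ²/12) I = v I = V. Both loops therefore satisfy `Plant.IsWhiteLoop`, and
the control part is proved once for that structure.

Control. The identity P⁻¹ - P₊⁻¹ = Cᵀ V⁻¹ C makes P₊ a fixed point of the prediction-error
covariance recursion (`Plant.Realizes.joseph`). As W ≻ 0, the same P₊ is a Lyapunov certificate for
A (I - J C), so the prediction and posterior error covariances converge to P₊ and P. Completing the
square with the Riccati equation turns the expected stage cost into a telescoping difference plus
Tr(SW) + Tr(Θ E), with E the posterior error covariance. State moments are bounded because A + B K
is stable, so the telescoping part averages out.

Rate. A Schur complement eliminates Π and bounds the optimal value below by ½ log₂ (det P₊ / det P)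
(`Plant.Feasible.le_objective`). With Σ = C P₊ Cᵀ + V this ratio equals det Σ / det V
(`Plant.Realizes.det_innovation`), so it suffices to bound code lengths by the latter. A codeword of
a symbol of probability p has length at most 1 - log₂ p. The unknown p is compared with b = Δᵐ g(Δk
- δ), g the centred Gaussian density of covariance Σ: since ln r ≤ r - 1, replacing p by b costs at
most (E[b/p] - 1) / ln 2, and E[b/p] ≤ 1 because the dithered cells tile space
(`lintegral_likelihoodRatio_le`). The expectation of -log₂ b depends only on the second moment of q
- d, which tends to Σ; with Δ² = 12 v the limit is the rate term plus (m/2) log₂ (2πe/12).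

When the code ignores the dither, a fictitious independent dither is adjoined for the analysis only.
The quantization error with dither left in has variance at most Δ²/4 = 3v per entry, and the
fictitious dither adds v. A reference covariance 4Σ absorbs both, and the factor four costs exactly
m bits (`lengthBound_quarter`).

Prefix-freeness. Sorting makes lengths non-decreasing along the order, and a length n with 2⁻ⁿ ≤ p
separates the truncated cumulative sums (`shannonCode_not_prefix`). With side information, the
history contains d_t, and given it a_t lies almost surely in the codebook designed for d_t. -/

theorem posSemidef_quad_nonneg {n : Type*} [Fintype n] {M : Matrix n n ℝ} (hM : M.PosSemidef)
    (x : n → ℝ) : 0 ≤ x ⬝ᵥ (M *ᵥ x) := by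
  simpa using hM.dotProduct_mulVec_nonneg x

/-- The Rayleigh quotient of 1 + N at a unit eigenvector is 1 plus a nonnegative term, so every
factor in the product of eigenvalues is at least 1. -/
theorem one_le_det_one_add {n : Type*} [Fintype n] [DecidableEq n] {N : Matrix n n ℝ}
    (hN : N.PosSemidef) : 1 ≤ (1 + N).det := by
  have hM : (1 + N).IsHermitian := Matrix.isHermitian_one.add hN.1
  rw [hM.det_eq_prod_eigenvalues]
  suffices h1 : ∀ i, 1 ≤ hM.eigenvalues i by
    simpa using Finset.prod_le_prod (s := Finset.univ) (fun _ _ => zero_le_one (α := ℝ))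
      fun i _ => h1 i
  intro i
  have h := hM.eigenvalues_eq i
  have hv : (⇑(hM.eigenvectorBasis i) : n → ℝ) ⬝ᵥ ⇑(hM.eigenvectorBasis i) = 1 := by
    have := hM.eigenvectorBasis.orthonormal.1 i
    have h2 : inner ℝ (hM.eigenvectorBasis i) (hM.eigenvectorBasis i) = (1 : ℝ) := by
      rw [real_inner_self_eq_norm_sq, this]; norm_num
    rw [PiLp.inner_apply] at h2
    simpa only [dotProduct, RCLike.inner_apply, conj_trivial] using h2
  have h0 := posSemidef_quad_nonneg hN (⇑(hM.eigenvectorBasis i) : n → ℝ)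
  simp only [Matrix.add_mulVec, Matrix.one_mulVec, dotProduct_add, star_trivial] at h
  simp only [RCLike.re_to_real] at h ⊢
  rw [hv] at h
  linarith

/-- The determinant is monotone in the Loewner order. -/
theorem det_le_det {n : Type*} [Fintype n] [DecidableEq n] {M N : Matrix n n ℝ}
    (hM : M.PosDef) (h : (N - M).PosSemidef) : M.det ≤ N.det := by
  obtain ⟨B, hB⟩ : ∃ B : Matrix n n ℝ, M = Bᴴ * B := by
    open scoped MatrixOrder in
    exact (CStarAlgebra.nonneg_iff_eq_star_mul_self).1 hM.posSemidef.nonneg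
  have hdet : IsUnit B.det := by
    have := (Matrix.isUnit_iff_isUnit_det _).1 hM.isUnit
    rw [hB, Matrix.det_mul] at this
    exact isUnit_of_mul_isUnit_right this
  -- Congruence by the square-root factor B of M reduces the claim to M = 1.
  have hE : N = Bᴴ * (1 + (B⁻¹)ᴴ * (N - M) * B⁻¹) * B := by
    have h1 : Bᴴ * (B⁻¹)ᴴ = 1 := by
      rw [← Matrix.conjTranspose_mul, Matrix.nonsing_inv_mul _ hdet, Matrix.conjTranspose_one]
    calc N = M + (N - M) := by abel
      _ = Bᴴ * B + (Bᴴ * (B⁻¹)ᴴ) * (N - M) * (B⁻¹ * B) := by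
        rw [h1, Matrix.nonsing_inv_mul _ hdet, ← hB]; simp
      _ = _ := by simp only [Matrix.mul_add, Matrix.add_mul, Matrix.mul_assoc, Matrix.mul_one]
  have h1 := one_le_det_one_add (h.conjTranspose_mul_mul_same B⁻¹)
  have hM0 : M.det = B.det * B.det := by
    rw [hB, Matrix.det_mul, Matrix.det_conjTranspose]; simp
  have hN0 : N.det = B.det * B.det * (1 + (B⁻¹)ᴴ * (N - M) * B⁻¹).det := by
    conv_lhs => rw [hE]
    rw [Matrix.det_mul, Matrix.det_mul, Matrix.det_conjTranspose]; simp; ring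
  rw [hM0, hN0]
  exact le_mul_of_one_le_right (mul_self_nonneg _) h1

/-- The constant is the minimum of the form over the compact unit sphere, here that of the sup norm;
homogeneity gives the rest. -/
theorem PosDef.exists_quad_ge {n : Type*} [Fintype n] [DecidableEq n] {M : Matrix n n ℝ}
    (hM : M.PosDef) : ∃ α : ℝ, 0 < α ∧ ∀ x : n → ℝ, α * ‖x‖ ^ 2 ≤ x ⬝ᵥ (M *ᵥ x) := by
  have hc : Continuous fun x : n → ℝ => x ⬝ᵥ (M *ᵥ x) := by
    unfold dotProduct Matrix.mulVec dotProduct; fun_prop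
  rcases (Metric.sphere (0 : n → ℝ) 1).eq_empty_or_nonempty with he | hne
  · refine ⟨1, one_pos, fun x => ?_⟩
    have hx : x = 0 := by
      by_contra hx
      have : (‖x‖⁻¹ • x) ∈ Metric.sphere (0 : n → ℝ) 1 := by
        simp [norm_smul, hx]
      rw [he] at this; exact this
    simp [hx]
  · obtain ⟨y, hy, hmin⟩ := (isCompact_sphere (0 : n → ℝ) 1).exists_isMinOn hne hc.continuousOn
    have hy1 : ‖y‖ = 1 := by simpa using hy
    have hy0 : y ≠ 0 := by rintro rfl; simp at hy1
    refine ⟨y ⬝ᵥ (M *ᵥ y), by simpa using hM.dotProduct_mulVec_pos hy0, fun x => ?_⟩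
    by_cases hx : x = 0
    · simp [hx]
    have hx' : 0 < ‖x‖ := norm_pos_iff.2 hx
    have h := hmin (show (‖x‖⁻¹ • x) ∈ Metric.sphere (0 : n → ℝ) 1 by simp [norm_smul, hx])
    simp only [Set.mem_ofPred_eq, Matrix.mulVec_smul, smul_dotProduct, dotProduct_smul,
      smul_eq_mul] at h
    rw [← mul_assoc, ← sq, inv_pow, inv_mul_eq_div, le_div_iff₀ (by positivity)] at h
    exact h

/-! ### Powers of stable matrices -/

section Gelfand

attribute [local instance] Matrix.linftyOpNormedRing Matrix.linftyOpNormedAlgebra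

/-- By Gelfand's formula the norms of the powers are eventually below rᵏ for some r strictly between
the spectral radius and 1. -/
theorem IsSchurStable.exists_summable {M : Matrix (Fin m) (Fin m) ℝ} (hM : IsSchurStable M) :
    ∃ a : ℕ → ℝ, (∀ k, 0 ≤ a k) ∧ Summable a ∧
      ∀ (k : ℕ) (x : Fin m → ℝ), ‖(M ^ k) *ᵥ x‖ ≤ a k * ‖x‖ := by
  refine ⟨fun k => ‖M ^ k‖, fun k => norm_nonneg _, ?_, fun k x => Matrix.linfty_opNorm_mulVec _ _⟩
  rcases isEmpty_or_nonempty (Fin m) with h | h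
  · have : ∀ k, ‖M ^ k‖ = 0 := fun k => by rw [Subsingleton.elim (M ^ k) 0, norm_zero]
    simp [this]
  -- The spectrum is complex, so Gelfand's formula is applied to the complexified matrix; the ℓ∞
  -- operator norm does not see the change of field.
  have hnorm : ∀ k, ‖M ^ k‖ = ‖(M.map (algebraMap ℝ ℂ)) ^ k‖ := fun k => by
    rw [← Matrix.map_pow]
    simp [Matrix.linfty_opNorm_def]
  have : Nontrivial (Matrix (Fin m) (Fin m) ℂ) := inferInstance
  have hr : spectralRadius ℂ (M.map (algebraMap ℝ ℂ)) < (1 : NNReal) :=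
    spectrum.spectralRadius_lt_of_forall_lt _ fun z hz => by exact_mod_cast hM z hz
  obtain ⟨r, hr1, hr2⟩ := ENNReal.lt_iff_exists_nnreal_btwn.1 hr
  have hr2' : r < 1 := by exact_mod_cast hr2
  have hev := (spectrum.pow_nnnorm_pow_one_div_tendsto_nhds_spectralRadius
    (M.map (algebraMap ℝ ℂ))).eventually_lt_const hr1
  have hev2 : ∀ᶠ n : ℕ in atTop, ‖M ^ n‖ ≤ (r : ℝ) ^ n := by
    filter_upwards [hev, eventually_ge_atTop 1] with n hn hn1
    have hn0 : (n : ℝ) ≠ 0 := by positivity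
    have h2 := ENNReal.rpow_le_rpow hn.le (Nat.cast_nonneg (α := ℝ) n)
    rw [← ENNReal.rpow_mul, one_div, inv_mul_cancel₀ hn0, ENNReal.rpow_one,
      ENNReal.rpow_natCast] at h2
    rw [hnorm]
    have h3 : ‖(M.map (algebraMap ℝ ℂ)) ^ n‖₊ ≤ r ^ n := by exact_mod_cast h2
    exact_mod_cast h3
  exact Summable.of_norm_bounded_eventually_nat
    (summable_geometric_of_lt_one r.2 (by exact_mod_cast hr2')) (by simpa using hev2)

end Gelfand

theorem IsSchurStable.tendsto_pow_mulVec {M : Matrix (Fin m) (Fin m) ℝ} (hM : IsSchurStable M)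
    (x : Fin m → ℝ) : Tendsto (fun k => (M ^ k) *ᵥ x) atTop (𝓝 0) := by
  obtain ⟨a, _, ha, hb⟩ := hM.exists_summable
  refine squeeze_zero_norm (fun k => hb k x) ?_
  simpa using ha.tendsto_atTop_zero.mul_const ‖x‖

/-- If `N = M N Mᵀ + D` with `N ⪰ 0` and `D ≻ 0` then the powers of `M` tend to zero. -/
theorem tendsto_pow_of_lyapunov {M N D : Matrix (Fin m) (Fin m) ℝ} (hN : N.PosSemidef)
    (hD : D.PosDef) (h : (N - M * N * Mᵀ - D).PosSemidef) :
    Tendsto (fun k => M ^ k) atTop (𝓝 0) := by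
  obtain ⟨α, hα, hq⟩ := PosDef.exists_quad_ge hD
  have key : ∀ x : Fin m → ℝ, Tendsto (fun k => (Mᵀ ^ k) *ᵥ x) atTop (𝓝 0) := by
    intro x
    set f : ℕ → ℝ := fun k => ((Mᵀ ^ k) *ᵥ x) ⬝ᵥ (N *ᵥ ((Mᵀ ^ k) *ᵥ x)) with hf
    -- The form N is a Lyapunov function for the iteration of Mᵀ: each step loses at least the
    -- D-form of the current vector. Telescoping makes the squared norms summable.
    have hstep : ∀ k, α * ‖(Mᵀ ^ k) *ᵥ x‖ ^ 2 ≤ f k - f (k + 1) := by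
      intro k
      set y := (Mᵀ ^ k) *ᵥ x with hy
      have h1 : (Mᵀ ^ (k + 1)) *ᵥ x = Mᵀ *ᵥ y := by
        rw [hy, Matrix.mulVec_mulVec, pow_succ']
      have h2 := posSemidef_quad_nonneg h y
      have h3 := hq y
      have h4 : f (k + 1) = y ⬝ᵥ ((M * N * Mᵀ) *ᵥ y) := by
        simp only [hf]
        rw [h1, ← Matrix.mulVec_mulVec, ← Matrix.mulVec_mulVec, Matrix.dotProduct_mulVec y,
          ← Matrix.mulVec_transpose]
      simp only [Matrix.sub_mulVec, dotProduct_sub] at h2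
      rw [h4]
      have : f k = y ⬝ᵥ (N *ᵥ y) := rfl
      linarith
    have hf0 : ∀ k, 0 ≤ f k := fun k => posSemidef_quad_nonneg hN _
    have hs : Summable fun k => α * ‖(Mᵀ ^ k) *ᵥ x‖ ^ 2 := by
      refine summable_of_sum_range_le (c := f 0) (fun k => by positivity) fun n => ?_
      calc _ ≤ ∑ k ∈ Finset.range n, (f k - f (k + 1)) := Finset.sum_le_sum fun k _ => hstep k
        _ = f 0 - f n := Finset.sum_range_sub' f n
        _ ≤ f 0 := by linarith [hf0 n]
    have h0 := hs.tendsto_atTop_zero.const_mul α⁻¹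
    simp only [inv_mul_cancel_left₀ hα.ne', mul_zero] at h0
    rw [tendsto_zero_iff_norm_tendsto_zero]
    have := h0.sqrt
    simpa using this
  refine tendsto_pi_nhds.2 fun i => tendsto_pi_nhds.2 fun j => ?_
  -- Applying the powers of Mᵀ to unit vectors reads off the entries of the powers of M.
  have := (tendsto_pi_nhds.1 (key (Pi.single i 1))) j
  simp only [Matrix.mulVec_single_one, Pi.zero_apply] at this
  simpa [← Matrix.transpose_pow] using this

/-! ### The Riccati equation -/

/-- S is not assumed positive semidefinite, so invertibility has to be proved. Were the matrix
singular, its Lean inverse would be 0; then K = 0, A itself is stable, and the Riccati equation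
degenerates to S = Aᵀ S A + Q. Along the powers of A the form of S then decreases to 0, which forces
S ⪰ 0 and makes Bᵀ S B + R positive definite, a contradiction. -/
theorem Plant.IsStabilizingDARE.isUnit_det {Sys : Plant m p} (hSys : Sys.IsAdmissible)
    {S : Matrix (Fin m) (Fin m) ℝ} (hS : Sys.IsStabilizingDARE S) :
    IsUnit (Sys.Bᵀ * S * Sys.B + Sys.R).det := by
  by_contra hG
  have hinv := Matrix.nonsing_inv_apply_not_isUnit _ hG
  have hK : Sys.gain S = 0 := by simp [Plant.gain, hinv]
  have hst := hS.stable
  have hd := hS.dare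
  rw [hK, Matrix.mul_zero, add_zero] at hst
  rw [hinv] at hd
  simp only [Matrix.mul_zero, Matrix.zero_mul, sub_zero] at hd
  have hquad : ∀ x : Fin m → ℝ, 0 ≤ x ⬝ᵥ (S *ᵥ x) := by
    intro x
    set f : ℕ → ℝ := fun k => ((Sys.A ^ k) *ᵥ x) ⬝ᵥ (S *ᵥ ((Sys.A ^ k) *ᵥ x)) with hf
    have hanti : Antitone f := by
      refine antitone_nat_of_succ_le fun k => ?_
      set y := (Sys.A ^ k) *ᵥ x with hy
      have h1 : (Sys.A ^ (k + 1)) *ᵥ x = Sys.A *ᵥ y := by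
        rw [hy, Matrix.mulVec_mulVec, pow_succ']
      have h4 : f (k + 1) = y ⬝ᵥ ((Sys.Aᵀ * S * Sys.A) *ᵥ y) := by
        simp only [hf]
        rw [h1, ← Matrix.mulVec_mulVec, ← Matrix.mulVec_mulVec, Matrix.dotProduct_mulVec y,
          Matrix.vecMul_transpose]
      have h5 : Sys.Aᵀ * S * Sys.A = S - Sys.Q := by
        rw [← sub_eq_zero, ← hd]; abel
      rw [h4, h5, Matrix.sub_mulVec, dotProduct_sub]
      have := posSemidef_quad_nonneg hSys.Q_posSemidef y
      have h6 : f k = y ⬝ᵥ (S *ᵥ y) := rfl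
      linarith
    have hc : Continuous fun y : Fin m → ℝ => y ⬝ᵥ (S *ᵥ y) := by
      unfold dotProduct Matrix.mulVec dotProduct; fun_prop
    have hlim : Tendsto f atTop (𝓝 0) := by
      have := (hc.tendsto 0).comp (hst.tendsto_pow_mulVec x)
      rwa [Matrix.mulVec_zero, dotProduct_zero] at this
    have := hanti.le_of_tendsto hlim 0
    simpa [hf] using this
  have hSpsd : S.PosSemidef :=
    Matrix.PosSemidef.of_dotProduct_mulVec_nonneg
      (by simpa [Matrix.IsHermitian, Matrix.IsSymm] using hS.symm)
      (by simpa using hquad)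
  have hGpd : (Sys.Bᵀ * S * Sys.B + Sys.R).PosDef := by
    refine Matrix.PosDef.posSemidef_add ?_ hSys.R_posDef
    simpa using hSpsd.conjTranspose_mul_mul_same Sys.B
  exact hG ((Matrix.isUnit_iff_isUnit_det _).1 hGpd.isUnit)

/-- Completion of squares for the linear-quadratic stage cost. -/
theorem Plant.IsStabilizingDARE.quad_eq {Sys : Plant m p} (hSys : Sys.IsAdmissible)
    {S : Matrix (Fin m) (Fin m) ℝ} (hS : Sys.IsStabilizingDARE S) (x e : Fin m → ℝ) :
    let u := Sys.gain S *ᵥ (x - e)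
    x ⬝ᵥ (Sys.Q *ᵥ x) + u ⬝ᵥ (Sys.R *ᵥ u)
      + (Sys.A *ᵥ x + Sys.B *ᵥ u) ⬝ᵥ (S *ᵥ (Sys.A *ᵥ x + Sys.B *ᵥ u))
      = x ⬝ᵥ (S *ᵥ x) + e ⬝ᵥ (Sys.theta S *ᵥ e) := by
  intro u
  have hG := hS.isUnit_det hSys
  set G := Sys.Bᵀ * S * Sys.B + Sys.R with hGdef
  set K := Sys.gain S with hK
  have hGK : G * K = -(Sys.Bᵀ * S * Sys.A) := by
    rw [hK, Plant.gain, Matrix.mul_neg, ← hGdef]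
    simp only [← Matrix.mul_assoc]
    rw [Matrix.mul_nonsing_inv _ hG, Matrix.one_mul]
  have hSt : Sᵀ = S := hS.symm
  have hRt : Sys.Rᵀ = Sys.R := by simpa [Matrix.IsHermitian] using hSys.R_posDef.isHermitian
  have hGt : Gᵀ = G := by
    simp [hGdef, Matrix.transpose_mul, hSt, hRt, Matrix.mul_assoc]
  have hKG : Kᵀ * G = -(Sys.Aᵀ * S * Sys.B) := by
    have := congrArg Matrix.transpose hGK
    simpa [Matrix.transpose_mul, hGt, hSt, Matrix.mul_assoc] using this
  have hth : Sys.theta S = Kᵀ * G * K := rfl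
  have hdare : Sys.Q = S - Sys.Aᵀ * S * Sys.A + Kᵀ * G * K := by
    have h1 : Kᵀ * G * K
        = Sys.Aᵀ * S * Sys.B * G⁻¹ * Sys.Bᵀ * S * Sys.A := by
      rw [hKG, hK, Plant.gain, ← hGdef]
      simp [Matrix.mul_assoc]
    rw [h1, ← sub_eq_zero, ← hS.dare]
    abel
  have mv : ∀ {a b : ℕ} (X : Matrix (Fin a) (Fin b) ℝ) (y : Fin b → ℝ) (z : Fin a → ℝ),
      (X *ᵥ y) ⬝ᵥ z = y ⬝ᵥ (Xᵀ *ᵥ z) := by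
    intro a b X y z
    rw [Matrix.dotProduct_mulVec, Matrix.vecMul_transpose]
  -- For an arbitrary input the cost exceeds the value function by a square around the optimal input
  -- K x. At u = K (x - e) the deviation is -K e, which produces Θ.
  have expand : ∀ u : Fin p → ℝ, x ⬝ᵥ (Sys.Q *ᵥ x) + u ⬝ᵥ (Sys.R *ᵥ u)
      + (Sys.A *ᵥ x + Sys.B *ᵥ u) ⬝ᵥ (S *ᵥ (Sys.A *ᵥ x + Sys.B *ᵥ u))
      = x ⬝ᵥ (S *ᵥ x) + (u - K *ᵥ x) ⬝ᵥ (G *ᵥ (u - K *ᵥ x)) := by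
    intro u
    have e1 : (u - K *ᵥ x) ⬝ᵥ (G *ᵥ (u - K *ᵥ x)) = u ⬝ᵥ (G *ᵥ u) - u ⬝ᵥ ((G * K) *ᵥ x)
        - x ⬝ᵥ ((Kᵀ * G) *ᵥ u) + x ⬝ᵥ ((Kᵀ * G * K) *ᵥ x) := by
      simp only [sub_dotProduct, Matrix.mulVec_sub, dotProduct_sub, mv, Matrix.mulVec_mulVec,
        Matrix.mul_assoc]
      ring
    rw [e1, hGK, hdare]
    have e2 : u ⬝ᵥ (G *ᵥ u) = u ⬝ᵥ ((Sys.Bᵀ * S * Sys.B) *ᵥ u) + u ⬝ᵥ (Sys.R *ᵥ u) := by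
      rw [hGdef, Matrix.add_mulVec, dotProduct_add]
    rw [e2]
    rw [hKG]
    simp only [Matrix.mulVec_add, dotProduct_add, add_dotProduct, Matrix.add_mulVec,
      Matrix.sub_mulVec, Matrix.neg_mulVec, dotProduct_neg, dotProduct_sub, mv,
      Matrix.mulVec_mulVec, Matrix.mul_assoc]
    ring
  rw [expand u]
  have : u - K *ᵥ x = -(K *ᵥ e) := by simp [u, Matrix.mulVec_sub, hK]
  rw [this, hth]
  simp only [Matrix.mulVec_neg, neg_dotProduct, dotProduct_neg, neg_neg, mv, Matrix.mulVec_mulVec,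
    Matrix.mul_assoc]

/-! ### The stationary filter -/

theorem Plant.pred_posDef {Sys : Plant m p} (hSys : Sys.IsAdmissible)
    {P : Matrix (Fin m) (Fin m) ℝ} (hP : P.PosSemidef) : (Sys.pred P).PosDef := by
  refine Matrix.PosDef.posSemidef_add ?_ hSys.W_posDef
  simpa using hP.mul_mul_conjTranspose_same Sys.A

section Filter

variable {Sys : Plant m p} {P C V : Matrix (Fin m) (Fin m) ℝ}

theorem isUnit_det_of_posDef {n : Type*} [Fintype n] [DecidableEq n] {M : Matrix n n ℝ}
    (h : M.PosDef) : IsUnit M.det := (Matrix.isUnit_iff_isUnit_det _).1 h.isUnit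

/-- Covariance of the stationary measurement. -/
theorem Plant.innovation_posDef (hSys : Sys.IsAdmissible) (hC : Sys.Realizes P C V) :
    (C * Sys.pred P * Cᵀ + V).PosDef := by
  refine Matrix.PosDef.posSemidef_add ?_ hC.V_posDef
  simpa using (Sys.pred_posDef hSys hC.P_posDef.posSemidef).posSemidef.mul_mul_conjTranspose_same C

theorem Plant.Realizes.information_eq (hC : Sys.Realizes P C V) :
    Cᵀ * V⁻¹ * C = P⁻¹ - (Sys.pred P)⁻¹ := (sub_eq_zero.1 hC.eq).symm

/-- Information form of the Kalman gain. Multiplying P Cᵀ V⁻¹ by the innovation covariance and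
inserting P⁻¹ - P₊⁻¹ for Cᵀ V⁻¹ C collapses the product to P₊ Cᵀ. -/
theorem Plant.Realizes.filterGain_eq (hSys : Sys.IsAdmissible) (hC : Sys.Realizes P C V) :
    Sys.filterGain P C V = P * Cᵀ * V⁻¹ := by
  have hN := isUnit_det_of_posDef (Plant.innovation_posDef hSys hC)
  have hPu := isUnit_det_of_posDef hC.P_posDef
  have hVu := isUnit_det_of_posDef hC.V_posDef
  have hPp := isUnit_det_of_posDef (Sys.pred_posDef hSys hC.P_posDef.posSemidef)
  have h1 : P * Cᵀ * V⁻¹ * (C * Sys.pred P * Cᵀ + V) = Sys.pred P * Cᵀ := by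
    calc _ = P * (Cᵀ * V⁻¹ * C) * Sys.pred P * Cᵀ + P * Cᵀ * (V⁻¹ * V) := by
          simp only [Matrix.mul_add, Matrix.mul_assoc]
      _ = _ := by
          rw [hC.information_eq, Matrix.nonsing_inv_mul _ hVu, Matrix.mul_one, Matrix.mul_sub,
            Matrix.mul_nonsing_inv _ hPu, Matrix.sub_mul, Matrix.one_mul, Matrix.mul_assoc P,
            Matrix.nonsing_inv_mul _ hPp, Matrix.mul_one, Matrix.sub_mul]
          abel
  rw [Plant.filterGain, ← h1, Matrix.mul_assoc, Matrix.mul_nonsing_inv _ hN, Matrix.mul_one]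

theorem Plant.Realizes.one_sub_filterGain_mul (hSys : Sys.IsAdmissible)
    (hC : Sys.Realizes P C V) :
    1 - Sys.filterGain P C V * C = P * (Sys.pred P)⁻¹ := by
  have hPu := isUnit_det_of_posDef hC.P_posDef
  rw [hC.filterGain_eq hSys, Matrix.mul_assoc P, Matrix.mul_assoc P, hC.information_eq,
    Matrix.mul_sub, Matrix.mul_nonsing_inv _ hPu]
  abel

/-- Stationarity of the filter: P is the posterior covariance produced from the prior covariance P₊.
The two terms are P P₊⁻¹ P and P (P⁻¹ - P₊⁻¹) P. -/
theorem Plant.Realizes.joseph (hSys : Sys.IsAdmissible) (hC : Sys.Realizes P C V) :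
    (1 - Sys.filterGain P C V * C) * Sys.pred P * (1 - Sys.filterGain P C V * C)ᵀ
      + Sys.filterGain P C V * V * (Sys.filterGain P C V)ᵀ = P := by
  have hPu := isUnit_det_of_posDef hC.P_posDef
  have hVu := isUnit_det_of_posDef hC.V_posDef
  have hPp := isUnit_det_of_posDef (Sys.pred_posDef hSys hC.P_posDef.posSemidef)
  have hPt : Pᵀ = P := by simpa [Matrix.IsHermitian] using hC.P_posDef.isHermitian
  have hVt : Vᵀ = V := by simpa [Matrix.IsHermitian] using hC.V_posDef.isHermitian
  have hPpt : (Sys.pred P)ᵀ = Sys.pred P := by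
    simpa [Matrix.IsHermitian] using (Sys.pred_posDef hSys hC.P_posDef.posSemidef).isHermitian
  rw [hC.one_sub_filterGain_mul hSys, hC.filterGain_eq hSys]
  have h1 : P * (Sys.pred P)⁻¹ * Sys.pred P * (P * (Sys.pred P)⁻¹)ᵀ
      = P * (Sys.pred P)⁻¹ * P := by
    rw [Matrix.mul_assoc P, Matrix.nonsing_inv_mul _ hPp, Matrix.transpose_mul,
      Matrix.transpose_nonsing_inv, hPpt, hPt, Matrix.mul_one, Matrix.mul_assoc]
  have h2 : P * Cᵀ * V⁻¹ * V * (P * Cᵀ * V⁻¹)ᵀ = P * (Cᵀ * V⁻¹ * C) * P := by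
    simp only [Matrix.transpose_mul, Matrix.transpose_nonsing_inv, hVt, hPt,
      Matrix.transpose_transpose]
    rw [Matrix.mul_assoc (P * Cᵀ), Matrix.nonsing_inv_mul _ hVu]
    simp only [Matrix.mul_assoc, Matrix.one_mul]
  rw [h1, h2, hC.information_eq, Matrix.mul_sub, Matrix.mul_nonsing_inv _ hPu, Matrix.sub_mul,
    Matrix.one_mul]
  abel

/-- Sylvester's identity replaces det(1 + V⁻¹ C P₊ Cᵀ) by det(1 + P₊ Cᵀ V⁻¹ C) = det(P₊ P⁻¹). This
converts the log-determinant of the code-length bound into the one of the log-det program. -/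
theorem Plant.Realizes.det_innovation (hSys : Sys.IsAdmissible) (hC : Sys.Realizes P C V) :
    (C * Sys.pred P * Cᵀ + V).det = V.det * ((Sys.pred P).det / P.det) := by
  have hVu := isUnit_det_of_posDef hC.V_posDef
  have hPp := isUnit_det_of_posDef (Sys.pred_posDef hSys hC.P_posDef.posSemidef)
  have h1 : C * Sys.pred P * Cᵀ + V = V * (1 + V⁻¹ * C * (Sys.pred P * Cᵀ)) := by
    rw [Matrix.mul_add, Matrix.mul_one, Matrix.mul_assoc V⁻¹, ← Matrix.mul_assoc V,
      Matrix.mul_nonsing_inv _ hVu, Matrix.one_mul, Matrix.mul_assoc, add_comm]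
  rw [h1, Matrix.det_mul, Matrix.det_one_add_mul_comm, Matrix.mul_assoc (Sys.pred P),
    ← Matrix.mul_assoc Cᵀ, hC.information_eq, Matrix.mul_sub, Matrix.mul_nonsing_inv _ hPp]
  rw [add_sub_cancel, Matrix.det_mul, Matrix.det_nonsing_inv, Ring.inverse_eq_inv', div_eq_mul_inv]

/-- The powers of the error transition matrix `A (I - J C)` tend to zero. -/
theorem Plant.Realizes.tendsto_pow (hSys : Sys.IsAdmissible) (hC : Sys.Realizes P C V) :
    Tendsto (fun k => (Sys.A * (1 - Sys.filterGain P C V * C)) ^ k) atTop (𝓝 0) := by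
  refine tendsto_pow_of_lyapunov (Sys.pred_posDef hSys hC.P_posDef.posSemidef).posSemidef
    hSys.W_posDef ?_
  set J := Sys.filterGain P C V
  -- With P₊ as Lyapunov matrix and W as strict decrease, the leftover is the measurement-noise
  -- contribution, which is positive semidefinite.
  have h : Sys.pred P - Sys.A * (1 - J * C) * Sys.pred P * (Sys.A * (1 - J * C))ᵀ - Sys.W
      = (Sys.A * J) * V * (Sys.A * J)ᴴ := by
    have hj := hC.joseph hSys
    have h2 : Sys.pred P - Sys.W = Sys.A * P * Sys.Aᵀ := by simp [Plant.pred]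
    rw [sub_right_comm, h2]
    conv_lhs => enter [1]; rw [← hj]
    simp only [Matrix.transpose_mul, Matrix.conjTranspose_eq_transpose_of_trivial, Matrix.mul_add,
      Matrix.add_mul, Matrix.mul_assoc, J]
    abel
  rw [h]
  exact hC.V_posDef.posSemidef.mul_mul_conjTranspose_same _

end Filter

/-- Lower bound for the objective of the log-det program. -/
theorem Plant.Feasible.le_objective {Sys : Plant m p} (hSys : Sys.IsAdmissible)
    {S P Pi : Matrix (Fin m) (Fin m) ℝ} {γ : ℝ} (h : Sys.Feasible S γ P Pi) (hP : P.PosDef) :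
    ((1 / 2 * Real.logb 2 ((Sys.pred P).det / P.det) : ℝ) : EReal) ≤ Sys.objective Pi := by
  rw [Plant.objective]
  split_ifs with hdet
  swap
  · exact le_top
  have hpp := Sys.pred_posDef hSys h.P_posSemidef
  have hPt : Pᵀ = P := by simpa [Matrix.IsHermitian] using hP.isHermitian
  have hPipd : Pi.PosDef := h.Pi_posSemidef.posDef_iff_det_ne_zero.2 hdet.ne'
  have hPpu := isUnit_det_of_posDef hpp
  have hPu := isUnit_det_of_posDef hP
  have hlmi := h.lmi
  have hAP : Sys.A * P = (P * Sys.Aᵀ)ᴴ := by simp [Matrix.transpose_mul, hPt]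
  have : Invertible (Sys.pred P) := hpp.isUnit.invertible
  rw [hAP, Matrix.PosDef.fromBlocks₂₂ _ _ hpp] at hlmi
  -- The Schur complement of the linear matrix inequality bounds Π above, and the determinant is
  -- monotone.
  have hsub : ((P - P * Sys.Aᵀ * (Sys.pred P)⁻¹ * (P * Sys.Aᵀ)ᴴ) - Pi).PosSemidef := by
    rwa [sub_right_comm]
  have hle := det_le_det hPipd hsub
  have heq : (P - P * Sys.Aᵀ * (Sys.pred P)⁻¹ * (P * Sys.Aᵀ)ᴴ).det
      = P.det * (Sys.W.det / (Sys.pred P).det) := by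
    rw [← hAP]
    have h1 : P - P * Sys.Aᵀ * (Sys.pred P)⁻¹ * (Sys.A * P)
        = P * (1 + (-(Sys.Aᵀ * (Sys.pred P)⁻¹)) * (Sys.A * P)) := by
      simp only [Matrix.mul_add, Matrix.mul_one, Matrix.neg_mul, Matrix.mul_neg, Matrix.mul_assoc]
      abel
    rw [h1, Matrix.det_mul, Matrix.det_one_add_mul_comm]
    -- After swapping the factors in det(1 + XY), the bracket is (P₊ - A P Aᵀ) P₊⁻¹ = W P₊⁻¹.
    have h2 : 1 + Sys.A * P * -(Sys.Aᵀ * (Sys.pred P)⁻¹) = Sys.W * (Sys.pred P)⁻¹ := by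
      have h3 : Sys.W = Sys.pred P - Sys.A * P * Sys.Aᵀ := by simp [Plant.pred]
      conv_rhs => enter [1]; rw [h3]
      rw [Matrix.sub_mul, Matrix.mul_nonsing_inv _ hPpu]
      simp only [Matrix.mul_neg, Matrix.mul_assoc]
      abel
    rw [h2, Matrix.det_mul, Matrix.det_nonsing_inv, Ring.inverse_eq_inv', div_eq_mul_inv]
  rw [heq] at hle
  have p1 := hP.det_pos
  have p2 := hpp.det_pos
  have p3 := hSys.W_posDef.det_pos
  have hlog := Real.logb_le_logb_of_le one_lt_two hdet hle
  rw [Real.logb_mul p1.ne' (by positivity), Real.logb_div p3.ne' p2.ne'] at hlog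
  rw [EReal.coe_le_coe_iff, Real.logb_div p2.ne' p1.ne']
  linarith

/-! ### Second moments of random vectors -/

section Moments

variable {Ω : Type*} [MeasurableSpace Ω] {μ : Measure Ω} {a b c : ℕ}

/-- All entries of the random vector are square integrable. -/
def IsL2 (μ : Measure Ω) (X : Ω → Fin a → ℝ) : Prop := ∀ i, MemLp (fun ω => X ω i) 2 μ

/-- The matrix `E[X Yᵀ]`. -/
noncomputable def crossMoment (μ : Measure Ω) (X : Ω → Fin a → ℝ) (Y : Ω → Fin b → ℝ) :
    Matrix (Fin a) (Fin b) ℝ := Matrix.of fun i j => ∫ ω, X ω i * Y ω j ∂μ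

theorem IsL2.add {X Y : Ω → Fin a → ℝ} (hX : IsL2 μ X) (hY : IsL2 μ Y) :
    IsL2 μ fun ω => X ω + Y ω := fun i => (hX i).add (hY i)

theorem IsL2.sub {X Y : Ω → Fin a → ℝ} (hX : IsL2 μ X) (hY : IsL2 μ Y) :
    IsL2 μ fun ω => X ω - Y ω := fun i => (hX i).sub (hY i)

theorem IsL2.mulVec {X : Ω → Fin a → ℝ} (hX : IsL2 μ X) (M : Matrix (Fin b) (Fin a) ℝ) :
    IsL2 μ fun ω => M *ᵥ X ω := fun i => by
  simp only [Matrix.mulVec, dotProduct]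
  exact memLp_finsetSum _ fun j _ => (hX j).const_mul (M i j)

theorem IsL2.integrable_mul {X : Ω → Fin a → ℝ} {Y : Ω → Fin b → ℝ} (hX : IsL2 μ X)
    (hY : IsL2 μ Y) (i : Fin a) (j : Fin b) : Integrable (fun ω => X ω i * Y ω j) μ :=
  (hX i).integrable_mul (hY j)

theorem crossMoment_transpose (X : Ω → Fin a → ℝ) (Y : Ω → Fin b → ℝ) :
    (crossMoment μ X Y)ᵀ = crossMoment μ Y X := by
  ext i j; simp [crossMoment, mul_comm]

theorem crossMoment_add_left {X X' : Ω → Fin a → ℝ} {Y : Ω → Fin b → ℝ} (hX : IsL2 μ X)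
    (hX' : IsL2 μ X') (hY : IsL2 μ Y) :
    crossMoment μ (fun ω => X ω + X' ω) Y = crossMoment μ X Y + crossMoment μ X' Y := by
  ext i j
  simp only [crossMoment, Matrix.of_apply, Matrix.add_apply, Pi.add_apply, add_mul]
  exact integral_add (hX.integrable_mul hY i j) (hX'.integrable_mul hY i j)

theorem crossMoment_sub_left {X X' : Ω → Fin a → ℝ} {Y : Ω → Fin b → ℝ} (hX : IsL2 μ X)
    (hX' : IsL2 μ X') (hY : IsL2 μ Y) :
    crossMoment μ (fun ω => X ω - X' ω) Y = crossMoment μ X Y - crossMoment μ X' Y := by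
  ext i j
  simp only [crossMoment, Matrix.of_apply, Matrix.sub_apply, Pi.sub_apply, sub_mul]
  exact integral_sub (hX.integrable_mul hY i j) (hX'.integrable_mul hY i j)

theorem crossMoment_mulVec_left {X : Ω → Fin a → ℝ} {Y : Ω → Fin b → ℝ} (hX : IsL2 μ X)
    (hY : IsL2 μ Y) (M : Matrix (Fin c) (Fin a) ℝ) :
    crossMoment μ (fun ω => M *ᵥ X ω) Y = M * crossMoment μ X Y := by
  ext i j
  simp only [crossMoment, Matrix.of_apply, Matrix.mul_apply, Matrix.mulVec, dotProduct,
    Finset.sum_mul, mul_assoc]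
  rw [integral_finsetSum _ fun k _ => (hX.integrable_mul hY k j).const_mul _]
  simp only [integral_const_mul]

theorem crossMoment_add_right {X : Ω → Fin a → ℝ} {Y Y' : Ω → Fin b → ℝ} (hX : IsL2 μ X)
    (hY : IsL2 μ Y) (hY' : IsL2 μ Y') :
    crossMoment μ X (fun ω => Y ω + Y' ω) = crossMoment μ X Y + crossMoment μ X Y' := by
  rw [← crossMoment_transpose, crossMoment_add_left hY hY' hX, Matrix.transpose_add,
    crossMoment_transpose, crossMoment_transpose]

theorem crossMoment_sub_right {X : Ω → Fin a → ℝ} {Y Y' : Ω → Fin b → ℝ} (hX : IsL2 μ X)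
    (hY : IsL2 μ Y) (hY' : IsL2 μ Y') :
    crossMoment μ X (fun ω => Y ω - Y' ω) = crossMoment μ X Y - crossMoment μ X Y' := by
  rw [← crossMoment_transpose, crossMoment_sub_left hY hY' hX, Matrix.transpose_sub,
    crossMoment_transpose, crossMoment_transpose]

theorem crossMoment_mulVec_right {X : Ω → Fin a → ℝ} {Y : Ω → Fin b → ℝ} (hX : IsL2 μ X)
    (hY : IsL2 μ Y) (M : Matrix (Fin c) (Fin b) ℝ) :
    crossMoment μ X (fun ω => M *ᵥ Y ω) = crossMoment μ X Y * Mᵀ := by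
  rw [← crossMoment_transpose, crossMoment_mulVec_left hY hX, Matrix.transpose_mul,
    crossMoment_transpose]

theorem crossMoment_swap_eq_zero {X : Ω → Fin a → ℝ} {Y : Ω → Fin b → ℝ}
    (h : crossMoment μ X Y = 0) : crossMoment μ Y X = 0 := by
  rw [← crossMoment_transpose, h, Matrix.transpose_zero]

/-- Second moment of a sum of uncorrelated vectors. -/
theorem crossMoment_add_self {X Y : Ω → Fin a → ℝ} (hX : IsL2 μ X) (hY : IsL2 μ Y)
    (h : crossMoment μ X Y = 0) :
    crossMoment μ (fun ω => X ω + Y ω) (fun ω => X ω + Y ω)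
      = crossMoment μ X X + crossMoment μ Y Y := by
  rw [crossMoment_add_left hX hY (hX.add hY), crossMoment_add_right hX hX hY,
    crossMoment_add_right hY hX hY, h, crossMoment_swap_eq_zero h]
  abel

/-- Second moment of a difference of uncorrelated vectors. -/
theorem crossMoment_sub_self {X Y : Ω → Fin a → ℝ} (hX : IsL2 μ X) (hY : IsL2 μ Y)
    (h : crossMoment μ X Y = 0) :
    crossMoment μ (fun ω => X ω - Y ω) (fun ω => X ω - Y ω)
      = crossMoment μ X X + crossMoment μ Y Y := by
  rw [crossMoment_sub_left hX hY (hX.sub hY), crossMoment_sub_right hX hX hY,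
    crossMoment_sub_right hY hX hY, h, crossMoment_swap_eq_zero h]
  abel

theorem crossMoment_mulVec_self {X : Ω → Fin a → ℝ} (hX : IsL2 μ X)
    (M : Matrix (Fin b) (Fin a) ℝ) :
    crossMoment μ (fun ω => M *ᵥ X ω) (fun ω => M *ᵥ X ω) = M * crossMoment μ X X * Mᵀ := by
  rw [crossMoment_mulVec_left hX (hX.mulVec M), crossMoment_mulVec_right hX hX, Matrix.mul_assoc]

theorem IsL2.integrable_quad {X : Ω → Fin a → ℝ} (hX : IsL2 μ X) (M : Matrix (Fin a) (Fin a) ℝ) :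
    Integrable (fun ω => X ω ⬝ᵥ (M *ᵥ X ω)) μ := by
  simp only [dotProduct]
  exact integrable_finsetSum _ fun i _ => hX.integrable_mul (hX.mulVec M) i i

theorem IsL2.integral_quad {X : Ω → Fin a → ℝ} (hX : IsL2 μ X) (M : Matrix (Fin a) (Fin a) ℝ) :
    ∫ ω, X ω ⬝ᵥ (M *ᵥ X ω) ∂μ = (M * crossMoment μ X X).trace := by
  rw [← crossMoment_mulVec_left hX hX, Matrix.trace]
  simp only [dotProduct, crossMoment, Matrix.diag, Matrix.of_apply]
  rw [integral_finsetSum _ fun i _ => hX.integrable_mul (hX.mulVec M) i i]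
  simp only [mul_comm]

theorem IsL2.integrable_norm_sq {X : Ω → Fin a → ℝ} (hX : IsL2 μ X) :
    Integrable (fun ω => ‖X ω‖ ^ 2) μ := by
  have : MemLp X 2 μ := MemLp.of_eval hX
  simpa using this.integrable_norm_pow two_ne_zero

/-- The norm on `Fin a → ℝ` is the sup norm, so this is an inequality only; it suffices for
boundedness. -/
theorem norm_sq_le_dotProduct_self (x : Fin a → ℝ) : ‖x‖ ^ 2 ≤ x ⬝ᵥ x := by
  have h0 : 0 ≤ x ⬝ᵥ x := Finset.sum_nonneg fun i _ => mul_self_nonneg _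
  have : ‖x‖ ≤ √(x ⬝ᵥ x) := by
    refine (pi_norm_le_iff_of_nonneg (Real.sqrt_nonneg _)).2 fun i => ?_
    rw [Real.norm_eq_abs]
    refine Real.abs_le_sqrt ?_
    rw [sq]
    exact Finset.single_le_sum (f := fun i => x i * x i) (fun i _ => mul_self_nonneg _)
      (Finset.mem_univ i)
  calc ‖x‖ ^ 2 ≤ √(x ⬝ᵥ x) ^ 2 := by gcongr
    _ = _ := Real.sq_sqrt h0

theorem IsL2.integral_norm_sq_le {X : Ω → Fin a → ℝ} (hX : IsL2 μ X) :
    ∫ ω, ‖X ω‖ ^ 2 ∂μ ≤ (crossMoment μ X X).trace := by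
  have h := hX.integral_quad 1
  simp only [Matrix.one_mulVec, Matrix.one_mul] at h
  rw [← h]
  refine integral_mono hX.integrable_norm_sq (by simpa using hX.integrable_quad 1) fun ω => ?_
  exact norm_sq_le_dotProduct_self _

theorem IsL2.abs_trace_le {X : Ω → Fin a → ℝ} (hX : IsL2 μ X) (M : Matrix (Fin a) (Fin a) ℝ) :
    |(M * crossMoment μ X X).trace| ≤ (∑ i, ∑ j, |M i j|) * ∫ ω, ‖X ω‖ ^ 2 ∂μ := by
  simp only [Matrix.trace, Matrix.diag, Matrix.mul_apply]
  refine (Finset.abs_sum_le_sum_abs _ _).trans ?_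
  rw [Finset.sum_mul]
  refine Finset.sum_le_sum fun i _ => (Finset.abs_sum_le_sum_abs _ _).trans ?_
  rw [Finset.sum_mul]
  refine Finset.sum_le_sum fun j _ => ?_
  rw [abs_mul]
  refine mul_le_mul_of_nonneg_left ?_ (abs_nonneg _)
  simp only [crossMoment, Matrix.of_apply]
  refine abs_integral_le_integral_abs.trans
    (integral_mono (hX.integrable_mul hX j i).abs hX.integrable_norm_sq fun ω => ?_)
  simp only [abs_mul, sq]
  exact mul_le_mul (norm_le_pi_norm (X ω) j) (norm_le_pi_norm (X ω) i) (abs_nonneg _)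
    (norm_nonneg _)

/-- A stable linear recursion driven by noise with bounded second moments has bounded second
moments. -/
theorem IsSchurStable.integral_norm_sq_bounded {M : Matrix (Fin m) (Fin m) ℝ}
    (hM : IsSchurStable M) {x η : ℕ → Ω → Fin m → ℝ} (hx : ∀ t, IsL2 μ (x t))
    (hη : ∀ t, IsL2 μ (η t)) (hrec : ∀ t ω, x (t + 1) ω = M *ᵥ x t ω + η t ω) {c : ℝ}
    (hc : ∀ t, ∫ ω, ‖η t ω‖ ^ 2 ∂μ ≤ c) : ∃ c', ∀ t, ∫ ω, ‖x t ω‖ ^ 2 ∂μ ≤ c' := by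
  obtain ⟨a, ha0, has, hab⟩ := hM.exists_summable
  -- The initial state is treated as the input at index 0, the noise being shifted by one, so that x
  -- is a single convolution of y with the powers of M.
  set y : ℕ → Ω → Fin m → ℝ := fun t => Nat.casesOn t (x 0) η with hy
  have hyL2 : ∀ t, IsL2 μ (y t) := by rintro (_ | t); exacts [hx 0, hη t]
  have hunroll : ∀ t ω, x t ω = ∑ k ∈ Finset.range (t + 1), (M ^ (t - k)) *ᵥ y k ω := by
    intro t ω
    induction t with
    | zero => simp [hy]
    | succ t ih =>
      rw [Finset.sum_range_succ, hrec, ih, Matrix.mulVec_sum]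
      congr 1
      · refine Finset.sum_congr rfl fun k hk => ?_
        have : t + 1 - k = (t - k) + 1 := by have := Finset.mem_range.1 hk; omega
        rw [this, Matrix.mulVec_mulVec, ← pow_succ']
      · simp [hy]
  set A := ∑' k, a k with hA
  have hsum : ∀ t, ∑ k ∈ Finset.range (t + 1), a (t - k) ≤ A := by
    intro t
    rw [← Finset.sum_range_reflect]
    refine le_trans (le_of_eq ?_) (has.sum_le_tsum (Finset.range (t + 1)) fun i _ => ha0 i)
    refine Finset.sum_congr rfl fun k hk => ?_
    have := Finset.mem_range.1 hk
    congr 1; omega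
  have hA0 : 0 ≤ A := tsum_nonneg ha0
  have hpt : ∀ t ω, ‖x t ω‖ ^ 2 ≤ A * ∑ k ∈ Finset.range (t + 1), a (t - k) * ‖y k ω‖ ^ 2 := by
    intro t ω
    have h1 : ‖x t ω‖ ≤ ∑ k ∈ Finset.range (t + 1), a (t - k) * ‖y k ω‖ := by
      rw [hunroll]
      exact (norm_sum_le _ _).trans (Finset.sum_le_sum fun k _ => hab _ _)
    calc ‖x t ω‖ ^ 2 ≤ (∑ k ∈ Finset.range (t + 1), a (t - k) * ‖y k ω‖) ^ 2 := by gcongr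
      _ ≤ (∑ k ∈ Finset.range (t + 1), a (t - k)) *
          ∑ k ∈ Finset.range (t + 1), a (t - k) * ‖y k ω‖ ^ 2 :=
        -- Cauchy–Schwarz with weights a (t - k), whose total mass is at most the sum of the series.
        Finset.sum_sq_le_sum_mul_sum_of_sq_le_mul _ (fun k _ => ha0 _)
          (fun k _ => mul_nonneg (ha0 _) (sq_nonneg _)) fun k _ => le_of_eq (by ring)
      _ ≤ _ := by
        gcongr
        · exact Finset.sum_nonneg fun k _ => mul_nonneg (ha0 _) (sq_nonneg _)
        · exact hsum t
  set c₀ := max c (∫ ω, ‖x 0 ω‖ ^ 2 ∂μ) with hc₀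
  have hyc : ∀ t, ∫ ω, ‖y t ω‖ ^ 2 ∂μ ≤ c₀ := by
    rintro (_ | t)
    exacts [le_max_right _ _, (hc t).trans (le_max_left _ _)]
  have hc₀0 : 0 ≤ c₀ := le_max_of_le_right (integral_nonneg fun ω => sq_nonneg _)
  refine ⟨A * (A * c₀), fun t => ?_⟩
  calc ∫ ω, ‖x t ω‖ ^ 2 ∂μ
      ≤ ∫ ω, A * ∑ k ∈ Finset.range (t + 1), a (t - k) * ‖y k ω‖ ^ 2 ∂μ :=
        integral_mono (hx t).integrable_norm_sq ((integrable_finsetSum _ fun k _ =>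
          (hyL2 k).integrable_norm_sq.const_mul _).const_mul _) (hpt t)
    _ = A * ∑ k ∈ Finset.range (t + 1), a (t - k) * ∫ ω, ‖y k ω‖ ^ 2 ∂μ := by
        rw [integral_const_mul, integral_finsetSum _ fun k _ =>
          (hyL2 k).integrable_norm_sq.const_mul _]
        simp only [integral_const_mul]
    _ ≤ A * ∑ k ∈ Finset.range (t + 1), a (t - k) * c₀ := by
        gcongr with k _
        · exact ha0 _
        · exact hyc k
    _ ≤ A * (A * c₀) := by
        rw [← Finset.sum_mul]
        gcongr
        exact hsum t

end Moments

/-! ### The closed loop driven by white noise -/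

section Loop

variable {Ω : Type*} [MeasurableSpace Ω]

/-- Second-order assumptions on the closed loop `testState` driven by `(x₀, w, n)`: the noises
are square integrable with covariances `W` and `V`, uncorrelated with the current loop state and
with each other. -/
structure Plant.IsWhiteLoop (Sys : Plant m p) (K : Matrix (Fin p) (Fin m) ℝ)
    (J C V : Matrix (Fin m) (Fin m) ℝ) (μ : Measure Ω) (x₀ : Ω → Fin m → ℝ)
    (w n : ℕ → Ω → Fin m → ℝ) (s : ℕ → Ω → (Fin m → ℝ) × (Fin m → ℝ)) : Prop where
  state : ∀ t ω, s t ω = Sys.testState K J C (x₀ ω) (fun i => w i ω) (fun i => n i ω) t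
  l2_x₀ : IsL2 μ x₀
  l2_w : ∀ t, IsL2 μ (w t)
  l2_n : ∀ t, IsL2 μ (n t)
  cov_w : ∀ t, crossMoment μ (w t) (w t) = Sys.W
  cov_n : ∀ t, crossMoment μ (n t) (n t) = V
  fst_n : ∀ t, crossMoment μ (fun ω => (s t ω).1) (n t) = 0
  snd_n : ∀ t, crossMoment μ (fun ω => (s t ω).2) (n t) = 0
  fst_w : ∀ t, crossMoment μ (fun ω => (s t ω).1) (w t) = 0
  snd_w : ∀ t, crossMoment μ (fun ω => (s t ω).2) (w t) = 0
  n_w : ∀ t, crossMoment μ (n t) (w t) = 0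

/-- Posterior estimation error `x_t - x̄_{t|t}`. -/
def posteriorError (J C : Matrix (Fin m) (Fin m) ℝ) (s : (Fin m → ℝ) × (Fin m → ℝ))
    (v : Fin m → ℝ) : Fin m → ℝ := s.1 - testPosterior J C s v

theorem posteriorError_eq (J C : Matrix (Fin m) (Fin m) ℝ) (s : (Fin m → ℝ) × (Fin m → ℝ))
    (v : Fin m → ℝ) : posteriorError J C s v = (1 - J * C) *ᵥ (s.1 - s.2) - J *ᵥ v := by
  simp only [posteriorError, testPosterior, filterUpdate, Matrix.sub_mulVec, Matrix.one_mulVec,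
    Matrix.mulVec_sub, Matrix.mulVec_add, Matrix.mulVec_mulVec]
  abel

variable {Sys : Plant m p} {K : Matrix (Fin p) (Fin m) ℝ} {J C V : Matrix (Fin m) (Fin m) ℝ}
  {μ : Measure Ω} {x₀ : Ω → Fin m → ℝ} {w n : ℕ → Ω → Fin m → ℝ}
  {s : ℕ → Ω → (Fin m → ℝ) × (Fin m → ℝ)}

namespace Plant.IsWhiteLoop

theorem state_succ (h : Sys.IsWhiteLoop K J C V μ x₀ w n s) (t : ℕ) (ω : Ω) :
    s (t + 1) ω = (Sys.A *ᵥ (s t ω).1 + Sys.B *ᵥ (K *ᵥ testPosterior J C (s t ω) (n t ω)) + w t ω,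
      Sys.A *ᵥ testPosterior J C (s t ω) (n t ω)
        + Sys.B *ᵥ (K *ᵥ testPosterior J C (s t ω) (n t ω))) := by
  rw [h.state (t + 1), h.state t]; rfl

theorem isL2_testPosterior (h : Sys.IsWhiteLoop K J C V μ x₀ w n s) {t : ℕ}
    (h1 : IsL2 μ fun ω => (s t ω).1) (h2 : IsL2 μ fun ω => (s t ω).2) :
    IsL2 μ fun ω => testPosterior J C (s t ω) (n t ω) :=
  h2.add ((((h1.mulVec C).add (h.l2_n t)).sub (h2.mulVec C)).mulVec J)

theorem l2_state (h : Sys.IsWhiteLoop K J C V μ x₀ w n s) (t : ℕ) :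
    (IsL2 μ fun ω => (s t ω).1) ∧ IsL2 μ fun ω => (s t ω).2 := by
  induction t with
  | zero =>
    simp only [h.state 0, Plant.testState]
    exact ⟨h.l2_x₀, fun i => by simp⟩
  | succ t ih =>
    have hp := h.isL2_testPosterior ih.1 ih.2
    simp only [h.state_succ t]
    exact ⟨((ih.1.mulVec _).add ((hp.mulVec K).mulVec _)).add (h.l2_w t),
      (hp.mulVec _).add ((hp.mulVec K).mulVec _)⟩

theorem l2_posterior (h : Sys.IsWhiteLoop K J C V μ x₀ w n s) (t : ℕ) :
    IsL2 μ fun ω => testPosterior J C (s t ω) (n t ω) :=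
  h.isL2_testPosterior (h.l2_state t).1 (h.l2_state t).2

theorem l2_error (h : Sys.IsWhiteLoop K J C V μ x₀ w n s) (t : ℕ) :
    IsL2 μ fun ω => (s t ω).1 - (s t ω).2 := (h.l2_state t).1.sub (h.l2_state t).2

theorem l2_posteriorError (h : Sys.IsWhiteLoop K J C V μ x₀ w n s) (t : ℕ) :
    IsL2 μ fun ω => posteriorError J C (s t ω) (n t ω) := (h.l2_state t).1.sub (h.l2_posterior t)

theorem error_n (h : Sys.IsWhiteLoop K J C V μ x₀ w n s) (t : ℕ) :
    crossMoment μ (fun ω => (s t ω).1 - (s t ω).2) (n t) = 0 := by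
  rw [crossMoment_sub_left (h.l2_state t).1 (h.l2_state t).2 (h.l2_n t), h.fst_n, h.snd_n, sub_zero]

theorem error_w (h : Sys.IsWhiteLoop K J C V μ x₀ w n s) (t : ℕ) :
    crossMoment μ (fun ω => (s t ω).1 - (s t ω).2) (w t) = 0 := by
  rw [crossMoment_sub_left (h.l2_state t).1 (h.l2_state t).2 (h.l2_w t), h.fst_w, h.snd_w, sub_zero]

theorem posteriorError_w (h : Sys.IsWhiteLoop K J C V μ x₀ w n s) (t : ℕ) :
    crossMoment μ (fun ω => posteriorError J C (s t ω) (n t ω)) (w t) = 0 := by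
  simp only [posteriorError_eq]
  rw [crossMoment_sub_left ((h.l2_error t).mulVec _) ((h.l2_n t).mulVec _) (h.l2_w t),
    crossMoment_mulVec_left (h.l2_error t) (h.l2_w t),
    crossMoment_mulVec_left (h.l2_n t) (h.l2_w t), h.error_w, h.n_w]
  simp

theorem cov_posteriorError (h : Sys.IsWhiteLoop K J C V μ x₀ w n s) (t : ℕ) :
    crossMoment μ (fun ω => posteriorError J C (s t ω) (n t ω))
        (fun ω => posteriorError J C (s t ω) (n t ω))
      = (1 - J * C) * crossMoment μ (fun ω => (s t ω).1 - (s t ω).2)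
          (fun ω => (s t ω).1 - (s t ω).2) * (1 - J * C)ᵀ + J * V * Jᵀ := by
  simp only [posteriorError_eq]
  rw [crossMoment_sub_self ((h.l2_error t).mulVec _) ((h.l2_n t).mulVec _),
    crossMoment_mulVec_self (h.l2_error t), crossMoment_mulVec_self (h.l2_n t), h.cov_n]
  rw [crossMoment_mulVec_left (h.l2_error t) ((h.l2_n t).mulVec _),
    crossMoment_mulVec_right (h.l2_error t) (h.l2_n t), h.error_n]
  simp

/-- The control input enters the plant and the prediction identically and cancels from the error,
which leaves A times the posterior error plus uncorrelated process noise. -/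
theorem cov_error_succ (h : Sys.IsWhiteLoop K J C V μ x₀ w n s) (t : ℕ) :
    crossMoment μ (fun ω => (s (t + 1) ω).1 - (s (t + 1) ω).2)
        (fun ω => (s (t + 1) ω).1 - (s (t + 1) ω).2)
      = Sys.pred (crossMoment μ (fun ω => posteriorError J C (s t ω) (n t ω))
        (fun ω => posteriorError J C (s t ω) (n t ω))) := by
  have he : ∀ ω, (s (t + 1) ω).1 - (s (t + 1) ω).2
      = Sys.A *ᵥ posteriorError J C (s t ω) (n t ω) + w t ω := by
    intro ω
    simp only [h.state_succ t, posteriorError, Matrix.mulVec_sub]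
    abel
  simp only [he]
  rw [crossMoment_add_self ((h.l2_posteriorError t).mulVec _) (h.l2_w t),
    crossMoment_mulVec_self (h.l2_posteriorError t), h.cov_w, Plant.pred]
  rw [crossMoment_mulVec_left (h.l2_posteriorError t) (h.l2_w t), h.posteriorError_w,
    Matrix.mul_zero]

/-- The prediction error covariance converges to the stationary one. -/
theorem tendsto_cov_error {P : Matrix (Fin m) (Fin m) ℝ} (hSys : Sys.IsAdmissible)
    (hC : Sys.Realizes P C V) (hJ : J = Sys.filterGain P C V)
    (h : Sys.IsWhiteLoop K J C V μ x₀ w n s) :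
    Tendsto (fun t => crossMoment μ (fun ω => (s t ω).1 - (s t ω).2)
      (fun ω => (s t ω).1 - (s t ω).2)) atTop (𝓝 (Sys.pred P)) := by
  subst hJ
  set J := Sys.filterGain P C V
  set E : ℕ → Matrix (Fin m) (Fin m) ℝ := fun t => crossMoment μ (fun ω => (s t ω).1 - (s t ω).2)
      (fun ω => (s t ω).1 - (s t ω).2) with hE
  set M := Sys.A * (1 - J * C) with hM
  -- The covariance recursion is affine with fixed point P₊, so the deviation from P₊ is propagated
  -- by congruence with M.
  have hform : ∀ t, E t = M ^ t * (E 0 - Sys.pred P) * (M ^ t)ᵀ + Sys.pred P := by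
    intro t
    induction t with
    | zero => simp
    | succ t ih =>
      have h1 : E (t + 1) = Sys.pred ((1 - J * C) * E t * (1 - J * C)ᵀ + J * V * Jᵀ) := by
        simp only [hE]
        rw [h.cov_error_succ, h.cov_posteriorError]
      rw [h1, ih]
      have h2 : (1 - J * C) * (M ^ t * (E 0 - Sys.pred P) * (M ^ t)ᵀ + Sys.pred P) * (1 - J * C)ᵀ
          + J * V * Jᵀ = (1 - J * C) * (M ^ t * (E 0 - Sys.pred P) * (M ^ t)ᵀ) * (1 - J * C)ᵀ
            + P := by
        rw [Matrix.mul_add, Matrix.add_mul, add_assoc]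
        exact congrArg _ (hC.joseph hSys)
      rw [h2, Plant.pred, Matrix.mul_add, Matrix.add_mul, add_assoc, ← Plant.pred]
      congr 1
      rw [pow_succ' M t, hM]
      simp only [Matrix.transpose_mul, Matrix.mul_assoc]
  have hlim := hC.tendsto_pow hSys
  have hT : Tendsto (fun t => (M ^ t)ᵀ) atTop (𝓝 0) := by
    have := (Continuous.matrix_transpose continuous_id).tendsto (0 : Matrix (Fin m) (Fin m) ℝ)
      |>.comp hlim
    rwa [id, Matrix.transpose_zero] at this
  have h3 := ((hlim.mul_const (E 0 - Sys.pred P)).mul hT).add_const (Sys.pred P)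
  simp only [Matrix.zero_mul, zero_add] at h3
  exact h3.congr fun t => (hform t).symm

theorem tendsto_cov_posteriorError {P : Matrix (Fin m) (Fin m) ℝ} (hSys : Sys.IsAdmissible)
    (hC : Sys.Realizes P C V) (hJ : J = Sys.filterGain P C V)
    (h : Sys.IsWhiteLoop K J C V μ x₀ w n s) :
    Tendsto (fun t => crossMoment μ (fun ω => posteriorError J C (s t ω) (n t ω))
        (fun ω => posteriorError J C (s t ω) (n t ω))) atTop (𝓝 P) := by
  have h1 := (((h.tendsto_cov_error hSys hC hJ).const_mul (1 - J * C)).mul_const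
    (1 - J * C)ᵀ).add_const (J * V * Jᵀ)
  subst hJ
  rw [hC.joseph hSys] at h1
  exact h1.congr fun t => (h.cov_posteriorError t).symm

/-- The state has bounded second moments. -/
theorem state_bounded {S P : Matrix (Fin m) (Fin m) ℝ} (hSys : Sys.IsAdmissible)
    (hS : Sys.IsStabilizingDARE S) (hK : K = Sys.gain S)
    (hC : Sys.Realizes P C V) (hJ : J = Sys.filterGain P C V)
    (h : Sys.IsWhiteLoop K J C V μ x₀ w n s) :
    ∃ c, ∀ t, ∫ ω, ‖(s t ω).1‖ ^ 2 ∂μ ≤ c := by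
  set Eps : ℕ → Matrix (Fin m) (Fin m) ℝ := fun t =>
    crossMoment μ (fun ω => posteriorError J C (s t ω) (n t ω))
        (fun ω => posteriorError J C (s t ω) (n t ω)) with hEps
  -- Writing the estimate as state minus posterior error gives x⁺ = (A + B K) x + (w - B K e). This
  -- forcing term need not be white in time; its second moments converge and hence are bounded,
  -- which is enough for a stable recursion.
  have hl2 : ∀ t, IsL2 μ fun ω => w t ω - (Sys.B * K) *ᵥ posteriorError J C (s t ω) (n t ω) :=
    fun t => (h.l2_w t).sub ((h.l2_posteriorError t).mulVec _)
  have hcov : ∀ t, crossMoment μ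
      (fun ω => w t ω - (Sys.B * K) *ᵥ posteriorError J C (s t ω) (n t ω))
      (fun ω => w t ω - (Sys.B * K) *ᵥ posteriorError J C (s t ω) (n t ω))
      = Sys.W + (Sys.B * K) * Eps t * (Sys.B * K)ᵀ := by
    intro t
    rw [crossMoment_sub_self (h.l2_w t) ((h.l2_posteriorError t).mulVec _),
      crossMoment_mulVec_self (h.l2_posteriorError t), h.cov_w]
    rw [crossMoment_mulVec_right (h.l2_w t) (h.l2_posteriorError t),
      crossMoment_swap_eq_zero (h.posteriorError_w t), Matrix.zero_mul]
  have hlim := (((h.tendsto_cov_posteriorError hSys hC hJ).const_mul (Sys.B * K)).mul_const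
    (Sys.B * K)ᵀ).const_add Sys.W
  have hlimtr := (Continuous.matrix_trace continuous_id).tendsto _ |>.comp hlim
  obtain ⟨c, hc⟩ := hlimtr.bddAbove_range
  refine IsSchurStable.integral_norm_sq_bounded (M := Sys.A + Sys.B * K) (c := c)
    (by rw [hK]; exact hS.stable)
    (fun t => (h.l2_state t).1) hl2 (fun t ω => ?_) fun t => ?_
  · simp only [h.state_succ t, posteriorError, Matrix.mulVec_sub, Matrix.add_mulVec,
      Matrix.mulVec_mulVec]
    abel
  · refine (hl2 t).integral_norm_sq_le.trans ?_
    rw [hcov t]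
    exact hc ⟨t, rfl⟩

/-- Long-run average LQG cost of the closed loop. -/
theorem hasLQGCost {S P : Matrix (Fin m) (Fin m) ℝ} (hSys : Sys.IsAdmissible)
    (hS : Sys.IsStabilizingDARE S) (hK : K = Sys.gain S)
    (hC : Sys.Realizes P C V) (hJ : J = Sys.filterGain P C V)
    (h : Sys.IsWhiteLoop K J C V μ x₀ w n s) :
    Sys.HasLQGCost μ (fun t ω => (s t ω).1)
      (fun t ω => K *ᵥ testPosterior J C (s t ω) (n t ω))
      ((S * Sys.W).trace + (P * Sys.theta S).trace) := by
  set u : ℕ → Ω → Fin p → ℝ := fun t ω => K *ᵥ testPosterior J C (s t ω) (n t ω) with hu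
  have hul2 : ∀ t, IsL2 μ (u t) := fun t => (h.l2_posterior t).mulVec K
  have hxl2 : ∀ t, IsL2 μ fun ω => (s t ω).1 := fun t => (h.l2_state t).1
  set X : ℕ → Matrix (Fin m) (Fin m) ℝ :=
    fun t => crossMoment μ (fun ω => (s t ω).1) (fun ω => (s t ω).1) with hX
  set Eps : ℕ → Matrix (Fin m) (Fin m) ℝ := fun t =>
    crossMoment μ (fun ω => posteriorError J C (s t ω) (n t ω))
        (fun ω => posteriorError J C (s t ω) (n t ω)) with hEps
  refine ⟨fun t => ((hxl2 (t + 1)).integrable_quad _).add ((hul2 t).integrable_quad _), ?_⟩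
  have hpre : ∀ t, IsL2 μ fun ω => Sys.A *ᵥ (s t ω).1 + Sys.B *ᵥ u t ω := fun t =>
    ((hxl2 t).mulVec _).add ((hul2 t).mulVec _)
  have hpost_w : ∀ t, crossMoment μ (fun ω => testPosterior J C (s t ω) (n t ω)) (w t) = 0 := by
    intro t
    have h1 : ∀ ω, testPosterior J C (s t ω) (n t ω)
        = (s t ω).1 - posteriorError J C (s t ω) (n t ω) := fun ω => by simp [posteriorError]
    simp only [h1]
    rw [crossMoment_sub_left (hxl2 t) (h.l2_posteriorError t) (h.l2_w t), h.fst_w,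
      h.posteriorError_w, sub_zero]
  have hpre_w : ∀ t, crossMoment μ (fun ω => Sys.A *ᵥ (s t ω).1 + Sys.B *ᵥ u t ω) (w t) = 0 := by
    intro t
    rw [crossMoment_add_left ((hxl2 t).mulVec _) ((hul2 t).mulVec _) (h.l2_w t),
      crossMoment_mulVec_left (hxl2 t) (h.l2_w t), crossMoment_mulVec_left (hul2 t) (h.l2_w t),
      h.fst_w, crossMoment_mulVec_left (h.l2_posterior t) (h.l2_w t), hpost_w]
    simp
  -- The stage cost pairs x_{t+1} with u_t, so the state penalty is one step ahead of the Riccati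
  -- identity; the shift makes Q - S, not S, the weight in the telescoping term.
  have hstage : ∀ t, ∫ ω, Sys.stageCost (s (t + 1) ω).1 (u t ω) ∂μ
      = ((Sys.Q - S) * X (t + 1)).trace - ((Sys.Q - S) * X t).trace
        + ((S * Sys.W).trace + (Sys.theta S * Eps t).trace) := by
    intro t
    have e1 : ∫ ω, Sys.stageCost (s (t + 1) ω).1 (u t ω) ∂μ
        = (Sys.Q * X (t + 1)).trace + ∫ ω, u t ω ⬝ᵥ (Sys.R *ᵥ u t ω) ∂μ := by
      simp only [Plant.stageCost]
      rw [integral_add ((hxl2 (t + 1)).integrable_quad _) ((hul2 t).integrable_quad _),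
        (hxl2 (t + 1)).integral_quad]
    have e2 : (Sys.Q * X t).trace + ∫ ω, u t ω ⬝ᵥ (Sys.R *ᵥ u t ω) ∂μ
        + (S * crossMoment μ (fun ω => Sys.A *ᵥ (s t ω).1 + Sys.B *ᵥ u t ω)
            (fun ω => Sys.A *ᵥ (s t ω).1 + Sys.B *ᵥ u t ω)).trace
        = (S * X t).trace + (Sys.theta S * Eps t).trace := by
      rw [← (hxl2 t).integral_quad, ← (hxl2 t).integral_quad, ← (hpre t).integral_quad,
        ← (h.l2_posteriorError t).integral_quad,
        ← integral_add ((hxl2 t).integrable_quad _) ((hul2 t).integrable_quad _),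
        ← integral_add (f := fun ω => (s t ω).1 ⬝ᵥ (Sys.Q *ᵥ (s t ω).1) + u t ω ⬝ᵥ (Sys.R *ᵥ u t ω))
          (((hxl2 t).integrable_quad _).add ((hul2 t).integrable_quad _))
          ((hpre t).integrable_quad _),
        ← integral_add ((hxl2 t).integrable_quad _) ((h.l2_posteriorError t).integrable_quad _)]
      refine integral_congr_ae (Eventually.of_forall fun ω => ?_)
      have := hS.quad_eq hSys (s t ω).1 (posteriorError J C (s t ω) (n t ω))
      simpa [posteriorError, hu, hK] using this
    have e3 : X (t + 1) = crossMoment μ (fun ω => Sys.A *ᵥ (s t ω).1 + Sys.B *ᵥ u t ω)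
            (fun ω => Sys.A *ᵥ (s t ω).1 + Sys.B *ᵥ u t ω) + Sys.W := by
      simp only [hX, h.state_succ t]
      rw [← h.cov_w t]
      exact crossMoment_add_self (hpre t) (h.l2_w t) (hpre_w t)
    rw [e1]
    have e4 : (S * X (t + 1)).trace
        = (S * crossMoment μ (fun ω => Sys.A *ᵥ (s t ω).1 + Sys.B *ᵥ u t ω)
            (fun ω => Sys.A *ᵥ (s t ω).1 + Sys.B *ᵥ u t ω)).trace + (S * Sys.W).trace := by
      rw [e3, Matrix.mul_add, Matrix.trace_add]
    simp only [Matrix.sub_mul, Matrix.trace_sub]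
    linarith
  obtain ⟨c, hc⟩ := h.state_bounded hSys hS hK hC hJ
  -- The telescoped boundary terms are bounded uniformly in time by the state moments, and the
  -- averaging factor sends them to zero.
  have hbd : Tendsto (fun T : ℕ => (1 / ((T : ℝ) + 1)) *
      (((Sys.Q - S) * X (T + 1)).trace - ((Sys.Q - S) * X 0).trace)) atTop (𝓝 0) := by
    set b := (∑ i, ∑ j, |(Sys.Q - S) i j|) * c with hb
    have hb' : ∀ t, |((Sys.Q - S) * X t).trace| ≤ b := fun t =>
      ((hxl2 t).abs_trace_le _).trans (mul_le_mul_of_nonneg_left (hc t) (by positivity))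
    refine bdd_le_mul_tendsto_zero' (2 * b) ?_ tendsto_one_div_add_atTop_nhds_zero_nat |>.congr
      fun T => mul_comm _ _
    refine Eventually.of_forall fun T => (abs_sub _ _).trans ?_
    linarith [hb' (T + 1), hb' 0]
  have hEpsl : Tendsto (fun t => (S * Sys.W).trace + (Sys.theta S * Eps t).trace) atTop
      (𝓝 ((S * Sys.W).trace + (P * Sys.theta S).trace)) := by
    refine Tendsto.const_add _ ?_
    rw [Matrix.trace_mul_comm P]
    exact (Continuous.matrix_trace continuous_id).tendsto _ |>.comp
      ((h.tendsto_cov_posteriorError hSys hC hJ).const_mul (Sys.theta S))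
  -- Cesàro means average the first n terms; composing with n = T + 1 matches the sum over t ≤ T.
  have hces := (hEpsl.cesaro.comp (tendsto_add_atTop_nat 1))
  have hsum := hbd.add hces
  rw [zero_add] at hsum
  refine hsum.congr fun T => ?_
  simp only [hstage, Function.comp_apply]
  rw [Finset.sum_add_distrib (f := fun t => ((Sys.Q - S) * X (t + 1)).trace
      - ((Sys.Q - S) * X t).trace), Finset.sum_range_sub fun t => ((Sys.Q - S) * X t).trace]
  push_cast
  ring

end Plant.IsWhiteLoop

end Loop

/-! ### Independence of the driving noise -/

section Independence

variable {Ω : Type*} [MeasurableSpace Ω] {μ : Measure Ω}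

/-- The hypotheses make the joint law of the triple a threefold product, and reassociating that
product gives the claim. It serves to assemble the initial state, one whole noise process and the
past of the other. -/
theorem indepFun_prodMk_of_indepFun [IsProbabilityMeasure μ] {α β γ : Type*}
    [MeasurableSpace α] [MeasurableSpace β]
    [MeasurableSpace γ] {X : Ω → α} {Y : Ω → β} {Z : Ω → γ} (hX : Measurable X)
    (hY : Measurable Y) (hZ : Measurable Z) (h : IndepFun X (fun ω => (Y ω, Z ω)) μ)
    (h' : IndepFun Y Z μ) : IndepFun (fun ω => (X ω, Y ω)) Z μ := by
  have hXY : IndepFun X Y μ := h.comp measurable_id measurable_fst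
  rw [indepFun_iff_map_prod_eq_prod_map_map (by fun_prop) (by fun_prop)] at h h' hXY ⊢
  have := Measure.isProbabilityMeasure_map (μ := μ) hX.aemeasurable
  have := Measure.isProbabilityMeasure_map (μ := μ) hY.aemeasurable
  have := Measure.isProbabilityMeasure_map (μ := μ) hZ.aemeasurable
  rw [hXY]
  rw [h'] at h
  have e := (measurePreserving_prodAssoc (μ.map X) (μ.map Y) (μ.map Z)).symm
  rw [← e.map_eq, ← h, Measure.map_map (MeasurableEquiv.measurable _) (by fun_prop)]
  rfl

/-- Keep the first `t` terms of a sequence. -/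
def truncate {α : Type*} [Zero α] (t : ℕ) (f : ℕ → α) : ℕ → α := fun i => if i < t then f i else 0

theorem truncate_of_lt {α : Type*} [Zero α] {t i : ℕ} (f : ℕ → α) (h : i < t) :
    truncate t f i = f i := if_pos h

/-- The past is encoded as a full sequence vanishing from time t on, so that the loop state, a
function of whole sequences, can be evaluated on it directly. -/
theorem iIndepFun.indepFun_truncate {w : ℕ → Ω → Fin m → ℝ} (h : iIndepFun w μ)
    (hw : ∀ t, Measurable (w t)) (t : ℕ) :
    IndepFun (fun ω => truncate t fun i => w i ω) (w t) μ := by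
  have h1 := h.indepFun_finset (Finset.range t) {t} (by simp) hw
  have hφ : Measurable fun (f : Finset.range t → Fin m → ℝ) (i : ℕ) =>
      if hi : i < t then f ⟨i, Finset.mem_range.2 hi⟩ else 0 := by
    refine measurable_pi_lambda _ fun i => ?_
    by_cases hi : i < t
    · simp only [hi, dif_pos]; exact measurable_pi_apply _
    · simp only [hi, dif_neg, not_false_iff]; exact measurable_const
  have h2 := h1.comp hφ
    (measurable_pi_apply (⟨t, Finset.mem_singleton_self t⟩ : ({t} : Finset ℕ)))
  convert! h2 using 1

theorem measurable_truncate {w : ℕ → Ω → Fin m → ℝ} (hw : ∀ t, Measurable (w t)) (t : ℕ) :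
    Measurable fun ω => truncate t fun i => w i ω := by
  refine measurable_pi_lambda _ fun i => ?_
  by_cases hi : i < t
  · simpa only [truncate, if_pos hi] using hw i
  · simpa only [truncate, if_neg hi] using measurable_const

variable {Sys : Plant m p} {ν : Measure (Fin m → ℝ)} {x₀ : Ω → Fin m → ℝ}
  {w n : ℕ → Ω → Fin m → ℝ}

/-- The measurement noise is independent of the initial state, the process noise and its own
past. -/
theorem Plant.IsDriving.indep_n_past [IsProbabilityMeasure μ]
    (h : Sys.IsDriving ν μ x₀ w n) (t : ℕ) :
    IndepFun (fun ω => (x₀ ω, (fun i => w i ω), truncate t fun i => n i ω)) (n t) μ := by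
  have hx := h.measurable_x₀
  have hw := h.measurable_w
  have hn := h.measurable_n
  have hnt := measurable_truncate hn t
  have htr : Measurable fun f : ℕ → Fin m → ℝ => (truncate t f, f t) :=
    (measurable_truncate (fun i => measurable_pi_apply i) t).prodMk (measurable_pi_apply t)
  have h1 : IndepFun (fun ω => ((fun i => w i ω), truncate t fun i => n i ω)) (n t) μ :=
    indepFun_prodMk_of_indepFun (measurable_pi_lambda _ hw) hnt (hn t)
      (h.indep_w_n.comp measurable_id htr)
      (iIndepFun.indepFun_truncate h.indep_n hn t)
  exact indepFun_prodMk_of_indepFun hx ((measurable_pi_lambda _ hw).prodMk hnt) (hn t)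
    (h.indep_x₀.comp measurable_id
      (((measurable_fst.prodMk (measurable_fst.comp (htr.comp measurable_snd)))).prodMk
        (measurable_snd.comp (htr.comp measurable_snd)))) h1

/-- The process noise is independent of the initial state, the measurement noise and its own
past. -/
theorem Plant.IsDriving.indep_w_past [IsProbabilityMeasure μ]
    (h : Sys.IsDriving ν μ x₀ w n) (t : ℕ) :
    IndepFun (fun ω => (x₀ ω, (fun i => n i ω), truncate t fun i => w i ω)) (w t) μ := by
  have hx := h.measurable_x₀
  have hw := h.measurable_w
  have hn := h.measurable_n
  have hnt := measurable_truncate hw t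
  have htr : Measurable fun f : ℕ → Fin m → ℝ => (truncate t f, f t) :=
    (measurable_truncate (fun i => measurable_pi_apply i) t).prodMk (measurable_pi_apply t)
  have h1 : IndepFun (fun ω => ((fun i => n i ω), truncate t fun i => w i ω)) (w t) μ :=
    indepFun_prodMk_of_indepFun (measurable_pi_lambda _ hn) hnt (hw t)
      (h.indep_w_n.symm.comp measurable_id htr)
      (iIndepFun.indepFun_truncate h.indep_w hw t)
  exact indepFun_prodMk_of_indepFun hx ((measurable_pi_lambda _ hn).prodMk hnt) (hw t)
    (h.indep_x₀.comp measurable_id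
      (((measurable_snd.prodMk (measurable_fst.comp (htr.comp measurable_fst)))).prodMk
        (measurable_snd.comp (htr.comp measurable_fst)))) h1

theorem crossMoment_eq_zero_of_indepFun {a b : ℕ} {X : Ω → Fin a → ℝ} {Y : Ω → Fin b → ℝ}
    (h : IndepFun X Y μ) (hX : Measurable X) (hY : Measurable Y)
    (h0 : ∀ j, ∫ ω, Y ω j ∂μ = 0) : crossMoment μ X Y = 0 := by
  ext i j
  have hij := h.comp (measurable_pi_apply i) (measurable_pi_apply j)
  simp only [crossMoment, Matrix.of_apply, Matrix.zero_apply]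
  have := hij.integral_fun_mul_eq_mul_integral
    ((measurable_pi_apply i).comp hX).aestronglyMeasurable
    ((measurable_pi_apply j).comp hY).aestronglyMeasurable
  simp only [Function.comp_apply] at this
  rw [this, h0 j, mul_zero]

/-- Fubini for a function of two independent random variables. -/
theorem IndepFun.integral_comp_eq [IsProbabilityMeasure μ] {α β : Type*}
    [MeasurableSpace α] [MeasurableSpace β]
    {X : Ω → α} {Y : Ω → β} {ν : Measure β} (h : IndepFun X Y μ) (hX : Measurable X)
    (hY : Measurable Y) (hν : μ.map Y = ν) {F : α → β → ℝ}
    (hF : Measurable fun z : α × β => F z.1 z.2)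
    (hInt : Integrable (fun ω => F (X ω) (Y ω)) μ) :
    ∫ ω, F (X ω) (Y ω) ∂μ = ∫ ω, ∫ y, F (X ω) y ∂ν ∂μ := by
  have hXY := (indepFun_iff_map_prod_eq_prod_map_map hX.aemeasurable hY.aemeasurable).1 h
  have := Measure.isProbabilityMeasure_map (μ := μ) hX.aemeasurable
  have := Measure.isProbabilityMeasure_map (μ := μ) hY.aemeasurable
  subst hν
  have h1 : ∫ ω, F (X ω) (Y ω) ∂μ = ∫ z, F z.1 z.2 ∂((μ.map X).prod (μ.map Y)) := by
    rw [← hXY, integral_map (hX.prodMk hY).aemeasurable hF.aestronglyMeasurable]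
  have hInt' : Integrable (fun z : α × β => F z.1 z.2) ((μ.map X).prod (μ.map Y)) := by
    rw [← hXY]
    exact (integrable_map_measure hF.aestronglyMeasurable (hX.prodMk hY).aemeasurable).2 hInt
  rw [h1, integral_prod _ hInt']
  exact integral_map hX.aemeasurable
    (hF.stronglyMeasurable.integral_prod_right).aestronglyMeasurable

end Independence

/-! ### Moments of the Gaussian noise -/

section Gaussian

variable {Ω : Type*} [MeasurableSpace Ω] {μ : Measure Ω}
  {X : Ω → Fin m → ℝ} {Sig : Matrix (Fin m) (Fin m) ℝ}

theorem memLp_eval_multivariateGaussian (i : Fin m) :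
    MemLp (fun x : EuclideanSpace ℝ (Fin m) => x i) 2 (multivariateGaussian 0 Sig) :=
  (EuclideanSpace.proj (𝕜 := ℝ) i).comp_memLp' IsGaussian.memLp_two_id

theorem integral_eval_multivariateGaussian (i : Fin m) :
    ∫ x : EuclideanSpace ℝ (Fin m), x i ∂(multivariateGaussian 0 Sig) = 0 := by
  have := (EuclideanSpace.proj (𝕜 := ℝ) i : EuclideanSpace ℝ (Fin m) →L[ℝ] ℝ).integral_comp_id_comm
    (IsGaussian.integrable_id (μ := multivariateGaussian 0 Sig))
  simpa using this

theorem gaussianVec_isL2 (hX : Measurable X) (h : μ.map X = gaussianVec Sig) : IsL2 μ X := by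
  intro i
  have h1 : MemLp (fun x : Fin m → ℝ => x i) 2 (μ.map X) := by
    rw [h, gaussianVec]
    exact (memLp_map_measure_iff (measurable_pi_apply i).aestronglyMeasurable
      (by fun_prop)).2 (memLp_eval_multivariateGaussian i)
  exact (memLp_map_measure_iff (measurable_pi_apply i).aestronglyMeasurable hX.aemeasurable).1 h1

theorem gaussianVec_integral_eval (hX : Measurable X) (h : μ.map X = gaussianVec Sig)
    (i : Fin m) : ∫ ω, X ω i ∂μ = 0 := by
  rw [← integral_map (f := fun x : Fin m → ℝ => x i) hX.aemeasurable
    (measurable_pi_apply i).aestronglyMeasurable, h, gaussianVec,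
    integral_map (f := fun x : Fin m → ℝ => x i) (by fun_prop)
      (measurable_pi_apply i).aestronglyMeasurable]
  exact integral_eval_multivariateGaussian i

theorem gaussianVec_crossMoment (hSig : Sig.PosSemidef) (hX : Measurable X)
    (h : μ.map X = gaussianVec Sig) : crossMoment μ X X = Sig := by
  ext i j
  rw [← covariance_eval_multivariateGaussian (μ := 0) hSig i j,
    covariance_eq_sub (memLp_eval_multivariateGaussian i) (memLp_eval_multivariateGaussian j),
    integral_eval_multivariateGaussian, zero_mul, sub_zero]
  simp only [crossMoment, Matrix.of_apply]
  rw [← integral_map (f := fun x : Fin m → ℝ => x i * x j) hX.aemeasurable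
    (Measurable.aestronglyMeasurable (by fun_prop)), h,
    gaussianVec, integral_map (by fun_prop) (Measurable.aestronglyMeasurable (by fun_prop))]
  rfl

end Gaussian

/-! ### Dithered quantization -/

section Dither

/-- Overall error `Q_Δ(z + d) - d - z` of the subtractively dithered quantizer. -/
noncomputable def ditherError (Δ : ℝ) (z d : Fin m → ℝ) : Fin m → ℝ :=
  latticePoint Δ (quantIndex Δ (z + d)) - d - z

variable {Δ : ℝ}

/-- In this form the error depends on d i / Δ only modulo 1, with the signal entering as a mere
shift; averaging over one period of dither removes the signal. -/
theorem ditherError_apply (hΔ : 0 < Δ) (z d : Fin m → ℝ) (i : Fin m) :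
    ditherError Δ z d i = (1 / 2 - Int.fract (d i / Δ + (z i / Δ + 1 / 2))) * Δ := by
  have h : (z i + d i) / Δ + 1 / 2 = d i / Δ + (z i / Δ + 1 / 2) := by ring
  simp only [ditherError, latticePoint, quantIndex, Pi.sub_apply, Pi.add_apply]
  rw [h, Int.fract]
  field_simp
  ring

theorem measurable_quantIndex (Δ : ℝ) : Measurable (quantIndex (m := m) Δ) := by
  refine measurable_pi_lambda _ fun i => ?_
  exact Int.measurable_floor.comp (by fun_prop)

theorem measurable_latticePoint (Δ : ℝ) : Measurable (latticePoint (m := m) Δ) :=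
  Measurable.of_discrete

theorem measurable_ditherError {α : Type*} [MeasurableSpace α] {z d : α → Fin m → ℝ} (Δ : ℝ)
    (hz : Measurable z) (hd : Measurable d) : Measurable fun a => ditherError Δ (z a) (d a) :=
  (((measurable_latticePoint Δ).comp ((measurable_quantIndex Δ).comp (hz.add hd))).sub hd).sub hz

theorem abs_ditherError_le (hΔ : 0 < Δ) (z d : Fin m → ℝ) (i : Fin m) :
    |ditherError Δ z d i| ≤ Δ / 2 := by
  rw [ditherError_apply hΔ, abs_le]
  have h0 := Int.fract_nonneg (d i / Δ + (z i / Δ + 1 / 2))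
  have h1 := (Int.fract_lt_one (d i / Δ + (z i / Δ + 1 / 2))).le
  constructor <;> nlinarith

/-- The uniform law on `[-Δ/2, Δ/2]`. -/
noncomputable def uniformReal (Δ : ℝ) : Measure ℝ :=
  ProbabilityTheory.cond volume (Set.Icc (-Δ / 2) (Δ / 2))

theorem uniformVec_eq (Δ : ℝ) : uniformVec m Δ = Measure.pi fun _ => uniformReal Δ := rfl

theorem uniformReal_eq (Δ : ℝ) :
    uniformReal Δ = (ENNReal.ofReal Δ)⁻¹ • volume.restrict (Set.Icc (-Δ / 2) (Δ / 2)) := by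
  rw [uniformReal, ProbabilityTheory.cond, Real.volume_Icc]
  congr 3; ring

theorem isProbabilityMeasure_uniformReal (hΔ : 0 < Δ) : IsProbabilityMeasure (uniformReal Δ) := by
  refine ProbabilityTheory.cond_isProbabilityMeasure_of_finite ?_ ?_
  · rw [Real.volume_Icc]; simp; linarith
  · rw [Real.volume_Icc]; simp

theorem integral_uniformReal (hΔ : 0 < Δ) (f : ℝ → ℝ) :
    ∫ x, f x ∂(uniformReal Δ) = Δ⁻¹ * ∫ x in (-Δ / 2)..(Δ / 2), f x := by
  rw [uniformReal_eq Δ, integral_smul_measure, intervalIntegral.integral_of_le (by linarith),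
    integral_Icc_eq_integral_Ioc, ENNReal.toReal_inv, ENNReal.toReal_ofReal hΔ.le, smul_eq_mul]

/-- The dither covers exactly one period, so by periodicity the shift c is irrelevant and the
fractional part is uniform on [0, 1]. This is why the moments of the dithered error do not depend on
the signal. -/
theorem integral_fract_uniformReal (hΔ : 0 < Δ) (f : ℝ → ℝ) (c : ℝ) :
    ∫ x, f (Int.fract (x / Δ + c)) ∂(uniformReal Δ) = ∫ x in (0 : ℝ)..1, f x := by
  rw [integral_uniformReal hΔ,
    intervalIntegral.integral_comp_div_add (fun x => f (Int.fract x)) hΔ.ne' c, smul_eq_mul,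
    inv_mul_cancel_left₀ hΔ.ne']
  have hper : Function.Periodic (fun x : ℝ => f (Int.fract x)) 1 := fun x => by
    simp
  have h1 : Δ / 2 / Δ + c = -Δ / 2 / Δ + c + 1 := by field_simp; ring
  rw [h1, hper.intervalIntegral_add_eq _ 0, zero_add]
  refine intervalIntegral.integral_congr_ae ?_
  have : ∀ᵐ x : ℝ, x ≠ 1 := by simp [ae_iff]
  filter_upwards [this] with x hx hx'
  rw [Set.uIoc_of_le zero_le_one] at hx'
  rw [Int.fract_eq_self.2 ⟨hx'.1.le, lt_of_le_of_ne hx'.2 hx⟩]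

theorem integral_half_sub : ∫ x in (0 : ℝ)..1, (1 / 2 - x) * Δ = 0 := by
  rw [intervalIntegral.integral_mul_const, intervalIntegral.integral_sub (by simp) (by simp)]
  simp

theorem integral_half_sub_sq : ∫ x in (0 : ℝ)..1, ((1 / 2 - x) * Δ) * ((1 / 2 - x) * Δ)
    = Δ ^ 2 / 12 := by
  have h : ∀ x : ℝ, ((1 / 2 - x) * Δ) * ((1 / 2 - x) * Δ) = Δ ^ 2 * (x - 1 / 2) ^ 2 := fun x => by
    ring
  simp only [h]
  rw [intervalIntegral.integral_const_mul,
    intervalIntegral.integral_comp_sub_right (fun x => x ^ 2) (1 / 2 : ℝ), integral_pow]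
  norm_num
  ring

theorem integral_id_uniformReal (hΔ : 0 < Δ) : ∫ x, x ∂(uniformReal Δ) = 0 := by
  rw [integral_uniformReal hΔ, integral_id]
  ring

theorem integral_sq_uniformReal (hΔ : 0 < Δ) : ∫ x, x * x ∂(uniformReal Δ) = Δ ^ 2 / 12 := by
  rw [integral_uniformReal hΔ]
  have : ∀ x : ℝ, x * x = x ^ 2 := fun x => (sq x).symm
  simp only [this]
  rw [integral_pow]
  field_simp
  ring

theorem ae_mem_Icc_uniformReal : ∀ᵐ x ∂(uniformReal Δ), x ∈ Set.Icc (-Δ / 2) (Δ / 2) :=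
  ProbabilityTheory.ae_cond_mem measurableSet_Icc

theorem isProbabilityMeasure_uniformVec (hΔ : 0 < Δ) : IsProbabilityMeasure (uniformVec m Δ) := by
  have := isProbabilityMeasure_uniformReal hΔ
  rw [uniformVec_eq]; infer_instance

theorem integral_eval_uniformVec (hΔ : 0 < Δ) {f : ℝ → ℝ} (hf : Measurable f) (i : Fin m) :
    ∫ d, f (d i) ∂(uniformVec m Δ) = ∫ x, f x ∂(uniformReal Δ) := by
  have := isProbabilityMeasure_uniformReal hΔ
  rw [uniformVec_eq]
  exact integral_comp_eval (μ := fun _ : Fin m => uniformReal Δ) hf.aestronglyMeasurable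

theorem integral_eval_mul_uniformVec (hΔ : 0 < Δ) {f g : ℝ → ℝ} (hf : Measurable f)
    (hg : Measurable g) {i j : Fin m} (hij : i ≠ j) :
    ∫ d, f (d i) * g (d j) ∂(uniformVec m Δ)
      = (∫ x, f x ∂(uniformReal Δ)) * ∫ x, g x ∂(uniformReal Δ) := by
  have := isProbabilityMeasure_uniformReal hΔ
  have hind : iIndepFun (fun (i : Fin m) (d : Fin m → ℝ) => d i) (uniformVec m Δ) := by
    rw [uniformVec_eq]
    exact iIndepFun_pi (X := fun (_ : Fin m) (x : ℝ) => x) fun _ => aemeasurable_id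
  have h1 := ((hind.indepFun hij).comp hf hg).integral_fun_mul_eq_mul_integral
    (hf.comp (measurable_pi_apply i)).aestronglyMeasurable
    (hg.comp (measurable_pi_apply j)).aestronglyMeasurable
  simp only [Function.comp_apply] at h1
  rw [h1, integral_eval_uniformVec hΔ hf, integral_eval_uniformVec hΔ hg]

theorem ae_mem_Icc_uniformVec (hΔ : 0 < Δ) :
    ∀ᵐ d ∂(uniformVec m Δ), ∀ i, d i ∈ Set.Icc (-Δ / 2) (Δ / 2) := by
  have := isProbabilityMeasure_uniformReal hΔ
  rw [ae_all_iff]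
  intro i
  exact (measurePreserving_eval (fun _ : Fin m => uniformReal Δ) i).quasiMeasurePreserving.ae
    ae_mem_Icc_uniformReal

theorem integral_ditherError (hΔ : 0 < Δ) (z : Fin m → ℝ) (i : Fin m) :
    ∫ d, ditherError Δ z d i ∂(uniformVec m Δ) = 0 := by
  simp only [ditherError_apply hΔ]
  rw [integral_eval_uniformVec hΔ
    (f := fun x => (1 / 2 - Int.fract (x / Δ + (z i / Δ + 1 / 2))) * Δ)
    (by have := measurable_fract (R := ℝ); fun_prop),
    integral_fract_uniformReal hΔ fun x => (1 / 2 - x) * Δ]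
  exact integral_half_sub

theorem integral_ditherError_mul (hΔ : 0 < Δ) (z : Fin m → ℝ) (i j : Fin m) :
    ∫ d, ditherError Δ z d i * ditherError Δ z d j ∂(uniformVec m Δ)
      = (Δ ^ 2 / 12) * (1 : Matrix (Fin m) (Fin m) ℝ) i j := by
  have hfr := measurable_fract (R := ℝ)
  simp only [ditherError_apply hΔ]
  by_cases hij : i = j
  · subst hij
    rw [integral_eval_uniformVec hΔ
      (f := fun x => ((1 / 2 - Int.fract (x / Δ + (z i / Δ + 1 / 2))) * Δ) *
        ((1 / 2 - Int.fract (x / Δ + (z i / Δ + 1 / 2))) * Δ)) (by fun_prop),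
      integral_fract_uniformReal hΔ fun x => ((1 / 2 - x) * Δ) * ((1 / 2 - x) * Δ)]
    rw [integral_half_sub_sq]; simp
  · rw [integral_eval_mul_uniformVec hΔ
      (f := fun x => (1 / 2 - Int.fract (x / Δ + (z i / Δ + 1 / 2))) * Δ)
      (g := fun x => (1 / 2 - Int.fract (x / Δ + (z j / Δ + 1 / 2))) * Δ)
      (by fun_prop) (by fun_prop) hij,
      integral_fract_uniformReal hΔ fun x => (1 / 2 - x) * Δ, integral_half_sub]
    simp [hij]

/-- Error `Q_Δ(z + d) - z` of the quantizer when the dither is not subtracted. -/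
noncomputable def quantError (Δ : ℝ) (z d : Fin m → ℝ) : Fin m → ℝ :=
  latticePoint Δ (quantIndex Δ (z + d)) - z

theorem quantError_eq (Δ : ℝ) (z d : Fin m → ℝ) : quantError Δ z d = ditherError Δ z d + d := by
  simp only [quantError, ditherError]; abel

theorem measurable_quantError {α : Type*} [MeasurableSpace α] {z d : α → Fin m → ℝ} (Δ : ℝ)
    (hz : Measurable z) (hd : Measurable d) : Measurable fun a => quantError Δ (z a) (d a) :=
  ((measurable_latticePoint Δ).comp ((measurable_quantIndex Δ).comp (hz.add hd))).sub hz

theorem abs_quantError_le (hΔ : 0 < Δ) {z d : Fin m → ℝ} {i : Fin m}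
    (hd : d i ∈ Set.Icc (-Δ / 2) (Δ / 2)) : |quantError Δ z d i| ≤ Δ := by
  rw [quantError_eq, Pi.add_apply]
  have h1 := abs_le.1 (abs_ditherError_le hΔ z d i)
  rw [abs_le]
  constructor <;> linarith [hd.1, hd.2, h1.1, h1.2]

/-- With dither in a closed half-cell the quantizer returns one of the two lattice points around z.
With f the fractional part of z i / Δ, the error is -fΔ or (1 - f)Δ, and the identity is the
quadratic with these two roots. In expectation the linear term vanishes, leaving the variance f(1 -
f)Δ². -/
theorem quantError_sq (hΔ : 0 < Δ) {z d : Fin m → ℝ} {i : Fin m}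
    (hd : d i ∈ Set.Icc (-Δ / 2) (Δ / 2)) :
    quantError Δ z d i * quantError Δ z d i
      = (Δ - 2 * (Int.fract (z i / Δ) * Δ)) * quantError Δ z d i
        + (Int.fract (z i / Δ) * Δ) * (Δ - Int.fract (z i / Δ) * Δ) := by
  set k := ⌊(z i + d i) / Δ + 1 / 2⌋ with hk
  have hq : quantError Δ z d i = k * Δ - z i := by
    simp [quantError, latticePoint, quantIndex, hk]
  have hz : z i = (⌊z i / Δ⌋ + Int.fract (z i / Δ)) * Δ := by
    rw [Int.floor_add_fract]; field_simp
  have hlb : ⌊z i / Δ⌋ ≤ k := by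
    refine Int.floor_mono ?_
    have : (0 : ℝ) ≤ d i / Δ + 1 / 2 := by
      rw [← sub_nonneg] at *
      have := hd.1
      have h2 : d i / Δ + 1 / 2 = (d i + Δ / 2) / Δ := by field_simp
      rw [sub_zero, h2]; apply div_nonneg <;> linarith
    rw [add_div]; linarith
  have hub : k ≤ ⌊z i / Δ⌋ + 1 := by
    have h1 : ⌊z i / Δ⌋ + 1 = ⌊z i / Δ + 1⌋ := by simp
    rw [h1]
    refine Int.floor_mono ?_
    have h2 : d i / Δ + 1 / 2 ≤ 1 := by
      have h2 : d i / Δ + 1 / 2 = (d i + Δ / 2) / Δ := by field_simp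
      rw [h2, div_le_one hΔ]; linarith [hd.2]
    rw [add_div]; linarith
  have hcase : k = ⌊z i / Δ⌋ ∨ k = ⌊z i / Δ⌋ + 1 := by omega
  rw [hq]
  set f := Int.fract (z i / Δ)
  set l := ⌊z i / Δ⌋
  rw [hz]
  rcases hcase with h | h <;> rw [h] <;> push_cast <;> ring

theorem integrable_quantError (hΔ : 0 < Δ) (z : Fin m → ℝ) (i : Fin m) :
    Integrable (fun d => quantError Δ z d i) (uniformVec m Δ) := by
  have := isProbabilityMeasure_uniformVec (m := m) hΔ
  refine Integrable.of_bound (Measurable.aestronglyMeasurable ?_) Δ ?_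
  · exact (measurable_pi_apply i).comp (measurable_quantError Δ measurable_const measurable_id)
  · filter_upwards [ae_mem_Icc_uniformVec hΔ] with d hd using abs_quantError_le hΔ (hd i)

theorem integral_quantError (hΔ : 0 < Δ) (z : Fin m → ℝ) (i : Fin m) :
    ∫ d, quantError Δ z d i ∂(uniformVec m Δ) = 0 := by
  have := isProbabilityMeasure_uniformVec (m := m) hΔ
  simp only [quantError_eq, Pi.add_apply]
  rw [integral_add, integral_ditherError hΔ,
    integral_eval_uniformVec hΔ (f := fun x => x) measurable_id]
  · simp [integral_id_uniformReal hΔ]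
  · refine Integrable.of_bound (Measurable.aestronglyMeasurable ?_) (Δ / 2)
      (Eventually.of_forall fun d => abs_ditherError_le hΔ z d i)
    exact (measurable_pi_apply i).comp (measurable_ditherError Δ measurable_const measurable_id)
  · refine Integrable.of_bound (Measurable.aestronglyMeasurable (measurable_pi_apply i)) (Δ / 2) ?_
    filter_upwards [ae_mem_Icc_uniformVec hΔ] with d hd
    rw [Real.norm_eq_abs, abs_le]
    exact ⟨by linarith [(hd i).1], (hd i).2⟩

theorem integral_quantError_sq_le (hΔ : 0 < Δ) (z : Fin m → ℝ) (i : Fin m) :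
    ∫ d, quantError Δ z d i * quantError Δ z d i ∂(uniformVec m Δ) ≤ Δ ^ 2 / 4 := by
  have := isProbabilityMeasure_uniformVec (m := m) hΔ
  set f := Int.fract (z i / Δ)
  have h1 : ∫ d, quantError Δ z d i * quantError Δ z d i ∂(uniformVec m Δ)
      = ∫ d, ((Δ - 2 * (f * Δ)) * quantError Δ z d i + (f * Δ) * (Δ - f * Δ))
          ∂(uniformVec m Δ) := by
    refine integral_congr_ae ?_
    filter_upwards [ae_mem_Icc_uniformVec hΔ] with d hd using quantError_sq hΔ (hd i)
  rw [h1, integral_add ((integrable_quantError hΔ z i).const_mul _) (integrable_const _),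
    integral_const_mul, integral_quantError hΔ]
  simp only [mul_zero, integral_const, probReal_univ, one_smul, zero_add]
  -- This is f(1 - f) ≤ 1/4 scaled by Δ².
  nlinarith [sq_nonneg (Δ - 2 * (f * Δ))]

/-- Each entry of the error depends on its own dither coordinate only, so for a fixed signal
distinct entries are independent and centred. -/
theorem integral_quantError_mul (hΔ : 0 < Δ) (z : Fin m → ℝ) {i j : Fin m} (hij : i ≠ j) :
    ∫ d, quantError Δ z d i * quantError Δ z d j ∂(uniformVec m Δ) = 0 := by
  have hfl : ∀ i : Fin m, Measurable fun x : ℝ => ((⌊(z i + x) / Δ + 1 / 2⌋ : ℤ) : ℝ) * Δ - z i :=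
    fun i => by
      have h1 : Measurable fun x : ℝ => (z i + x) / Δ + 1 / 2 := by fun_prop
      have h2 : Measurable fun x : ℝ => ((⌊(z i + x) / Δ + 1 / 2⌋ : ℤ) : ℝ) :=
        (measurable_from_top (f := fun k : ℤ => (k : ℝ))).comp (Int.measurable_floor.comp h1)
      fun_prop
  have hz := integral_quantError hΔ z i
  have key : ∀ (d : Fin m → ℝ) (i : Fin m), quantError Δ z d i
      = ((⌊(z i + d i) / Δ + 1 / 2⌋ : ℤ) : ℝ) * Δ - z i := fun d i => rfl
  simp only [key] at hz ⊢
  rw [integral_eval_uniformVec hΔ (hfl i)] at hz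
  rw [integral_eval_mul_uniformVec hΔ (hfl i) (hfl j) hij, hz, zero_mul]

end Dither

/-! ### The two closed loops are driven by white noise -/

section Loops

variable {Ω : Type*} [MeasurableSpace Ω] {μ : Measure Ω} {Sys : Plant m p}
  {K : Matrix (Fin p) (Fin m) ℝ} {J C V : Matrix (Fin m) (Fin m) ℝ} {Δ : ℝ}

theorem measurable_mulVec {a b : ℕ} (M : Matrix (Fin a) (Fin b) ℝ) :
    Measurable fun x : Fin b → ℝ => M *ᵥ x := by
  refine measurable_pi_lambda _ fun i => ?_
  simp only [Matrix.mulVec, dotProduct]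
  fun_prop

theorem measurable_filterUpdate (J C : Matrix (Fin m) (Fin m) ℝ) :
    Measurable (Function.uncurry (filterUpdate J C)) :=
  measurable_fst.add ((measurable_mulVec J).comp
    (measurable_snd.sub ((measurable_mulVec C).comp measurable_fst)))

theorem measurable_testPosterior (J C : Matrix (Fin m) (Fin m) ℝ) :
    Measurable (Function.uncurry (testPosterior J C)) :=
  (measurable_filterUpdate J C).comp ((measurable_snd.comp measurable_fst).prodMk
    (((measurable_mulVec C).comp (measurable_fst.comp measurable_fst)).add measurable_snd))

theorem Plant.testState_congr (Sys : Plant m p) (K : Matrix (Fin p) (Fin m) ℝ)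
    (J C : Matrix (Fin m) (Fin m) ℝ) (x₀ : Fin m → ℝ) {w w' v v' : ℕ → Fin m → ℝ} {t : ℕ}
    (hw : ∀ i < t, w i = w' i) (hv : ∀ i < t, v i = v' i) :
    Sys.testState K J C x₀ w v t = Sys.testState K J C x₀ w' v' t := by
  induction t with
  | zero => rfl
  | succ t ih =>
    have := ih (fun i hi => hw i (hi.trans t.lt_succ_self))
      fun i hi => hv i (hi.trans t.lt_succ_self)
    simp only [Plant.testState, this, hw t t.lt_succ_self, hv t t.lt_succ_self]

theorem Plant.measurable_testState (Sys : Plant m p) (K : Matrix (Fin p) (Fin m) ℝ)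
    (J C : Matrix (Fin m) (Fin m) ℝ) (t : ℕ) :
    Measurable fun z : (Fin m → ℝ) × (ℕ → Fin m → ℝ) × (ℕ → Fin m → ℝ) =>
      Sys.testState K J C z.1 z.2.1 z.2.2 t := by
  induction t with
  | zero => exact measurable_fst.prodMk measurable_const
  | succ t ih =>
    have hw : Measurable fun z : (Fin m → ℝ) × (ℕ → Fin m → ℝ) × (ℕ → Fin m → ℝ) => z.2.1 t := by
      fun_prop
    have hv : Measurable fun z : (Fin m → ℝ) × (ℕ → Fin m → ℝ) × (ℕ → Fin m → ℝ) => z.2.2 t := by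
      fun_prop
    have hp := (measurable_testPosterior J C).comp (ih.prodMk hv)
    have hu := (measurable_mulVec Sys.B).comp ((measurable_mulVec K).comp hp)
    exact ((((measurable_mulVec Sys.A).comp (measurable_fst.comp ih)).add hu).add hw).prodMk
      (((measurable_mulVec Sys.A).comp hp).add hu)

theorem measurable_innovIndex (C : Matrix (Fin m) (Fin m) ℝ) (Δ : ℝ) :
    Measurable (Function.uncurry (innovIndex C Δ)) :=
  (measurable_quantIndex Δ).comp (((measurable_mulVec C).comp
    ((measurable_fst.comp measurable_fst).sub (measurable_snd.comp measurable_fst))).add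
      measurable_snd)

theorem measurable_ditherPosterior (J C : Matrix (Fin m) (Fin m) ℝ) (Δ : ℝ) :
    Measurable fun z : (Fin m → ℝ) × (Fin m → ℤ) × (Fin m → ℝ) =>
      ditherPosterior J C Δ z.1 z.2.1 z.2.2 :=
  (measurable_filterUpdate J C).comp (measurable_fst.prodMk
    ((((measurable_latticePoint Δ).comp (measurable_fst.comp measurable_snd)).sub
      (measurable_snd.comp measurable_snd)).add ((measurable_mulVec C).comp measurable_fst)))

theorem Plant.measurable_ditherState (Sys : Plant m p) (K : Matrix (Fin p) (Fin m) ℝ)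
    (J C : Matrix (Fin m) (Fin m) ℝ) (Δ : ℝ) (t : ℕ) :
    Measurable fun z : (Fin m → ℝ) × (ℕ → Fin m → ℝ) × (ℕ → Fin m → ℝ) =>
      Sys.ditherState K J C Δ z.1 z.2.1 z.2.2 t := by
  induction t with
  | zero => exact measurable_fst.prodMk measurable_const
  | succ t ih =>
    have hw : Measurable fun z : (Fin m → ℝ) × (ℕ → Fin m → ℝ) × (ℕ → Fin m → ℝ) => z.2.1 t := by
      fun_prop
    have hd : Measurable fun z : (Fin m → ℝ) × (ℕ → Fin m → ℝ) × (ℕ → Fin m → ℝ) => z.2.2 t := by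
      fun_prop
    have hp := (measurable_ditherPosterior J C Δ).comp ((measurable_snd.comp ih).prodMk
      (((measurable_innovIndex C Δ).comp (ih.prodMk hd)).prodMk hd))
    have hu := (measurable_mulVec Sys.B).comp ((measurable_mulVec K).comp hp)
    exact ((((measurable_mulVec Sys.A).comp (measurable_fst.comp ih)).add hu).add hw).prodMk
      ((measurable_mulVec (Sys.A + Sys.B * K)).comp hp)

theorem Plant.ditherState_congr (Sys : Plant m p) (K : Matrix (Fin p) (Fin m) ℝ)
    (J C : Matrix (Fin m) (Fin m) ℝ) (Δ : ℝ) (x₀ : Fin m → ℝ) {w w' d d' : ℕ → Fin m → ℝ} {t : ℕ}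
    (hw : ∀ i < t, w i = w' i) (hd : ∀ i < t, d i = d' i) :
    Sys.ditherState K J C Δ x₀ w d t = Sys.ditherState K J C Δ x₀ w' d' t := by
  induction t with
  | zero => rfl
  | succ t ih =>
    have := ih (fun i hi => hw i (hi.trans t.lt_succ_self))
      fun i hi => hd i (hi.trans t.lt_succ_self)
    simp only [Plant.ditherState, this, hw t t.lt_succ_self, hd t t.lt_succ_self]

theorem ditherPosterior_eq_testPosterior (J C : Matrix (Fin m) (Fin m) ℝ) (Δ : ℝ)
    (s : (Fin m → ℝ) × (Fin m → ℝ)) (d : Fin m → ℝ) :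
    ditherPosterior J C Δ s.2 (innovIndex C Δ s d) d
      = testPosterior J C s (ditherError Δ (C *ᵥ (s.1 - s.2)) d) := by
  rw [ditherPosterior, testPosterior, innovIndex, ditherError]
  congr 1
  rw [Matrix.mulVec_sub]
  abel

/-- The dithered loop is the test channel loop driven by the overall quantization error. -/
theorem Plant.ditherState_eq_testState (Sys : Plant m p) (K : Matrix (Fin p) (Fin m) ℝ)
    (J C : Matrix (Fin m) (Fin m) ℝ) (Δ : ℝ) (x₀ : Fin m → ℝ) (w d : ℕ → Fin m → ℝ) (t : ℕ) :
    Sys.ditherState K J C Δ x₀ w d t = Sys.testState K J C x₀ w (fun i =>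
      ditherError Δ (C *ᵥ ((Sys.ditherState K J C Δ x₀ w d i).1
        - (Sys.ditherState K J C Δ x₀ w d i).2)) (d i)) t := by
  induction t with
  | zero => rfl
  | succ t ih =>
    rw [Plant.testState, ← ih, Plant.ditherState]
    simp only [ditherPosterior_eq_testPosterior, Matrix.add_mulVec, Matrix.mulVec_mulVec]

variable {x₀ : Ω → Fin m → ℝ} {w n : ℕ → Ω → Fin m → ℝ}

/-- The Gaussian test channel is a white loop. -/
theorem Plant.IsDriving.isWhiteLoop_test [IsProbabilityMeasure μ]
    (hSys : Sys.IsAdmissible) (hV : V.PosDef)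
    (h : Sys.IsDriving (gaussianVec V) μ x₀ w n) :
    Sys.IsWhiteLoop K J C V μ x₀ w n fun t ω =>
      Sys.testState K J C (x₀ ω) (fun i => w i ω) (fun i => n i ω) t := by
  have hmw : Measurable fun ω => fun i => w i ω := measurable_pi_lambda _ h.measurable_w
  have hmn : Measurable fun ω => fun i => n i ω := measurable_pi_lambda _ h.measurable_n
  have hms : ∀ t, Measurable fun ω =>
      Sys.testState K J C (x₀ ω) (fun i => w i ω) (fun i => n i ω) t := fun t =>
    (Sys.measurable_testState K J C t).comp (h.measurable_x₀.prodMk (hmw.prodMk hmn))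
  have hsn : ∀ t, IndepFun (fun ω =>
      Sys.testState K J C (x₀ ω) (fun i => w i ω) (fun i => n i ω) t) (n t) μ := by
    intro t
    have h1 := (h.indep_n_past t).comp (Sys.measurable_testState K J C t) measurable_id
    convert! h1 using 1
    funext ω
    -- Causality: the state at time t reads the noise before t only, so truncating the noise leaves
    -- it unchanged.
    exact Sys.testState_congr K J C _ (fun i _ => rfl)
      fun i hi => (truncate_of_lt (fun i => n i ω) hi).symm
  have hsw : ∀ t, IndepFun (fun ω =>
      (Sys.testState K J C (x₀ ω) (fun i => w i ω) (fun i => n i ω) t, n t ω)) (w t) μ := by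
    intro t
    have hφ : Measurable fun z : (Fin m → ℝ) × (ℕ → Fin m → ℝ) × (ℕ → Fin m → ℝ) =>
        (Sys.testState K J C z.1 z.2.2 z.2.1 t, z.2.1 t) :=
      ((Sys.measurable_testState K J C t).comp (measurable_fst.prodMk
        ((measurable_snd.comp measurable_snd).prodMk (measurable_fst.comp measurable_snd)))).prodMk
          (by fun_prop)
    have h1 := (h.indep_w_past t).comp hφ measurable_id
    convert! h1 using 1
    funext ω
    refine Prod.ext ?_ rfl
    exact Sys.testState_congr K J C _
      (fun i hi => (truncate_of_lt (fun i => w i ω) hi).symm) fun i _ => rfl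
  have hn0 := fun t => gaussianVec_integral_eval (h.measurable_n t) (h.law_n t)
  have hw0 := fun t => gaussianVec_integral_eval (h.measurable_w t) (h.law_w t)
  exact {
    state := fun t ω => rfl
    l2_x₀ := gaussianVec_isL2 h.measurable_x₀ h.law_x₀
    l2_w := fun t => gaussianVec_isL2 (h.measurable_w t) (h.law_w t)
    l2_n := fun t => gaussianVec_isL2 (h.measurable_n t) (h.law_n t)
    cov_w := fun t =>
      gaussianVec_crossMoment hSys.W_posDef.posSemidef (h.measurable_w t) (h.law_w t)
    cov_n := fun t => gaussianVec_crossMoment hV.posSemidef (h.measurable_n t) (h.law_n t)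
    fst_n := fun t => crossMoment_eq_zero_of_indepFun ((hsn t).comp measurable_fst measurable_id)
      (measurable_fst.comp (hms t)) (h.measurable_n t) (hn0 t)
    snd_n := fun t => crossMoment_eq_zero_of_indepFun ((hsn t).comp measurable_snd measurable_id)
      (measurable_snd.comp (hms t)) (h.measurable_n t) (hn0 t)
    fst_w := fun t => crossMoment_eq_zero_of_indepFun
      ((hsw t).comp (measurable_fst.comp measurable_fst) measurable_id)
      (measurable_fst.comp (hms t)) (h.measurable_w t) (hw0 t)
    snd_w := fun t => crossMoment_eq_zero_of_indepFun
      ((hsw t).comp (measurable_snd.comp measurable_fst) measurable_id)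
      (measurable_snd.comp (hms t)) (h.measurable_w t) (hw0 t)
    n_w := fun t => crossMoment_eq_zero_of_indepFun
      ((hsw t).comp measurable_snd measurable_id)
      (h.measurable_n t) (h.measurable_w t) (hw0 t) }

theorem Plant.IsDriving.measurable_ditherState {ν : Measure (Fin m → ℝ)}
    (h : Sys.IsDriving ν μ x₀ w n) (t : ℕ) : Measurable fun ω =>
      Sys.ditherState K J C Δ (x₀ ω) (fun i => w i ω) (fun i => n i ω) t :=
  (Sys.measurable_ditherState K J C Δ t).comp (h.measurable_x₀.prodMk
    ((measurable_pi_lambda _ h.measurable_w).prodMk (measurable_pi_lambda _ h.measurable_n)))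

theorem Plant.IsDriving.indep_ditherState [IsProbabilityMeasure μ] {ν : Measure (Fin m → ℝ)}
    (h : Sys.IsDriving ν μ x₀ w n) (t : ℕ) : IndepFun (fun ω =>
      Sys.ditherState K J C Δ (x₀ ω) (fun i => w i ω) (fun i => n i ω) t) (n t) μ := by
  have h1 := (h.indep_n_past t).comp (Sys.measurable_ditherState K J C Δ t) measurable_id
  convert! h1 using 1
  funext ω
  exact Sys.ditherState_congr K J C Δ _ (fun i _ => rfl)
    fun i hi => (truncate_of_lt (fun i => n i ω) hi).symm

theorem isL2_ditherError [IsFiniteMeasure μ] (hΔ : 0 < Δ) {X d : Ω → Fin m → ℝ}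
    (hX : Measurable X) (hd : Measurable d) : IsL2 μ fun ω => ditherError Δ (X ω) (d ω) := by
  intro i
  have hm : Measurable fun ω => ditherError Δ (X ω) (d ω) :=
    measurable_ditherError Δ hX hd
  have hm' : Measurable fun ω => ditherError Δ (X ω) (d ω) i := (measurable_pi_apply i).comp hm
  exact MemLp.of_bound hm'.aestronglyMeasurable (Δ / 2)
    (Eventually.of_forall fun ω => abs_ditherError_le hΔ (X ω) (d ω) i)

/-- The overall quantization error is uncorrelated with any independent input. -/
theorem crossMoment_ditherError [IsProbabilityMeasure μ] (hΔ : 0 < Δ)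
    {α : Type*} [MeasurableSpace α] {X : Ω → α}
    {d : Ω → Fin m → ℝ} (hX : Measurable X) (hd : Measurable d) (hind : IndepFun X d μ)
    (hlaw : μ.map d = uniformVec m Δ) {g : α → Fin m → ℝ} (hg : Measurable g)
    (hgl2 : IsL2 μ fun ω => g (X ω)) {z : α → Fin m → ℝ} (hz : Measurable z) :
    crossMoment μ (fun ω => g (X ω)) (fun ω => ditherError Δ (z (X ω)) (d ω)) = 0 := by
  ext i j
  simp only [crossMoment, Matrix.of_apply, Matrix.zero_apply]
  have hl2 : IsL2 μ fun ω => ditherError Δ (z (X ω)) (d ω) :=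
    isL2_ditherError hΔ (hz.comp hX) hd
  -- Integrating the dither first, with the independent variable frozen, leaves the conditional mean
  -- of the error, which is zero.
  rw [IndepFun.integral_comp_eq (F := fun x δ => g x i * ditherError Δ (z x) δ j) hind hX hd hlaw
    (((measurable_pi_apply i).comp (hg.comp measurable_fst)).mul ((measurable_pi_apply j).comp
      (measurable_ditherError Δ (hz.comp measurable_fst) measurable_snd)))
    (hgl2.integrable_mul hl2 i j)]
  simp [integral_const_mul, integral_ditherError hΔ]

theorem crossMoment_ditherError_self [IsProbabilityMeasure μ] (hΔ : 0 < Δ) {X d : Ω → Fin m → ℝ}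
    (hX : Measurable X) (hd : Measurable d) (hind : IndepFun X d μ)
    (hlaw : μ.map d = uniformVec m Δ) :
    crossMoment μ (fun ω => ditherError Δ (X ω) (d ω)) (fun ω => ditherError Δ (X ω) (d ω))
      = (Δ ^ 2 / 12) • (1 : Matrix (Fin m) (Fin m) ℝ) := by
  ext i j
  simp only [crossMoment, Matrix.of_apply]
  have hl2 : IsL2 μ fun ω => ditherError Δ (X ω) (d ω) := isL2_ditherError hΔ hX hd
  rw [IndepFun.integral_comp_eq (F := fun x δ => ditherError Δ x δ i * ditherError Δ x δ j)
    hind hX hd hlaw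
    (((measurable_pi_apply i).comp (measurable_ditherError Δ measurable_fst measurable_snd)).mul
      ((measurable_pi_apply j).comp
      (measurable_ditherError Δ measurable_fst measurable_snd))) (hl2.integrable_mul hl2 i j)]
  simp [integral_ditherError_mul hΔ]

/-- The dithered architecture is a white loop. -/
theorem Plant.IsDriving.isWhiteLoop_dither [IsProbabilityMeasure μ]
    (hSys : Sys.IsAdmissible) (hΔ : 0 < Δ)
    (hV : V = (Δ ^ 2 / 12) • (1 : Matrix (Fin m) (Fin m) ℝ))
    {d : ℕ → Ω → Fin m → ℝ} (h : Sys.IsDriving (uniformVec m Δ) μ x₀ w d)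
    {s : ℕ → Ω → (Fin m → ℝ) × (Fin m → ℝ)}
    (hs : ∀ t ω, s t ω = Sys.ditherState K J C Δ (x₀ ω) (fun i => w i ω) (fun i => d i ω) t) :
    Sys.IsWhiteLoop K J C V μ x₀ w
      (fun t ω => ditherError Δ (C *ᵥ ((s t ω).1 - (s t ω).2)) (d t ω)) s := by
  have hms : ∀ t, Measurable (s t) := fun t => by
    have := h.measurable_ditherState (K := K) (J := J) (C := C) (Δ := Δ) t
    simpa only [← hs] using this
  have hsd : ∀ t, IndepFun (s t) (d t) μ := fun t => by
    have := h.indep_ditherState (K := K) (J := J) (C := C) (Δ := Δ) t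
    simpa only [← hs] using this
  have hz : Measurable fun s : (Fin m → ℝ) × (Fin m → ℝ) => C *ᵥ (s.1 - s.2) :=
    (measurable_mulVec C).comp (measurable_fst.sub measurable_snd)
  have hφ : Measurable fun z : ((Fin m → ℝ) × (Fin m → ℝ)) × (Fin m → ℝ) =>
      ditherError Δ (C *ᵥ (z.1.1 - z.1.2)) z.2 :=
    measurable_ditherError Δ (hz.comp measurable_fst) measurable_snd
  have hsw : ∀ t, IndepFun (fun ω => (s t ω, d t ω)) (w t) μ := by
    intro t
    have hφ : Measurable fun z : (Fin m → ℝ) × (ℕ → Fin m → ℝ) × (ℕ → Fin m → ℝ) =>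
        (Sys.ditherState K J C Δ z.1 z.2.2 z.2.1 t, z.2.1 t) :=
      ((Sys.measurable_ditherState K J C Δ t).comp (measurable_fst.prodMk
        ((measurable_snd.comp measurable_snd).prodMk (measurable_fst.comp measurable_snd)))).prodMk
          (by fun_prop)
    have h1 := (h.indep_w_past t).comp hφ measurable_id
    convert! h1 using 1
    funext ω
    have h2 : s t ω = Sys.ditherState K J C Δ (x₀ ω) (truncate t fun i => w i ω)
        (fun i => d i ω) t := by
      rw [hs]
      exact Sys.ditherState_congr K J C Δ _
        (fun i hi => (truncate_of_lt (fun i => w i ω) hi).symm) fun i _ => rfl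
    exact congrArg (fun y => (y, d t ω)) h2
  have hw0 := fun t => gaussianVec_integral_eval (h.measurable_w t) (h.law_w t)
  have hstate : ∀ t ω, s t ω = Sys.testState K J C (x₀ ω) (fun i => w i ω)
      (fun i => ditherError Δ (C *ᵥ ((s i ω).1 - (s i ω).2)) (d i ω)) t := by
    intro t ω
    simp only [hs]
    exact Sys.ditherState_eq_testState K J C Δ _ _ _ t
  have hl2n : ∀ t, IsL2 μ fun ω => ditherError Δ (C *ᵥ ((s t ω).1 - (s t ω).2)) (d t ω) := fun t =>
    isL2_ditherError (X := fun ω => C *ᵥ ((s t ω).1 - (s t ω).2)) hΔ (hz.comp (hms t))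
      (h.measurable_n t)
  have hl2x₀ : IsL2 μ x₀ := gaussianVec_isL2 h.measurable_x₀ h.law_x₀
  have hl2w : ∀ t, IsL2 μ (w t) := fun t => gaussianVec_isL2 (h.measurable_w t) (h.law_w t)
  -- Square integrability of the state is needed before uncorrelatedness can be shown, so it is
  -- proved here directly and not taken from `Plant.IsWhiteLoop.l2_state`.
  have hl2s : ∀ t, (IsL2 μ fun ω => (s t ω).1) ∧ IsL2 μ fun ω => (s t ω).2 := by
    intro t
    induction t with
    | zero =>
      simp only [hs, Plant.ditherState]
      exact ⟨hl2x₀, fun i => by simp⟩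
    | succ t ih =>
      have hp : IsL2 μ fun ω => testPosterior J C (s t ω)
          (ditherError Δ (C *ᵥ ((s t ω).1 - (s t ω).2)) (d t ω)) :=
        ih.2.add ((((ih.1.mulVec C).add (hl2n t)).sub (ih.2.mulVec C)).mulVec J)
      have hsucc : ∀ ω, s (t + 1) ω = (Sys.A *ᵥ (s t ω).1 + Sys.B *ᵥ (K *ᵥ testPosterior J C (s t ω)
          (ditherError Δ (C *ᵥ ((s t ω).1 - (s t ω).2)) (d t ω))) + w t ω,
          (Sys.A + Sys.B * K) *ᵥ testPosterior J C (s t ω)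
          (ditherError Δ (C *ᵥ ((s t ω).1 - (s t ω).2)) (d t ω))) := by
        intro ω
        simp only [hs, Plant.ditherState, ditherPosterior_eq_testPosterior]
      simp only [hsucc]
      exact ⟨((ih.1.mulVec _).add ((hp.mulVec K).mulVec _)).add (hl2w t), hp.mulVec _⟩
  have hcov : ∀ t, crossMoment μ
      (fun ω => ditherError Δ (C *ᵥ ((s t ω).1 - (s t ω).2)) (d t ω))
      (fun ω => ditherError Δ (C *ᵥ ((s t ω).1 - (s t ω).2)) (d t ω)) = V := fun t => by
    rw [hV]
    exact crossMoment_ditherError_self (X := fun ω => C *ᵥ ((s t ω).1 - (s t ω).2)) hΔ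
      (hz.comp (hms t)) (h.measurable_n t) ((hsd t).comp hz measurable_id) (h.law_n t)
  have hfst : ∀ t, crossMoment μ (fun ω => (s t ω).1)
      (fun ω => ditherError Δ (C *ᵥ ((s t ω).1 - (s t ω).2)) (d t ω)) = 0 := fun t =>
    crossMoment_ditherError (X := s t) (g := Prod.fst) (z := fun s => C *ᵥ (s.1 - s.2)) hΔ
      (hms t) (h.measurable_n t) (hsd t) (h.law_n t) measurable_fst (hl2s t).1 hz
  have hsnd : ∀ t, crossMoment μ (fun ω => (s t ω).2)
      (fun ω => ditherError Δ (C *ᵥ ((s t ω).1 - (s t ω).2)) (d t ω)) = 0 := fun t =>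
    crossMoment_ditherError (X := s t) (g := Prod.snd) (z := fun s => C *ᵥ (s.1 - s.2)) hΔ
      (hms t) (h.measurable_n t) (hsd t) (h.law_n t) measurable_snd (hl2s t).2 hz
  have hnw : ∀ t, crossMoment μ
      (fun ω => ditherError Δ (C *ᵥ ((s t ω).1 - (s t ω).2)) (d t ω)) (w t) = 0 := fun t =>
    crossMoment_eq_zero_of_indepFun
      (X := (fun z : ((Fin m → ℝ) × (Fin m → ℝ)) × (Fin m → ℝ) =>
        ditherError Δ (C *ᵥ (z.1.1 - z.1.2)) z.2) ∘ fun ω => (s t ω, d t ω))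
      ((hsw t).comp hφ measurable_id)
      (hφ.comp ((hms t).prodMk (h.measurable_n t))) (h.measurable_w t) (hw0 t)
  exact {
    state := hstate
    l2_x₀ := hl2x₀
    l2_w := hl2w
    l2_n := hl2n
    cov_w := fun t =>
      gaussianVec_crossMoment hSys.W_posDef.posSemidef (h.measurable_w t) (h.law_w t)
    cov_n := hcov
    fst_n := hfst
    snd_n := hsnd
    fst_w := fun t => crossMoment_eq_zero_of_indepFun
      ((hsw t).comp (measurable_fst.comp measurable_fst) measurable_id)
      (measurable_fst.comp (hms t)) (h.measurable_w t) (hw0 t)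
    snd_w := fun t => crossMoment_eq_zero_of_indepFun
      ((hsw t).comp (measurable_snd.comp measurable_fst) measurable_id)
      (measurable_snd.comp (hms t)) (h.measurable_w t) (hw0 t)
    n_w := hnw }

end Loops

/-! ### Binary expansions -/

theorem length_binaryDigits (x : ℝ) (n : ℕ) : (binaryDigits x n).length = n := by
  simp [binaryDigits]

theorem binaryDigits_succ (x : ℝ) (n : ℕ) :
    binaryDigits x (n + 1) = binaryDigits x n ++ [decide (⌊2 ^ (n + 1) * x⌋ % 2 = 1)] := by
  simp [binaryDigits, List.range_succ]

theorem take_binaryDigits (x : ℝ) {k n : ℕ} (h : k ≤ n) :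
    (binaryDigits x n).take k = binaryDigits x k := by
  simp [binaryDigits, ← List.map_take, List.take_range, min_eq_left h]

/-- Passing from n to n + 1 doubles the floor and adds the next digit; on [0, 1) the recursion
starts from 0, so the digits determine the floor. -/
theorem floor_eq_of_binaryDigits_eq {x y : ℝ} (hx : x ∈ Set.Ico (0 : ℝ) 1)
    (hy : y ∈ Set.Ico (0 : ℝ) 1) {n : ℕ} (h : binaryDigits x n = binaryDigits y n) :
    ⌊2 ^ n * x⌋ = ⌊2 ^ n * y⌋ := by
  have step : ∀ (n : ℕ) (z : ℝ), ⌊2 ^ (n + 1) * z⌋ = 2 * ⌊2 ^ n * z⌋ ∨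
      ⌊2 ^ (n + 1) * z⌋ = 2 * ⌊2 ^ n * z⌋ + 1 := by
    intro n z
    have h1 := Int.floor_le (2 ^ n * z)
    have h2 := Int.lt_floor_add_one (2 ^ n * z)
    have h3 : 2 * ⌊2 ^ n * z⌋ ≤ ⌊2 ^ (n + 1) * z⌋ := by
      rw [Int.le_floor]; push_cast; rw [pow_succ]; linarith
    have h4 : ⌊2 ^ (n + 1) * z⌋ < 2 * ⌊2 ^ n * z⌋ + 2 := by
      rw [Int.floor_lt]; push_cast; rw [pow_succ]; linarith
    omega
  induction n with
  | zero =>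
    simp [Int.floor_eq_zero_iff.2 hx, Int.floor_eq_zero_iff.2 hy]
  | succ n ih =>
    rw [binaryDigits_succ, binaryDigits_succ] at h
    obtain ⟨h1, h2⟩ := List.append_inj' h rfl
    have h3 := ih h1
    simp only [List.cons.injEq, and_true, decide_eq_decide] at h2
    rcases step n x with hx' | hx' <;> rcases step n y with hy' | hy' <;> omega

theorem measurable_binaryDigits {β : Type*} [MeasurableSpace β] {x : β → ℝ} {n : β → ℕ}
    (hx : Measurable x) (hn : Measurable n) : Measurable fun b => binaryDigits (x b) (n b) := by
  have h : Measurable fun z : ℝ × ℕ => binaryDigits z.1 z.2 := by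
    refine measurable_from_prod_countable_left fun n => ?_
    induction n with
    | zero => simp only [binaryDigits, List.range_zero, List.map_nil]; exact measurable_const
    | succ n ih =>
      simp only [binaryDigits_succ]
      have h1 : Measurable fun x : ℝ => decide (⌊2 ^ (n + 1) * x⌋ % 2 = 1) :=
        (measurable_of_countable fun k : ℤ => decide (k % 2 = 1)).comp
          (Int.measurable_floor.comp (by fun_prop))
      exact (measurable_of_countable fun z : List Bool × Bool => z.1 ++ [z.2]).comp (ih.prodMk h1)
  exact h.comp (hx.prodMk hn)

/-! ### Sorted Shannon–Fano–Elias codes are prefix free -/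

section Code

variable {α : Type*} [MeasurableSpace α]

theorem length_shannonCode (P : Measure α) (s : α → ℕ) (a : α) :
    (shannonCode P s a).length = ⌈-Real.logb 2 (P.real {a})⌉₊ := length_binaryDigits _ _

theorem real_singleton_pos {P : Measure α} [IsFiniteMeasure P] {a : α} (ha : P {a} ≠ 0) :
    0 < P.real {a} := ENNReal.toReal_pos ha (measure_ne_top _ _)

/-- The symbols that precede `a` when sorting by non-increasing probability, ties broken by an
encoding of the alphabet. -/
def precedingSet (P : Measure α) (e : α → ℕ) (a : α) : Set α :=
  {b | P {a} < P {b} ∨ (P {b} = P {a} ∧ e b < e a)}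

/-- Number of preceding symbols. -/
noncomputable def sortRank (P : Measure α) (e : α → ℕ) (a : α) : ℕ :=
  ⌊(Measure.count (precedingSet P e a)).toReal⌋₊

theorem precedingSet_ssubset {P : Measure α} {e : α → ℕ} {a b : α} (h : b ∈ precedingSet P e a) :
    precedingSet P e b ⊂ precedingSet P e a := by
  refine ⟨fun c hc => ?_, fun hsub => ?_⟩
  · rcases h with h | ⟨h, h'⟩ <;> rcases hc with hc | ⟨hc, hc'⟩
    · exact Or.inl (h.trans hc)
    · exact Or.inl (hc ▸ h)
    · exact Or.inl (h ▸ hc)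
    · exact Or.inr ⟨hc.trans h, hc'.trans h'⟩
  · rcases hsub h with hb | ⟨_, hb⟩
    · exact lt_irrefl _ hb
    · exact lt_irrefl _ hb

theorem precedingSet_total {P : Measure α} {e : α → ℕ} (he : Function.Injective e) {a b : α}
    (h : a ≠ b) :
    b ∈ precedingSet P e a ∨ a ∈ precedingSet P e b := by
  rcases lt_trichotomy (P {a}) (P {b}) with hp | hp | hp
  · exact Or.inl (Or.inl hp)
  · rcases lt_or_gt_of_ne (he.ne h) with hlt | hlt
    · exact Or.inr (Or.inr ⟨hp, hlt⟩)
    · exact Or.inl (Or.inr ⟨hp.symm, hlt⟩)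
  · exact Or.inr (Or.inl hp)

variable {P : Measure α} [IsProbabilityMeasure P] {s : α → ℕ}

theorem length_le_of_sorting (hs : IsSorting P s) {a b : α} (ha : P {a} ≠ 0) (hb : P {b} ≠ 0)
    (hab : s a < s b) :
    ⌈-Real.logb 2 (P.real {a})⌉₊ ≤ ⌈-Real.logb 2 (P.real {b})⌉₊ := by
  refine Nat.ceil_mono (neg_le_neg ?_)
  exact Real.logb_le_logb_of_le one_lt_two (real_singleton_pos hb)
    (ENNReal.toReal_mono (measure_ne_top _ _) (hs.sorted a b ha hb hab))

variable [MeasurableSingletonClass α]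

theorem cumulative_add_le (s : α → ℕ) {a b : α} (hab : s a < s b) :
    P.real {c | s c < s a} + P.real {a} ≤ P.real {c | s c < s b} := by
  rw [← measureReal_union (by simp) (Set.countable_singleton a).measurableSet]
  refine measureReal_mono ?_
  rintro c (hc | hc)
  · exact lt_trans (b := s a) hc hab
  · rw [Set.mem_singleton_iff.1 hc]; exact hab

theorem cumulative_mem_Ico (s : α → ℕ) {a : α} (ha : P {a} ≠ 0) :
    P.real {c | s c < s a} ∈ Set.Ico (0 : ℝ) 1 := by
  refine ⟨measureReal_nonneg, ?_⟩
  have h := real_singleton_pos ha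
  have h1 : P.real {c | s c < s a} + P.real {a} ≤ 1 := by
    rw [← measureReal_union (by simp) (Set.countable_singleton a).measurableSet]
    exact measureReal_le_one
  linarith

/-- The length n of the codeword of a satisfies 2⁻ⁿ ≤ P{a}, and the cumulative sums of a and b
differ by at least P{a}. Scaled by 2ⁿ they differ by at least 1, so their floors, hence their first
n digits, differ. -/
theorem binaryDigits_cumulative_ne {a b : α} (ha : P {a} ≠ 0) (hb : P {b} ≠ 0)
    (hab : s a < s b) :
    binaryDigits (P.real {c | s c < s b}) ⌈-Real.logb 2 (P.real {a})⌉₊ ≠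
      binaryDigits (P.real {c | s c < s a}) ⌈-Real.logb 2 (P.real {a})⌉₊ := by
  intro h
  set n := ⌈-Real.logb 2 (P.real {a})⌉₊ with hn
  have hfl := floor_eq_of_binaryDigits_eq (cumulative_mem_Ico s hb) (cumulative_mem_Ico s ha) h
  have hp := real_singleton_pos ha
  have h1 : 1 ≤ 2 ^ n * P.real {a} := by
    have h2 : -Real.logb 2 (P.real {a}) ≤ n := Nat.le_ceil _
    have h3 : (2 : ℝ) ^ (-(n : ℝ)) ≤ P.real {a} :=
      (Real.le_logb_iff_rpow_le one_lt_two hp).1 (by linarith)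
    rw [Real.rpow_neg zero_le_two, Real.rpow_natCast] at h3
    have h4 : (0 : ℝ) < 2 ^ n := by positivity
    calc (1 : ℝ) = 2 ^ n * (2 ^ n)⁻¹ := (mul_inv_cancel₀ h4.ne').symm
      _ ≤ _ := by gcongr
  have h2 := cumulative_add_le (P := P) s hab
  have h3 : ⌊2 ^ n * P.real {c | s c < s a}⌋ + 1 ≤ ⌊2 ^ n * P.real {c | s c < s b}⌋ := by
    rw [Int.le_floor]
    push_cast
    have h4 := Int.floor_le (2 ^ n * P.real {c | s c < s a})
    have h5 : (0 : ℝ) < 2 ^ n := by positivity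
    nlinarith
  omega

/-- No codeword of the sorted code is a prefix of another one. -/
theorem shannonCode_not_prefix (hs : IsSorting P s) {a b : α} (ha : P {a} ≠ 0) (hb : P {b} ≠ 0)
    (hab : a ≠ b) : ¬ shannonCode P s a <+: shannonCode P s b := by
  intro h
  have htake := List.prefix_iff_eq_take.1 h
  rw [length_shannonCode] at htake
  have hlen := h.length_le
  rw [length_shannonCode, length_shannonCode] at hlen
  rcases lt_trichotomy (s a) (s b) with hlt | heq | hlt
  · rw [shannonCode, shannonCode, take_binaryDigits _ hlen] at htake
    exact binaryDigits_cumulative_ne ha hb hlt htake.symm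
  · exact hab (hs.injOn ha hb heq)
  -- Here sorting is essential: the earlier symbol b has no longer a codeword than a, so a prefix
  -- relation forces equal lengths and the digit comparison applies with the roles exchanged.
  · have hlen' := length_le_of_sorting hs hb ha hlt
    have he := le_antisymm hlen hlen'
    rw [shannonCode, shannonCode, take_binaryDigits _ hlen, he] at htake
    exact binaryDigits_cumulative_ne hb ha hlt htake

theorem shannonCode_injOn (hs : IsSorting P s) {a b : α} (ha : P {a} ≠ 0) (hb : P {b} ≠ 0)
    (h : shannonCode P s a = shannonCode P s b) : a = b := by
  by_contra hab
  exact shannonCode_not_prefix hs ha hb hab (h ▸ List.prefix_rfl)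

/-! ### Existence of sortings -/

variable [Countable α]

/-- A probability has only finitely many atoms of mass at least P{a} > 0. Off the support the set
may be infinite and `sortRank` then defaults to 0, which is harmless because `IsSorting` constrains
the support only. -/
theorem precedingSet_finite (e : α → ℕ) {a : α} (ha : P {a} ≠ 0) :
    (precedingSet P e a).Finite := by
  have hsum : ∑' b, P {b} ≠ ∞ := by
    have h := lintegral_countable' (μ := P) fun _ => 1
    simp only [lintegral_const, measure_univ, one_mul] at h
    rw [← h]; simp
  refine (ENNReal.finite_const_le_of_tsum_ne_top hsum ha).subset ?_
  rintro b (hb | ⟨hb, _⟩)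
  · exact hb.le
  · exact hb.ge

theorem sortRank_eq (e : α → ℕ) {a : α} (ha : P {a} ≠ 0) :
    sortRank P e a = (precedingSet_finite (P := P) e ha).toFinset.card := by
  rw [sortRank, Measure.count_apply_finite _ (precedingSet_finite e ha)]
  simp

/-- Sorting by the number of preceding symbols. -/
theorem isSorting_sortRank {e : α → ℕ} (he : Function.Injective e) :
    IsSorting P (sortRank P e) := by
  have hpos : ∀ {a b : α}, P {a} ≠ 0 → b ∈ precedingSet P e a → P {b} ≠ 0 := by
    rintro a b ha (hb | ⟨hb, _⟩)
    · exact (zero_le.trans_lt hb).ne'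
    · rwa [hb]
  have hlt : ∀ {a b : α}, P {a} ≠ 0 → b ∈ precedingSet P e a →
      sortRank P e b < sortRank P e a := by
    intro a b ha hb
    rw [sortRank_eq e ha, sortRank_eq e (hpos ha hb)]
    exact Finset.card_lt_card (by simpa using precedingSet_ssubset hb)
  have hinj : Set.InjOn (sortRank P e) {a | P {a} ≠ 0} := by
    intro a ha b hb hab
    by_contra hne
    rcases precedingSet_total (P := P) he hne with h | h
    · exact (hlt ha h).ne' hab
    · exact (hlt hb h).ne hab
  refine ⟨hinj, fun a ha n hn => ?_, fun a b ha hb hab => ?_⟩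
  · set F := (precedingSet_finite (P := P) e ha).toFinset with hF
    have hmem : ∀ b ∈ F, b ∈ precedingSet P e a := fun b hb => by simpa [hF] using hb
    -- Predecessors have distinct ranks below that of a, and their number equals that rank, so every
    -- smaller rank is attained.
    have himg : F.image (sortRank P e) = Finset.range (sortRank P e a) := by
      refine Finset.eq_of_subset_of_card_le ?_ ?_
      · intro k hk
        obtain ⟨b, hb, rfl⟩ := Finset.mem_image.1 hk
        exact Finset.mem_range.2 (hlt ha (hmem b hb))
      · rw [Finset.card_range, sortRank_eq e ha, Finset.card_image_of_injOn]
        exact fun b hb c hc h => hinj (hpos ha (hmem b hb)) (hpos ha (hmem c hc)) h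
    obtain ⟨b, hb, hbn⟩ := Finset.mem_image.1 (himg ▸ Finset.mem_range.2 hn)
    exact ⟨b, hpos ha (hmem b hb), hbn⟩
  · by_contra hlt'
    exact absurd (hlt ha (Or.inl (not_le.1 hlt'))) (by omega)

/-- The counting measure writes the rank as a countable sum of indicators of comparisons between
atom masses, each measurable in the parameter. -/
theorem measurable_sortRank {β : Type*} [MeasurableSpace β] (κ : Kernel β α) (e : α → ℕ) (a : α) :
    Measurable fun b => sortRank (κ b) e a := by
  have hm : ∀ c, Measurable fun b => κ b {c} := fun c =>
    κ.measurable_coe (measurableSet_singleton c)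
  have h : Measurable fun b => Measure.count (precedingSet (κ b) e a) := by
    have h1 : ∀ b, Measure.count (precedingSet (κ b) e a)
        = ∑' c, (precedingSet (κ b) e a).indicator (fun _ => 1) c := by
      intro b
      rw [← lintegral_count, lintegral_indicator (Set.to_countable _).measurableSet]
      simp
    simp only [h1]
    refine Measurable.tsum fun c => ?_
    have hset : MeasurableSet {b | c ∈ precedingSet (κ b) e a} := by
      refine MeasurableSet.union (measurableSet_lt (hm a) (hm c)) ?_
      exact (measurableSet_eq_fun (hm c) (hm a)).inter (MeasurableSet.const _)
    have : (fun b => (precedingSet (κ b) e a).indicator (fun _ => (1 : ℝ≥0∞)) c)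
        = {b | c ∈ precedingSet (κ b) e a}.indicator fun _ => 1 := by
      funext b; simp [Set.indicator]
    rw [this]
    exact measurable_const.indicator hset
  exact Nat.measurable_floor.comp h.ennreal_toReal

/-! ### Measurability and decoding -/

section Kernel

variable {β : Type*} [MeasurableSpace β] (κ : Kernel β α) [IsMarkovKernel κ] {σ : β → α → ℕ}

theorem measurable_shannonCode (hσ : ∀ k, Measurable fun b => σ b k) {γ : Type*}
    [MeasurableSpace γ] {f : γ → β} {g : γ → α} (hf : Measurable f) (hg : Measurable g) :
    Measurable fun c => shannonCode (κ (f c)) (σ (f c)) (g c) := by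
  suffices h : Measurable fun z : β × α => shannonCode (κ z.1) (σ z.1) z.2 by
    have h' := h.comp (hf.prodMk hg)
    exact h'
  refine measurable_from_prod_countable_left fun k => ?_
  refine measurable_binaryDigits ?_ ?_
  · have hset : MeasurableSet {z : β × α | σ z.1 z.2 < σ z.1 k} := by
      refine measurableSet_lt ?_ ((hσ k).comp measurable_fst)
      exact measurable_from_prod_countable_left fun c => hσ c
    exact (Kernel.measurable_kernel_prodMk_left hset).ennreal_toReal
  · have h1 : Measurable fun b => (κ b).real {k} :=
      (κ.measurable_coe (measurableSet_singleton k)).ennreal_toReal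
    have h2 : Measurable fun b => -Real.logb 2 ((κ b).real {k}) := by
      simp only [Real.logb]; fun_prop
    exact Nat.measurable_ceil.comp h2

theorem measurableSet_codeword (hσ : ∀ k, Measurable fun b => σ b k) (k : α) :
    MeasurableSet {z : List Bool × β | κ z.2 {k} ≠ 0 ∧ shannonCode (κ z.2) (σ z.2) k = z.1} := by
  refine MeasurableSet.inter ?_ (measurableSet_eq_fun ?_ measurable_fst)
  · exact (measurableSet_eq_fun ((κ.measurable_coe (measurableSet_singleton k)).comp measurable_snd)
      measurable_const).compl
  · exact measurable_shannonCode κ hσ (g := fun _ => k) measurable_snd measurable_const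

/-- A measurable decoder. -/
theorem exists_measurable_decoder [Nonempty α] (hσ : ∀ k, Measurable fun b => σ b k)
    (hs : ∀ b, IsSorting (κ b) (σ b)) :
    ∃ dec : List Bool × β → α, Measurable dec ∧
      ∀ b k, κ b {k} ≠ 0 → dec (shannonCode (κ b) (σ b) k, b) = k := by
  classical
  set D : α → Set (List Bool × β) := fun k =>
    {z | κ z.2 {k} ≠ 0 ∧ shannonCode (κ z.2) (σ z.2) k = z.1} with hD
  have hDm : ∀ k, MeasurableSet (D k) := fun k => measurableSet_codeword κ hσ k
  have huniq : ∀ z k l, z ∈ D k → z ∈ D l → k = l := by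
    rintro z k l ⟨hk, hk'⟩ ⟨hl, hl'⟩
    exact shannonCode_injOn (hs z.2) hk hl (hk'.trans hl'.symm)
  set k₀ : α := Classical.arbitrary α
  -- Words outside the codebook are sent to an arbitrary symbol; at most one symbol matches any word
  -- by injectivity.
  set dec : List Bool × β → α := fun z => if h : ∃ k, z ∈ D k then h.choose else k₀ with hdec
  have hdecD : ∀ z k, z ∈ D k → dec z = k := by
    intro z k hz
    have h : ∃ k, z ∈ D k := ⟨k, hz⟩
    simp only [hdec, dif_pos h]
    exact huniq z _ _ h.choose_spec hz
  refine ⟨dec, measurable_to_countable' fun y => ?_, fun b k hk => hdecD _ k ⟨hk, rfl⟩⟩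
  have hpre : dec ⁻¹' {y} = D y ∪ ({z | y = k₀} ∩ (⋃ k, D k)ᶜ) := by
    ext z
    simp only [Set.mem_preimage, Set.mem_singleton_iff, Set.mem_union, Set.mem_inter_iff,
      Set.mem_ofPred_eq, Set.mem_compl_iff, Set.mem_iUnion]
    constructor
    · intro hz
      by_cases h : ∃ k, z ∈ D k
      · obtain ⟨k, hk⟩ := h
        left
        rw [← hz, hdecD z k hk]; exact hk
      · right
        refine ⟨?_, h⟩
        rw [← hz]; simp only [hdec, dif_neg h]
    · rintro (hz | ⟨hy, hz⟩)
      · exact hdecD z y hz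
      · simp only [hdec, dif_neg hz, hy]
  rw [hpre]
  exact (hDm y).union ((MeasurableSet.const _).inter (MeasurableSet.iUnion hDm).compl)

end Kernel

end Code

/-! ### Codes for the quantized innovation -/

section Codewords

variable {Ω : Type*} [MeasurableSpace Ω] {μ : Measure Ω}

/-- On a countable alphabet the symbols of zero conditional probability together form a null set. -/
theorem ae_kernel_singleton_ne_zero {α β : Type*} [MeasurableSpace α] [MeasurableSpace β]
    [Countable α] [MeasurableSingletonClass α] {ν : Measure β} [SFinite ν] (κ : Kernel β α)
    [IsMarkovKernel κ] : ∀ᵐ z ∂(ν ⊗ₘ κ), κ z.1 {z.2} ≠ 0 := by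
  have hm : Measurable fun z : β × α => κ z.1 {z.2} :=
    measurable_from_prod_countable_left fun k => κ.measurable_coe (measurableSet_singleton k)
  refine Measure.ae_compProd_of_ae_ae ?_ (Eventually.of_forall fun b => ?_)
  · exact (measurableSet_eq_fun hm measurable_const).compl
  · refine ae_iff_of_countable.2 fun k hk => hk

theorem ae_condDistrib_singleton_ne_zero {α β : Type*} [MeasurableSpace α] [MeasurableSpace β]
    [Countable α] [MeasurableSingletonClass α] [StandardBorelSpace α] [Nonempty α]
    [IsFiniteMeasure μ] {q : Ω → α} {d : Ω → β} (hq : Measurable q) (hd : Measurable d) :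
    ∀ᵐ ω ∂μ, condDistrib q d μ (d ω) {q ω} ≠ 0 := by
  have h := ae_kernel_singleton_ne_zero (ν := μ.map d) (condDistrib q d μ)
  rw [compProd_map_condDistrib hq.aemeasurable] at h
  exact ae_of_ae_map (hd.prodMk hq).aemeasurable h

theorem ae_map_singleton_ne_zero {α : Type*} [MeasurableSpace α] [Countable α]
    [MeasurableSingletonClass α] {q : Ω → α} (hq : Measurable q) :
    ∀ᵐ ω ∂μ, μ.map q {q ω} ≠ 0 := by
  have h : ∀ᵐ k ∂(μ.map q), μ.map q {k} ≠ 0 := ae_iff_of_countable.2 fun k hk => hk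
  exact ae_of_ae_map hq.aemeasurable h

variable {q : ℕ → Ω → Fin m → ℤ} {d : ℕ → Ω → Fin m → ℝ}

theorem measurable_marginalCodeword (hq : ∀ t, Measurable (q t)) (s' : ℕ → (Fin m → ℤ) → ℕ)
    (t : ℕ) : Measurable (marginalCodeword μ q s' t) :=
  (measurable_of_countable (shannonCode (μ.map (q t)) (s' t))).comp (hq t)

variable [IsProbabilityMeasure μ]

theorem exists_isSideInfoSorting (q : ℕ → Ω → Fin m → ℤ) (d : ℕ → Ω → Fin m → ℝ) :
    ∃ s, IsSideInfoSorting μ q d s := by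
  obtain ⟨e, he⟩ := exists_injective_nat (Fin m → ℤ)
  exact ⟨fun t δ k => sortRank (condDistrib (q t) (d t) μ δ) e k,
    fun t k => measurable_sortRank _ e k, fun t δ => isSorting_sortRank he⟩

theorem exists_isMarginalSorting (hq : ∀ t, Measurable (q t)) :
    ∃ s, IsMarginalSorting μ q s := by
  obtain ⟨e, he⟩ := exists_injective_nat (Fin m → ℤ)
  refine ⟨fun t k => sortRank (μ.map (q t)) e k, fun t => ?_⟩
  have := Measure.isProbabilityMeasure_map (μ := μ) (hq t).aemeasurable
  exact isSorting_sortRank he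

variable {s : ℕ → (Fin m → ℝ) → (Fin m → ℤ) → ℕ}

theorem measurable_sideInfoCodeword (hq : ∀ t, Measurable (q t)) (hd : ∀ t, Measurable (d t))
    (hs : IsSideInfoSorting μ q d s) (t : ℕ) : Measurable (sideInfoCodeword μ q d s t) :=
  measurable_shannonCode (condDistrib (q t) (d t) μ) (hs.measurable t) (hd t) (hq t)

theorem sideInfoCodeword_decodable (hq : ∀ t, Measurable (q t)) (hd : ∀ t, Measurable (d t))
    (hs : IsSideInfoSorting μ q d s) :
    ∃ dec : ℕ → List Bool × (Fin m → ℝ) → (Fin m → ℤ), (∀ t, Measurable (dec t)) ∧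
      ∀ t, ∀ᵐ ω ∂μ, dec t (sideInfoCodeword μ q d s t ω, d t ω) = q t ω := by
  choose dec hm hdec using fun t =>
    exists_measurable_decoder (condDistrib (q t) (d t) μ) (hs.measurable t) (hs.sorting t)
  refine ⟨dec, hm, fun t => ?_⟩
  filter_upwards [ae_condDistrib_singleton_ne_zero (hq t) (hd t)] with ω hω
  exact hdec t (d t ω) (q t ω) hω

/-- The history contains d_t as its last dither entry, so almost surely a_t belongs to the codebook
determined by the history. Disintegration passes this to the conditional law of a_t, and words of
positive conditional probability inherit prefix-freeness. No independence between d_t and the past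
is involved. -/
theorem sideInfoCodeword_prefixConstraint (hq : ∀ t, Measurable (q t))
    (hd : ∀ t, Measurable (d t)) (hs : IsSideInfoSorting μ q d s) {u : ℕ → Ω → Fin p → ℝ}
    (hu : ∀ t, Measurable (u t)) : PrefixConstraint1 μ (sideInfoCodeword μ q d s) d u := by
  intro t hist
  have ha := measurable_sideInfoCodeword hq hd hs
  have hhist : Measurable hist :=
    (measurable_pi_lambda (fun ω (i : Fin t) => sideInfoCodeword μ q d s i ω) fun i => ha i).prodMk
      ((measurable_pi_lambda (fun ω (i : Fin (t + 1)) => d i ω) fun i => hd i).prodMk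
        (measurable_pi_lambda (fun ω (i : Fin t) => u i ω) fun i => hu i))
  set κ := condDistrib (q t) (d t) μ with hκ
  have hgood : ∀ᵐ z ∂(μ.map fun ω => (hist ω, sideInfoCodeword μ q d s t ω)),
      ∃ k, κ (z.1.2.1 (Fin.last t)) {k} ≠ 0 ∧
        shannonCode (κ (z.1.2.1 (Fin.last t))) (s t (z.1.2.1 (Fin.last t))) k = z.2 := by
    have hset : MeasurableSet {z : ((Fin t → List Bool) × (Fin (t + 1) → Fin m → ℝ) ×
        (Fin t → Fin p → ℝ)) × List Bool | ∃ k, κ (z.1.2.1 (Fin.last t)) {k} ≠ 0 ∧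
        shannonCode (κ (z.1.2.1 (Fin.last t))) (s t (z.1.2.1 (Fin.last t))) k = z.2} := by
      rw [Set.ofPred_exists]
      refine MeasurableSet.iUnion fun k => ?_
      have h1 : Measurable fun z : ((Fin t → List Bool) × (Fin (t + 1) → Fin m → ℝ) ×
        (Fin t → Fin p → ℝ)) × List Bool => (z.2, z.1.2.1 (Fin.last t)) := by fun_prop
      exact h1 (measurableSet_codeword κ (hs.measurable t) k)
    rw [ae_map_iff (hhist.prodMk (ha t)).aemeasurable hset]
    filter_upwards [ae_condDistrib_singleton_ne_zero (hq t) (hd t)] with ω hω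
    exact ⟨q t ω, hω, rfl⟩
  rw [← compProd_map_condDistrib (ha t).aemeasurable] at hgood
  filter_upwards [Measure.ae_ae_of_ae_compProd hgood] with h hh a₁ a₂ hne h₁ h₂
  have hmem := ae_iff_of_countable.1 hh
  obtain ⟨k₁, hk₁, rfl⟩ := hmem a₁ h₁.ne'
  obtain ⟨k₂, hk₂, rfl⟩ := hmem a₂ h₂.ne'
  exact shannonCode_not_prefix (hs.sorting t _) hk₁ hk₂ fun hk => hne (by rw [hk])

variable {s' : ℕ → (Fin m → ℤ) → ℕ}

theorem marginalCodeword_decodable (hq : ∀ t, Measurable (q t)) (hs : IsMarginalSorting μ q s') :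
    ∃ dec : ℕ → List Bool → (Fin m → ℤ), (∀ t, Measurable (dec t)) ∧
      ∀ t, ∀ᵐ ω ∂μ, dec t (marginalCodeword μ q s' t ω) = q t ω := by
  have hprob := fun t => Measure.isProbabilityMeasure_map (μ := μ) (hq t).aemeasurable
  choose dec hm hdec using fun t =>
    exists_measurable_decoder (Kernel.const Unit (μ.map (q t))) (σ := fun _ => s' t)
      (fun _ => measurable_const) (fun _ => hs t)
  refine ⟨fun t l => dec t (l, ()), fun t => measurable_of_countable _, fun t => ?_⟩
  filter_upwards [ae_map_singleton_ne_zero (hq t)] with ω hω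
  exact hdec t () (q t ω) hω

theorem marginalCodeword_prefixConstraint (hq : ∀ t, Measurable (q t))
    (hs : IsMarginalSorting μ q s') : PrefixConstraint2 μ (marginalCodeword μ q s') := by
  intro t a₁ a₂ hne h₁ h₂
  have := Measure.isProbabilityMeasure_map (μ := μ) (hq t).aemeasurable
  have key : ∀ a, 0 < μ.map (marginalCodeword μ q s' t) {a} →
      ∃ k, μ.map (q t) {k} ≠ 0 ∧ shannonCode (μ.map (q t)) (s' t) k = a := by
    intro a ha
    have hgood : ∀ᵐ l ∂(μ.map (marginalCodeword μ q s' t)),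
        ∃ k, μ.map (q t) {k} ≠ 0 ∧ shannonCode (μ.map (q t)) (s' t) k = l := by
      rw [ae_map_iff (measurable_marginalCodeword hq s' t).aemeasurable
        (Set.to_countable _).measurableSet]
      filter_upwards [ae_map_singleton_ne_zero (hq t)] with ω hω
      exact ⟨q t ω, hω, rfl⟩
    exact ae_iff_of_countable.1 hgood a ha.ne'
  obtain ⟨k₁, hk₁, rfl⟩ := key a₁ h₁
  obtain ⟨k₂, hk₂, rfl⟩ := key a₂ h₂
  exact shannonCode_not_prefix (hs t) hk₁ hk₂ fun hk => hne (by rw [hk])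

end Codewords

/-! ### Gaussian densities and the lattice tiling -/

/-- Density of the centred Gaussian law with inverse covariance `G`. -/
noncomputable def gaussianDensity (G : Matrix (Fin m) (Fin m) ℝ) (y : Fin m → ℝ) : ℝ :=
  √G.det * (√(2 * Real.pi) ^ m)⁻¹ * Real.exp (-(1 / 2) * (y ⬝ᵥ (G *ᵥ y)))

theorem measurable_gaussianDensity (G : Matrix (Fin m) (Fin m) ℝ) :
    Measurable (gaussianDensity G) := by
  have h : Measurable fun y : Fin m → ℝ => y ⬝ᵥ (G *ᵥ y) := by
    unfold dotProduct Matrix.mulVec dotProduct; fun_prop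
  unfold gaussianDensity
  fun_prop

theorem gaussianDensity_pos {G : Matrix (Fin m) (Fin m) ℝ} (hG : G.PosDef) (y : Fin m → ℝ) :
    0 < gaussianDensity G y := by
  have := hG.det_pos
  unfold gaussianDensity; positivity

theorem lintegral_exp_neg_half_dotProduct :
    ∫⁻ y : Fin m → ℝ, ENNReal.ofReal (Real.exp (-(1 / 2) * (y ⬝ᵥ y)))
      = ENNReal.ofReal (√(2 * Real.pi) ^ m) := by
  have h : ∀ y : Fin m → ℝ, Real.exp (-(1 / 2) * (y ⬝ᵥ y))
      = ∏ i, Real.exp (-(1 / 2) * (y i) ^ 2) := by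
    intro y
    rw [← Real.exp_sum, dotProduct, Finset.mul_sum]
    simp only [sq]
  simp only [h]
  rw [← ofReal_integral_eq_lintegral_ofReal]
  · rw [integral_fintype_prod_volume_eq_prod (fun (_ : Fin m) x => Real.exp (-(1 / 2) * x ^ 2))]
    simp only [integral_gaussian, Finset.prod_const, Finset.card_univ, Fintype.card_fin]
    congr 3
    ring
  · exact Integrable.fintype_prod (f := fun (_ : Fin m) x => Real.exp (-(1 / 2) * x ^ 2))
      fun _ => integrable_exp_neg_mul_sq (by norm_num)
  · exact Eventually.of_forall fun y => Finset.prod_nonneg fun i _ => (Real.exp_pos _).le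

theorem lintegral_gaussianDensity {G : Matrix (Fin m) (Fin m) ℝ} (hG : G.PosDef) :
    ∫⁻ y, ENNReal.ofReal (gaussianDensity G y) = 1 := by
  obtain ⟨B, hB⟩ : ∃ B : Matrix (Fin m) (Fin m) ℝ, G = Bᴴ * B := by
    open scoped MatrixOrder in
    exact (CStarAlgebra.nonneg_iff_eq_star_mul_self).1 hG.posSemidef.nonneg
  have hdet : G.det = B.det ^ 2 := by
    rw [hB, Matrix.det_mul, Matrix.det_conjTranspose, sq]; simp
  have hB0 : B.det ≠ 0 := by
    intro h0
    have := hG.det_pos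
    rw [hdet, h0] at this
    norm_num at this
  have hquad : ∀ y : Fin m → ℝ, y ⬝ᵥ (G *ᵥ y) = (B *ᵥ y) ⬝ᵥ (B *ᵥ y) := by
    intro y
    rw [hB, ← Matrix.mulVec_mulVec, Matrix.dotProduct_mulVec,
      Matrix.conjTranspose_eq_transpose_of_trivial, Matrix.vecMul_transpose]
  have hc : (0 : ℝ) ≤ √G.det * (√(2 * Real.pi) ^ m)⁻¹ := by positivity
  have hme : Measurable fun y : Fin m → ℝ => ENNReal.ofReal (Real.exp (-(1 / 2) * (y ⬝ᵥ y))) := by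
    unfold dotProduct; fun_prop
  have hmap := Real.map_matrix_volume_pi_eq_smul_volume_pi hB0
  have h1 : ∫⁻ y, ENNReal.ofReal (Real.exp (-(1 / 2) * (y ⬝ᵥ (G *ᵥ y))))
      -- The substitution y ↦ B y with G = Bᵀ B reduces to the standard Gaussian, at the price of
      -- the Jacobian.
      = ENNReal.ofReal |B.det⁻¹| * ENNReal.ofReal (√(2 * Real.pi) ^ m) := by
    rw [← lintegral_exp_neg_half_dotProduct, ← smul_eq_mul, ← lintegral_smul_measure, ← hmap,
      lintegral_map hme (by fun_prop)]
    simp only [hquad, Matrix.toLin'_apply]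
  unfold gaussianDensity
  simp only [ENNReal.ofReal_mul hc]
  rw [lintegral_const_mul' _ _ ENNReal.ofReal_ne_top, h1, ← ENNReal.ofReal_mul (abs_nonneg _),
    ← ENNReal.ofReal_mul hc, hdet, Real.sqrt_sq_eq_abs, abs_inv]
  have h2 : |B.det| ≠ 0 := abs_ne_zero.2 hB0
  have h3 : √(2 * Real.pi) ^ m ≠ 0 := by positivity
  rw [← ENNReal.ofReal_one]
  congr 1
  field_simp

theorem logb_gaussianDensity {G : Matrix (Fin m) (Fin m) ℝ} (hG : G.PosDef) (y : Fin m → ℝ) :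
    Real.logb 2 (gaussianDensity G y) = 1 / 2 * Real.logb 2 G.det
      - (m : ℝ) / 2 * Real.logb 2 (2 * Real.pi) - 1 / (2 * Real.log 2) * (y ⬝ᵥ (G *ᵥ y)) := by
  have h1 := hG.det_pos
  have h2 : (0 : ℝ) < 2 * Real.pi := by positivity
  have hlog : 0 < Real.log 2 := Real.log_pos one_lt_two
  unfold gaussianDensity Real.logb
  rw [Real.log_mul (by positivity) (Real.exp_pos _).ne', Real.log_exp,
    Real.log_mul (by positivity) (by positivity), Real.log_inv, Real.log_pow,
    Real.log_sqrt h1.le, Real.log_sqrt h2.le]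
  field_simp
  ring

variable {Δ : ℝ}

/-- The closed cube is exchanged for the half-open one, equal up to a null set, so that the
translated cells become disjoint. -/
theorem uniformVec_eq_smul_restrict (hΔ : 0 < Δ) :
    uniformVec m Δ = (ENNReal.ofReal Δ)⁻¹ ^ m •
      (volume : Measure (Fin m → ℝ)).restrict (Set.univ.pi fun _ => Set.Ico (-Δ / 2) (Δ / 2)) := by
  have := isProbabilityMeasure_uniformReal hΔ
  rw [uniformVec_eq, volume_pi, Measure.restrict_pi_pi]
  refine Measure.pi_eq fun s _ => ?_
  rw [Measure.smul_apply, Measure.pi_pi, smul_eq_mul, uniformReal_eq,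
    ← Measure.restrict_congr_set Ico_ae_eq_Icc]
  simp only [Measure.smul_apply, smul_eq_mul]
  rw [Finset.prod_mul_distrib]
  simp

/-- The cells around the lattice points tile the space. -/
theorem tsum_lintegral_uniformVec_le (hΔ : 0 < Δ) (f : (Fin m → ℝ) → ℝ≥0∞) :
    ∑' k : Fin m → ℤ, ∫⁻ δ, ENNReal.ofReal Δ ^ m * f (latticePoint Δ k - δ) ∂(uniformVec m Δ)
      ≤ ∫⁻ y, f y := by
  set box : Set (Fin m → ℝ) := Set.univ.pi fun _ => Set.Ico (-Δ / 2) (Δ / 2) with hbox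
  have hboxm : MeasurableSet box := MeasurableSet.univ_pi fun _ => measurableSet_Ico
  set cell : (Fin m → ℤ) → Set (Fin m → ℝ) := fun k => {y | latticePoint Δ k - y ∈ box} with hcell
  have hcellm : ∀ k, MeasurableSet (cell k) := fun k =>
    (measurable_const.sub measurable_id : Measurable fun y => latticePoint Δ k - y) hboxm
  -- The substitution y = Δk - δ turns the dither average into an integral over the cell of k; the
  -- factor Δᵐ cancels the uniform density.
  have hterm : ∀ k : Fin m → ℤ,
      ∫⁻ δ, ENNReal.ofReal Δ ^ m * f (latticePoint Δ k - δ) ∂(uniformVec m Δ)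
        = ∫⁻ y in cell k, f y := by
    intro k
    have h0 : ENNReal.ofReal Δ ≠ 0 := by simpa using hΔ
    rw [uniformVec_eq_smul_restrict hΔ, lintegral_smul_measure,
      lintegral_const_mul' _ _ (ENNReal.pow_ne_top ENNReal.ofReal_ne_top), smul_eq_mul, ← mul_assoc,
      ← mul_pow, ENNReal.inv_mul_cancel h0 ENNReal.ofReal_ne_top, one_pow, one_mul,
      ← lintegral_indicator hboxm, ← lintegral_indicator (hcellm k),
      ← lintegral_sub_left_eq_self ((cell k).indicator f) (latticePoint Δ k)]
    refine lintegral_congr fun δ => ?_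
    by_cases hδ : δ ∈ box
    · rw [Set.indicator_of_mem hδ, Set.indicator_of_mem]
      simpa [hcell] using hδ
    · rw [Set.indicator_of_notMem hδ, Set.indicator_of_notMem]
      simpa [hcell] using hδ
  simp only [hterm]
  rw [← lintegral_iUnion hcellm]
  · exact setLIntegral_le_lintegral _ _
  · intro k l hkl
    refine Set.disjoint_left.2 fun y hk hl => hkl ?_
    funext i
    have h1 : latticePoint Δ k i - y i ∈ Set.Ico (-Δ / 2) (Δ / 2) := hk i (Set.mem_univ i)
    have h2 : latticePoint Δ l i - y i ∈ Set.Ico (-Δ / 2) (Δ / 2) := hl i (Set.mem_univ i)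
    simp only [latticePoint, Set.mem_Ico] at h1 h2
    have h3 : ((k i : ℝ) - l i) * Δ < 1 * Δ := by linarith
    have h4 : ((l i : ℝ) - k i) * Δ < 1 * Δ := by linarith
    have h5 : (k i : ℝ) - l i < 1 := lt_of_mul_lt_mul_right h3 hΔ.le
    have h6 : (l i : ℝ) - k i < 1 := lt_of_mul_lt_mul_right h4 hΔ.le
    have h7 : k i < l i + 1 := by exact_mod_cast (by linarith : (k i : ℝ) < l i + 1)
    have h8 : l i < k i + 1 := by exact_mod_cast (by linarith : (l i : ℝ) < k i + 1)
    omega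

/-! ### Expected codeword length -/

section Length

variable {Ω : Type*} [MeasurableSpace Ω] {μ : Measure Ω} [IsProbabilityMeasure μ]

/-- The Gaussian reference measure, discretized on the lattice cells, has likelihood ratio of mean
at most one. -/
theorem lintegral_likelihoodRatio_le (hΔ : 0 < Δ) (κ : Kernel (Fin m → ℝ) (Fin m → ℤ))
    [IsMarkovKernel κ] {G : Matrix (Fin m) (Fin m) ℝ} (hG : G.PosDef) :
    ∫⁻ z, ENNReal.ofReal (Δ ^ m * gaussianDensity G (latticePoint Δ z.2 - z.1)
        / (κ z.1).real {z.2}) ∂(uniformVec m Δ ⊗ₘ κ) ≤ 1 := by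
  have := isProbabilityMeasure_uniformVec (m := m) hΔ
  have hg := measurable_gaussianDensity G
  have hm : Measurable fun z : (Fin m → ℝ) × (Fin m → ℤ) =>
      ENNReal.ofReal (Δ ^ m * gaussianDensity G (latticePoint Δ z.2 - z.1)
        / (κ z.1).real {z.2}) := by
    refine measurable_from_prod_countable_left fun k => ?_
    have h1 : Measurable fun b => (κ b).real {k} :=
      (κ.measurable_coe (measurableSet_singleton k)).ennreal_toReal
    have h2 : Measurable fun b => gaussianDensity G (latticePoint Δ k - b) :=
      hg.comp (measurable_const.sub measurable_id)
    exact ((measurable_const.mul h2).div h1).ennreal_ofReal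
  rw [Measure.lintegral_compProd hm]
  have hbound : ∀ δ : Fin m → ℝ, ∫⁻ k, ENNReal.ofReal (Δ ^ m *
      gaussianDensity G (latticePoint Δ k - δ) / (κ δ).real {k}) ∂(κ δ)
      ≤ ∑' k : Fin m → ℤ, ENNReal.ofReal Δ ^ m *
        ENNReal.ofReal (gaussianDensity G (latticePoint Δ k - δ)) := by
    intro δ
    rw [lintegral_countable']
    refine ENNReal.tsum_le_tsum fun k => ?_
    -- Division by zero gives ratio 0 at null symbols; elsewhere the atom mass cancels the
    -- denominator. This loses mass only in the favourable direction.
    by_cases hk : κ δ {k} = 0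
    · rw [hk, mul_zero]; exact zero_le
    · have hp := real_singleton_pos hk
      have he : κ δ {k} = ENNReal.ofReal ((κ δ).real {k}) := by
        rw [measureReal_def, ENNReal.ofReal_toReal (measure_ne_top _ _)]
      conv_lhs => rw [he]
      have hg0 := gaussianDensity_pos hG (latticePoint Δ k - δ)
      rw [← ENNReal.ofReal_mul (by positivity),
        div_mul_cancel₀ _ hp.ne', ENNReal.ofReal_mul (by positivity), ENNReal.ofReal_pow hΔ.le]
  refine (lintegral_mono hbound).trans ?_
  rw [lintegral_tsum]
  · refine (tsum_lintegral_uniformVec_le hΔ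
      fun y => ENNReal.ofReal (gaussianDensity G y)).trans ?_
    rw [lintegral_gaussianDensity hG]
  · intro k
    exact (measurable_const.mul
      (hg.comp (measurable_const.sub measurable_id)).ennreal_ofReal).aemeasurable

/-- Pointwise Gibbs inequality: the ceiling costs 1, and ln r ≤ r - 1 at r = b / a trades the true
probability for the reference. Used pointwise, it needs no integrability of log a. -/
theorem natCeil_neg_logb_le {a b : ℝ} (ha : 0 < a) (ha1 : a ≤ 1) (hb : 0 < b) :
    (⌈-Real.logb 2 a⌉₊ : ℝ) ≤ 1 - Real.logb 2 b + (b / a - 1) / Real.log 2 := by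
  have hlog : 0 < Real.log 2 := Real.log_pos one_lt_two
  have h0 : 0 ≤ -Real.logb 2 a := by
    rw [neg_nonneg]; exact Real.logb_nonpos one_lt_two ha.le ha1
  have h1 := (Nat.ceil_lt_add_one h0).le
  have h2 : Real.log (b / a) ≤ b / a - 1 := Real.log_le_sub_one_of_pos (by positivity)
  rw [Real.log_div hb.ne' ha.ne'] at h2
  have h3 : Real.logb 2 b - Real.logb 2 a ≤ (b / a - 1) / Real.log 2 := by
    unfold Real.logb
    rw [← sub_div]
    gcongr
  linarith

/-- Bound on the expected length of a Shannon code through a Gaussian reference density with inverse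
covariance `G`, for a signal with second moment `M`. -/
noncomputable def lengthBound (Δ : ℝ) (G M : Matrix (Fin m) (Fin m) ℝ) : ℝ :=
  1 - m * Real.logb 2 Δ + m / 2 * Real.logb 2 (2 * Real.pi) - 1 / 2 * Real.logb 2 G.det
    + 1 / (2 * Real.log 2) * (G * M).trace

/-- The expected length of a Shannon code for the lattice index given the dither is bounded through
a Gaussian reference density. -/
theorem lintegral_natCeil_le (hΔ : 0 < Δ) (κ : Kernel (Fin m → ℝ) (Fin m → ℤ))
    [IsMarkovKernel κ] {q : Ω → Fin m → ℤ} {d : Ω → Fin m → ℝ} (hq : Measurable q)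
    (hd : Measurable d) (hlaw : μ.map (fun ω => (d ω, q ω)) = uniformVec m Δ ⊗ₘ κ)
    {G : Matrix (Fin m) (Fin m) ℝ} (hG : G.PosDef)
    (hInt : IsL2 μ fun ω => latticePoint Δ (q ω) - d ω) :
    ∃ r : ℝ, 0 ≤ r ∧ r ≤ lengthBound Δ G (crossMoment μ (fun ω => latticePoint Δ (q ω) - d ω)
        (fun ω => latticePoint Δ (q ω) - d ω)) ∧
      ∫⁻ ω, (⌈-Real.logb 2 ((κ (d ω)).real {q ω})⌉₊ : ℝ≥0∞) ∂μ ≤ ENNReal.ofReal r := by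
  have := isProbabilityMeasure_uniformVec (m := m) hΔ
  have hlog : 0 < Real.log 2 := Real.log_pos one_lt_two
  have hdq : Measurable fun ω => (d ω, q ω) := hd.prodMk hq
  set y : Ω → Fin m → ℝ := fun ω => latticePoint Δ (q ω) - d ω with hy
  set b : Ω → ℝ := fun ω => Δ ^ m * gaussianDensity G (y ω) with hb
  set a : Ω → ℝ := fun ω => (κ (d ω)).real {q ω} with ha
  have hym : Measurable y := ((measurable_latticePoint Δ).comp hq).sub hd
  have ham : Measurable a := by
    have h1 : Measurable fun z : (Fin m → ℝ) × (Fin m → ℤ) => (κ z.1).real {z.2} :=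
      measurable_from_prod_countable_left fun k =>
        (κ.measurable_coe (measurableSet_singleton k)).ennreal_toReal
    exact h1.comp hdq
  have hbm : Measurable b := measurable_const.mul ((measurable_gaussianDensity G).comp hym)
  have hbpos : ∀ ω, 0 < b ω := fun ω => by
    have := gaussianDensity_pos hG (y ω)
    positivity
  have hratio : ∫⁻ ω, ENNReal.ofReal (b ω / a ω) ∂μ ≤ 1 := by
    have h := lintegral_likelihoodRatio_le hΔ κ hG
    rw [← hlaw] at h
    refine le_trans (le_of_eq ?_) h
    rw [lintegral_map' ?_ hdq.aemeasurable]
    refine Measurable.aemeasurable (measurable_from_prod_countable_left fun k => ?_)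
    have h1 : Measurable fun b => (κ b).real {k} :=
      (κ.measurable_coe (measurableSet_singleton k)).ennreal_toReal
    have h2 : Measurable fun b => gaussianDensity G (latticePoint Δ k - b) :=
      (measurable_gaussianDensity G).comp (measurable_const.sub measurable_id)
    exact ((measurable_const.mul h2).div h1).ennreal_ofReal
  have hr0 : ∀ ω, 0 ≤ b ω / a ω := fun ω => div_nonneg (hbpos ω).le measureReal_nonneg
  have hrint : Integrable (fun ω => b ω / a ω) μ := by
    refine ⟨(hbm.div ham).aestronglyMeasurable, ?_⟩
    rw [hasFiniteIntegral_iff_ofReal (Eventually.of_forall hr0)]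
    exact hratio.trans_lt ENNReal.one_lt_top
  have hrle : ∫ ω, b ω / a ω ∂μ ≤ 1 := by
    rw [integral_eq_lintegral_of_nonneg_ae (Eventually.of_forall hr0)
      (hbm.div ham).aestronglyMeasurable]
    exact ENNReal.toReal_le_of_le_ofReal zero_le_one (by simpa using hratio)
  have hlogb : ∀ ω, Real.logb 2 (b ω) = m * Real.logb 2 Δ + (1 / 2 * Real.logb 2 G.det
      - (m : ℝ) / 2 * Real.logb 2 (2 * Real.pi) - 1 / (2 * Real.log 2) * (y ω ⬝ᵥ (G *ᵥ y ω))) := by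
    intro ω
    rw [hb, Real.logb_mul (by positivity) (gaussianDensity_pos hG _).ne', Real.logb_pow,
      logb_gaussianDensity hG]
  have hquad := hInt.integrable_quad G
  have hbint : Integrable (fun ω => Real.logb 2 (b ω)) μ := by
    simp only [hlogb]
    exact (integrable_const _).add ((integrable_const _).sub (hquad.const_mul _))
  set h : Ω → ℝ := fun ω => 1 - Real.logb 2 (b ω) + (b ω / a ω - 1) / Real.log 2 with hh
  have hhint : Integrable h μ :=
    ((integrable_const _).sub hbint).add ((hrint.sub (integrable_const _)).div_const _)
  have hpt : ∀ᵐ ω ∂μ, (⌈-Real.logb 2 (a ω)⌉₊ : ℝ) ≤ h ω := by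
    have h1 := ae_kernel_singleton_ne_zero (ν := uniformVec m Δ) κ
    rw [← hlaw] at h1
    filter_upwards [ae_of_ae_map hdq.aemeasurable h1] with ω hω
    exact natCeil_neg_logb_le (real_singleton_pos hω) measureReal_le_one (hbpos ω)
  have hh0 : 0 ≤ᵐ[μ] h := hpt.mono fun ω hω => (Nat.cast_nonneg _).trans hω
  -- The witness is the mean of the pointwise majorant; it is nonnegative because it dominates a
  -- length.
  refine ⟨∫ ω, h ω ∂μ, integral_nonneg_of_ae hh0, ?_, ?_⟩
  · have e1 : ∫ ω, h ω ∂μ = 1 - ∫ ω, Real.logb 2 (b ω) ∂μ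
        + (∫ ω, b ω / a ω ∂μ - 1) / Real.log 2 := by
      have i1 : Integrable (fun ω => 1 - Real.logb 2 (b ω)) μ := (integrable_const _).sub hbint
      have i2 : Integrable (fun ω => (b ω / a ω - 1) / Real.log 2) μ :=
        (hrint.sub (integrable_const _)).div_const _
      simp only [hh]
      rw [integral_add i1 i2, integral_sub (integrable_const _) hbint, integral_div,
        integral_sub hrint (integrable_const _)]
      simp
    have e2 : ∫ ω, Real.logb 2 (b ω) ∂μ = m * Real.logb 2 Δ + (1 / 2 * Real.logb 2 G.det
        - (m : ℝ) / 2 * Real.logb 2 (2 * Real.pi) - 1 / (2 * Real.log 2) *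
          (G * crossMoment μ y y).trace) := by
      have i1 : Integrable (fun ω => 1 / 2 * Real.logb 2 G.det - (m : ℝ) / 2 *
          Real.logb 2 (2 * Real.pi) - 1 / (2 * Real.log 2) * (y ω ⬝ᵥ (G *ᵥ y ω))) μ :=
        (integrable_const _).sub (hquad.const_mul _)
      simp only [hlogb]
      rw [integral_add (integrable_const _) i1,
        integral_sub (integrable_const _) (hquad.const_mul _),
        integral_const_mul (1 / (2 * Real.log 2)),
        hInt.integral_quad G]
      simp
    have e3 : (∫ ω, b ω / a ω ∂μ - 1) / Real.log 2 ≤ 0 :=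
      div_nonpos_of_nonpos_of_nonneg (by linarith) hlog.le
    rw [e1, e2, lengthBound]
    linarith
  · rw [ofReal_integral_eq_lintegral_ofReal hhint hh0]
    refine lintegral_mono_ae (hpt.mono fun ω hω => ?_)
    rw [← ENNReal.ofReal_natCast]
    exact ENNReal.ofReal_le_ofReal hω

end Length

/-! ### Second moments of the quantizer output -/

section Moments

variable {Ω : Type*} [MeasurableSpace Ω] {μ : Measure Ω} {Δ : ℝ}

theorem crossMoment_of_map_eq_uniformVec (hΔ : 0 < Δ) {d : Ω → Fin m → ℝ} (hd : Measurable d)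
    (hlaw : μ.map d = uniformVec m Δ) :
    crossMoment μ d d = (Δ ^ 2 / 12) • (1 : Matrix (Fin m) (Fin m) ℝ) := by
  ext i j
  have hm : Measurable fun x : Fin m → ℝ => x i * x j := by fun_prop
  have h1 : crossMoment μ d d i j = ∫ x, x i * x j ∂(uniformVec m Δ) := by
    rw [← hlaw, integral_map hd.aemeasurable hm.aestronglyMeasurable]
    rfl
  rw [h1]
  rcases eq_or_ne i j with rfl | hij
  · rw [integral_eval_uniformVec hΔ (f := fun x => x * x) (by fun_prop), integral_sq_uniformReal hΔ]
    simp
  · rw [integral_eval_mul_uniformVec hΔ (f := fun x => x) (g := fun x => x) measurable_id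
      measurable_id hij, integral_id_uniformReal hΔ]
    simp [hij]

variable [IsProbabilityMeasure μ]

theorem isL2_of_map_eq_uniformVec (hΔ : 0 < Δ) {d : Ω → Fin m → ℝ} (hd : Measurable d)
    (hlaw : μ.map d = uniformVec m Δ) : IsL2 μ d := by
  intro i
  have hb := ae_mem_Icc_uniformVec (m := m) hΔ
  rw [← hlaw] at hb
  refine MemLp.of_bound ((measurable_pi_apply i).comp hd).aestronglyMeasurable (Δ / 2) ?_
  filter_upwards [ae_of_ae_map hd.aemeasurable hb] with ω hω
  have h := hω i
  rw [Real.norm_eq_abs, abs_le]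
  constructor <;> linarith [h.1, h.2]

theorem isL2_quantError (hΔ : 0 < Δ) {X d : Ω → Fin m → ℝ} (hX : Measurable X)
    (hd : Measurable d) (hlaw : μ.map d = uniformVec m Δ) :
    IsL2 μ fun ω => quantError Δ (X ω) (d ω) := by
  simp only [quantError_eq]
  exact (isL2_ditherError hΔ hX hd).add (isL2_of_map_eq_uniformVec hΔ hd hlaw)

theorem crossMoment_quantError (hΔ : 0 < Δ) {X d : Ω → Fin m → ℝ} (hX : Measurable X)
    (hXl2 : IsL2 μ X) (hd : Measurable d) (hind : IndepFun X d μ)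
    (hlaw : μ.map d = uniformVec m Δ) :
    crossMoment μ X (fun ω => quantError Δ (X ω) (d ω)) = 0 := by
  ext i j
  have hF : Measurable fun z : (Fin m → ℝ) × (Fin m → ℝ) => z.1 i * quantError Δ z.1 z.2 j :=
    ((measurable_pi_apply i).comp measurable_fst).mul
      ((measurable_pi_apply j).comp (measurable_quantError Δ measurable_fst measurable_snd))
  have h := IndepFun.integral_comp_eq hind hX hd hlaw
    (F := fun x e => x i * quantError Δ x e j) hF
    (hXl2.integrable_mul (isL2_quantError hΔ hX hd hlaw) i j)
  simp only [crossMoment, Matrix.of_apply, Matrix.zero_apply]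
  rw [h]
  simp [integral_const_mul, integral_quantError hΔ]

theorem crossMoment_quantError_self_of_ne (hΔ : 0 < Δ) {X d : Ω → Fin m → ℝ} (hX : Measurable X)
    (hd : Measurable d) (hind : IndepFun X d μ) (hlaw : μ.map d = uniformVec m Δ)
    {i j : Fin m} (hij : i ≠ j) :
    crossMoment μ (fun ω => quantError Δ (X ω) (d ω)) (fun ω => quantError Δ (X ω) (d ω)) i j
      = 0 := by
  have hq := measurable_quantError (m := m) Δ (measurable_fst (α := Fin m → ℝ) (β := Fin m → ℝ))
    measurable_snd
  have hl2 := isL2_quantError hΔ hX hd hlaw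
  have h := IndepFun.integral_comp_eq hind hX hd hlaw
    (F := fun x e => quantError Δ x e i * quantError Δ x e j)
    (((measurable_pi_apply i).comp hq).mul ((measurable_pi_apply j).comp hq))
    (hl2.integrable_mul hl2 i j)
  simp only [crossMoment, Matrix.of_apply]
  rw [h]
  simp [integral_quantError_mul hΔ _ hij]

theorem crossMoment_quantError_self_le (hΔ : 0 < Δ) {X d : Ω → Fin m → ℝ} (hX : Measurable X)
    (hd : Measurable d) (hind : IndepFun X d μ) (hlaw : μ.map d = uniformVec m Δ) (i : Fin m) :
    crossMoment μ (fun ω => quantError Δ (X ω) (d ω)) (fun ω => quantError Δ (X ω) (d ω)) i i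
      ≤ Δ ^ 2 / 4 := by
  have hq := measurable_quantError (m := m) Δ (measurable_fst (α := Fin m → ℝ) (β := Fin m → ℝ))
    measurable_snd
  have hl2 := isL2_quantError hΔ hX hd hlaw
  have h := IndepFun.integral_comp_eq hind hX hd hlaw
    (F := fun x e => quantError Δ x e i * quantError Δ x e i)
    (((measurable_pi_apply i).comp hq).mul ((measurable_pi_apply i).comp hq))
    (hl2.integrable_mul hl2 i i)
  simp only [crossMoment, Matrix.of_apply]
  rw [h]
  have h0 : ∀ x : Fin m → ℝ, 0 ≤ ∫ e, quantError Δ x e i * quantError Δ x e i ∂(uniformVec m Δ) :=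
    fun x => integral_nonneg fun e => mul_self_nonneg _
  refine (integral_mono_of_nonneg (Eventually.of_forall fun ω => h0 (X ω))
    (integrable_const (Δ ^ 2 / 4))
    (Eventually.of_forall fun ω => integral_quantError_sq_le hΔ (X ω) i)).trans ?_
  simp

/-- The expected length of a Shannon code for the marginal law of the lattice index. -/
theorem lintegral_natCeil_marginal_le (hΔ : 0 < Δ) {q : Ω → Fin m → ℤ} (hq : Measurable q)
    {G : Matrix (Fin m) (Fin m) ℝ} (hG : G.PosDef) (hInt : IsL2 μ fun ω => latticePoint Δ (q ω)) :
    ∃ r : ℝ, 0 ≤ r ∧ r ≤ lengthBound Δ G (crossMoment μ (fun ω => latticePoint Δ (q ω))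
        (fun ω => latticePoint Δ (q ω)) + (Δ ^ 2 / 12) • (1 : Matrix (Fin m) (Fin m) ℝ)) ∧
      ∫⁻ ω, (⌈-Real.logb 2 ((μ.map q).real {q ω})⌉₊ : ℝ≥0∞) ∂μ ≤ ENNReal.ofReal r := by
  have := isProbabilityMeasure_uniformVec (m := m) hΔ
  have hmapq := Measure.isProbabilityMeasure_map (μ := μ) hq.aemeasurable
  set ν := uniformVec m Δ with hν
  have hfst : MeasurePreserving Prod.fst (μ.prod ν) μ := measurePreserving_fst
  have hsnd : MeasurePreserving Prod.snd (μ.prod ν) ν := measurePreserving_snd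
  -- The fictitious dither lives on a second factor and is independent of q, so the conditional law
  -- of q given it is the constant kernel at the marginal law; the side-information bound then
  -- applies.
  have hlaw : (μ.prod ν).map (fun z => (z.2, q z.1)) = ν ⊗ₘ Kernel.const _ (μ.map q) := by
    have h1 : (μ.map q).prod ν = (μ.prod ν).map (Prod.map q id) := by
      rw [← Measure.map_prod_map μ ν hq measurable_id, Measure.map_id]
    rw [Measure.compProd_const, ← Measure.prod_swap (μ := μ.map q) (ν := ν), h1,
      Measure.map_map measurable_swap (hq.prodMap measurable_id)]
    rfl
  have hX : IsL2 (μ.prod ν) fun z => latticePoint Δ (q z.1) := fun i =>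
    (hInt i).comp_measurePreserving hfst
  have hd : IsL2 (μ.prod ν) Prod.snd := isL2_of_map_eq_uniformVec hΔ measurable_snd hsnd.map_eq
  have hXm : Measurable fun ω => latticePoint Δ (q ω) := (measurable_latticePoint Δ).comp hq
  have hind : IndepFun (fun z : Ω × (Fin m → ℝ) => latticePoint Δ (q z.1)) Prod.snd (μ.prod ν) :=
    indepFun_prod hXm measurable_id
  have hcross : crossMoment (μ.prod ν) (fun z => latticePoint Δ (q z.1)) Prod.snd = 0 := by
    refine crossMoment_eq_zero_of_indepFun hind (hXm.comp measurable_fst) measurable_snd fun j => ?_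
    have h1 := integral_map (μ := μ.prod ν) measurable_snd.aemeasurable
      (f := fun x : Fin m → ℝ => x j) (measurable_pi_apply j).aestronglyMeasurable
    rw [hsnd.map_eq] at h1
    rw [← h1, hν, integral_eval_uniformVec hΔ (f := fun x => x) measurable_id,
      integral_id_uniformReal hΔ]
  have hself : crossMoment (μ.prod ν) (fun z => latticePoint Δ (q z.1))
      (fun z => latticePoint Δ (q z.1)) = crossMoment μ (fun ω => latticePoint Δ (q ω))
        (fun ω => latticePoint Δ (q ω)) := by
    ext i j
    have hm : Measurable fun ω => latticePoint Δ (q ω) i * latticePoint Δ (q ω) j :=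
      ((measurable_pi_apply i).comp hXm).mul ((measurable_pi_apply j).comp hXm)
    have h1 := integral_map (μ := μ.prod ν) measurable_fst.aemeasurable
      (f := fun ω => latticePoint Δ (q ω) i * latticePoint Δ (q ω) j) hm.aestronglyMeasurable
    rw [hfst.map_eq] at h1
    exact h1.symm
  obtain ⟨r, hr0, hr, hle⟩ := lintegral_natCeil_le (μ := μ.prod ν) hΔ (Kernel.const _ (μ.map q))
    (hq.comp measurable_fst) measurable_snd hlaw hG (hX.sub hd)
  refine ⟨r, hr0, ?_, ?_⟩
  · rw [← hself, ← crossMoment_of_map_eq_uniformVec hΔ measurable_snd hsnd.map_eq,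
      ← crossMoment_sub_self hX hd hcross]
    exact hr
  · refine le_trans (le_of_eq ?_) hle
    have hm : Measurable fun ω => (⌈-Real.logb 2 ((μ.map q).real {q ω})⌉₊ : ℝ≥0∞) :=
      (measurable_of_countable fun k => (⌈-Real.logb 2 ((μ.map q).real {k})⌉₊ : ℝ≥0∞)).comp hq
    exact (hfst.lintegral_comp hm).symm

end Moments

/-! ### Asymptotics of the length bound -/

section Asymptotics

/-- For diagonal D the trace involves only the diagonal of G, which is nonnegative. -/
theorem trace_mul_le_of_diagonal {G D : Matrix (Fin m) (Fin m) ℝ} (hG : G.PosSemidef) {c : ℝ}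
    (hoff : ∀ i j, i ≠ j → D i j = 0) (hdiag : ∀ i, D i i ≤ c) :
    (G * D).trace ≤ (G * (c • (1 : Matrix (Fin m) (Fin m) ℝ))).trace := by
  have hD : D = Matrix.diagonal fun i => D i i := by
    ext i j
    rcases eq_or_ne i j with rfl | hij
    · simp
    · rw [hoff i j hij, Matrix.diagonal_apply_ne _ hij]
  rw [hD]
  simp only [Matrix.trace, Matrix.diag_apply, Matrix.mul_diagonal, Matrix.mul_smul, mul_one,
    Matrix.smul_apply, smul_eq_mul]
  refine Finset.sum_le_sum fun i _ => ?_
  rw [mul_comm c]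
  exact mul_le_mul_of_nonneg_left (hdiag i) hG.diag_nonneg

/-- Multiplying the reference covariance by 4 multiplies its determinant by 4ᵐ, which costs ½ log₂
4ᵐ = m bits, and in exchange the quadratic term tolerates a fourfold larger trace. -/
theorem lengthBound_quarter {Δ : ℝ} {G M M' : Matrix (Fin m) (Fin m) ℝ} (hG : G.PosDef)
    (h : (G * M').trace ≤ 4 * (G * M).trace) :
    lengthBound Δ ((1 / 4 : ℝ) • G) M' ≤ lengthBound Δ G M + m := by
  have hlog : 0 < Real.log 2 := Real.log_pos one_lt_two
  have hdet : Real.logb 2 ((1 / 4 : ℝ) • G).det = Real.logb 2 G.det - 2 * m := by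
    have h4 : Real.logb 2 (1 / 4) = -2 := by
      rw [show (1 / 4 : ℝ) = 2 ^ (-2 : ℝ) by norm_num [Real.rpow_neg],
        Real.logb_rpow two_pos (by norm_num)]
    rw [Matrix.det_smul, Fintype.card_fin, Real.logb_mul (by positivity) hG.det_pos.ne',
      Real.logb_pow, h4]
    ring
  have htr : 1 / (2 * Real.log 2) * ((1 / 4 : ℝ) • G * M').trace
      ≤ 1 / (2 * Real.log 2) * (G * M).trace := by
    rw [Matrix.smul_mul, Matrix.trace_smul, smul_eq_mul]
    gcongr
    linarith
  unfold lengthBound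
  rw [hdet]
  linarith

theorem tendsto_lengthBound (Δ : ℝ) (G : Matrix (Fin m) (Fin m) ℝ)
    {M : ℕ → Matrix (Fin m) (Fin m) ℝ} {N : Matrix (Fin m) (Fin m) ℝ}
    (h : Tendsto M atTop (𝓝 N)) :
    Tendsto (fun t => lengthBound Δ G (M t)) atTop (𝓝 (lengthBound Δ G N)) := by
  have hc : Continuous fun A : Matrix (Fin m) (Fin m) ℝ => lengthBound Δ G A := by
    unfold lengthBound
    fun_prop
  exact (hc.tendsto N).comp h

/-- When the reference covariance matches the second moment, the trace is m and contributes (m/2)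
log₂ e. Inserting Δ² = 12 v turns -m log₂ Δ into the divisor 12 and the power of v. -/
theorem lengthBound_inv_self {Δ v : ℝ} (hv : 0 < v) (hΔ : Δ = √(12 * v))
    {Sig : Matrix (Fin m) (Fin m) ℝ} (hSig : Sig.PosDef) :
    lengthBound Δ Sig⁻¹ Sig = 1 + m / 2 * Real.logb 2 (2 * Real.pi * Real.exp 1 / 12)
      + 1 / 2 * Real.logb 2 (Sig.det / v ^ m) := by
  have hlog : 0 < Real.log 2 := Real.log_pos one_lt_two
  have hdet := hSig.det_pos
  have hpi := Real.pi_pos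
  unfold lengthBound
  rw [Matrix.nonsing_inv_mul _ (isUnit_det_of_posDef hSig), Matrix.trace_one, Fintype.card_fin,
    Matrix.det_nonsing_inv, Ring.inverse_eq_inv', Real.logb_inv, hΔ]
  unfold Real.logb
  rw [Real.log_sqrt (by positivity), Real.log_div (by positivity) (by positivity),
    Real.log_mul (by positivity) (Real.exp_pos _).ne', Real.log_exp,
    Real.log_div hdet.ne' (by positivity), Real.log_pow,
    Real.log_mul (by norm_num) hv.ne']
  field_simp
  ring

/-- The real witness r forces b t ≥ 0, so the bounds pass through `ENNReal.ofReal` without loss;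
averages of a convergent sequence then have the same limit. -/
theorem commCost_le {Ω : Type*} [MeasurableSpace Ω] {μ : Measure Ω} {a : ℕ → Ω → List Bool}
    {b : ℕ → ℝ} {c : ℝ} (hb : Tendsto b atTop (𝓝 c))
    (h : ∀ t, ∃ r : ℝ, 0 ≤ r ∧ r ≤ b t ∧
      ∫⁻ ω, ((a t ω).length : ℝ≥0∞) ∂μ ≤ ENNReal.ofReal r) :
    (commCost μ a : EReal) ≤ (c : EReal) := by
  have hb0 : ∀ t, 0 ≤ b t := fun t => by
    obtain ⟨r, h0, h1, -⟩ := h t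
    exact h0.trans h1
  have hle : ∀ t, ∫⁻ ω, ((a t ω).length : ℝ≥0∞) ∂μ ≤ ENNReal.ofReal (b t) := fun t => by
    obtain ⟨r, -, h1, h2⟩ := h t
    exact h2.trans (ENNReal.ofReal_le_ofReal h1)
  have hc0 : 0 ≤ c := ge_of_tendsto' hb hb0
  have hces := (hb.cesaro.comp (tendsto_add_atTop_nat 1))
  have hlim := ENNReal.tendsto_ofReal hces
  have key : commCost μ a ≤ ENNReal.ofReal c := by
    rw [← hlim.limsup_eq]
    refine limsup_le_limsup (Eventually.of_forall fun T => ?_)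
    have hT : (0 : ℝ) < (T : ℝ) + 1 := by positivity
    have e1 : ENNReal.ofReal ((T : ℝ) + 1) = (T : ℝ≥0∞) + 1 := by
      rw [ENNReal.ofReal_add (by positivity) zero_le_one]; simp
    have e2 : ((fun n : ℕ => (n : ℝ)⁻¹ * ∑ i ∈ Finset.range n, b i) ∘ fun a => a + 1) T
        = (∑ t ∈ Finset.range (T + 1), b t) / ((T : ℝ) + 1) := by
      simp only [Function.comp_apply, Nat.cast_add, Nat.cast_one]
      rw [inv_mul_eq_div]
    beta_reduce
    rw [e2, ENNReal.ofReal_div_of_pos hT, e1, ENNReal.ofReal_sum_of_nonneg fun t _ => hb0 t]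
    exact ENNReal.div_le_div_right (Finset.sum_le_sum fun t _ => hle t) _
  have h1 : (commCost μ a : EReal) ≤ (ENNReal.ofReal c : EReal) := by exact_mod_cast key
  rwa [EReal.coe_ennreal_ofReal, max_eq_left (by exact_mod_cast hc0)] at h1

end Asymptotics

/-! ### Codeword lengths in the dithered loop -/

section Loop

variable {Ω : Type*} [MeasurableSpace Ω] {μ : Measure Ω}
  {Sys : Plant m p} {K : Matrix (Fin p) (Fin m) ℝ} {J C V G : Matrix (Fin m) (Fin m) ℝ} {Δ : ℝ}
  {x₀ : Ω → Fin m → ℝ} {w d : ℕ → Ω → Fin m → ℝ} {s : ℕ → Ω → (Fin m → ℝ) × (Fin m → ℝ)}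
  {q : ℕ → Ω → Fin m → ℤ}

theorem latticePoint_innovIndex_sub (C : Matrix (Fin m) (Fin m) ℝ) (Δ : ℝ)
    (s : (Fin m → ℝ) × (Fin m → ℝ)) (d : Fin m → ℝ) :
    latticePoint Δ (innovIndex C Δ s d) - d
      = C *ᵥ (s.1 - s.2) + ditherError Δ (C *ᵥ (s.1 - s.2)) d := by
  simp only [innovIndex, ditherError]
  abel

theorem latticePoint_innovIndex (C : Matrix (Fin m) (Fin m) ℝ) (Δ : ℝ)
    (s : (Fin m → ℝ) × (Fin m → ℝ)) (d : Fin m → ℝ) :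
    latticePoint Δ (innovIndex C Δ s d)
      = C *ᵥ (s.1 - s.2) + quantError Δ (C *ᵥ (s.1 - s.2)) d := by
  simp only [innovIndex, quantError]
  abel

theorem Plant.IsDriving.measurable_innovIndex {ν : Measure (Fin m → ℝ)}
    (h : Sys.IsDriving ν μ x₀ w d)
    (hs : ∀ t ω, s t ω = Sys.ditherState K J C Δ (x₀ ω) (fun i => w i ω) (fun i => d i ω) t)
    (hq : ∀ t ω, q t ω = innovIndex C Δ (s t ω) (d t ω)) (t : ℕ) : Measurable (q t) := by
  have hsm := h.measurable_ditherState (K := K) (J := J) (C := C) (Δ := Δ) t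
  have h1 := (LQG.measurable_innovIndex C Δ).comp (hsm.prodMk (h.measurable_n t))
  have h2 : q t = fun ω => Function.uncurry (innovIndex C Δ)
      (Sys.ditherState K J C Δ (x₀ ω) (fun i => w i ω) (fun i => d i ω) t, d t ω) := by
    funext ω
    rw [hq, hs]
    rfl
  rw [h2]
  exact h1

variable [IsProbabilityMeasure μ]

/-- Subtracting the dither from the quantizer output leaves C times the prediction error plus an
uncorrelated error of covariance V, so the relevant second moment is C E Cᵀ + V. -/
theorem Plant.IsDriving.exists_sideInfo_length_le (hSys : Sys.IsAdmissible) (hΔ : 0 < Δ)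
    (hV : V = (Δ ^ 2 / 12) • (1 : Matrix (Fin m) (Fin m) ℝ))
    (h : Sys.IsDriving (uniformVec m Δ) μ x₀ w d)
    (hs : ∀ t ω, s t ω = Sys.ditherState K J C Δ (x₀ ω) (fun i => w i ω) (fun i => d i ω) t)
    (hq : ∀ t ω, q t ω = innovIndex C Δ (s t ω) (d t ω)) (hG : G.PosDef) (t : ℕ) :
    ∃ r : ℝ, 0 ≤ r ∧ r ≤ lengthBound Δ G (C * crossMoment μ (fun ω => (s t ω).1 - (s t ω).2)
        (fun ω => (s t ω).1 - (s t ω).2) * Cᵀ + V) ∧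
      ∫⁻ ω, (⌈-Real.logb 2 ((condDistrib (q t) (d t) μ (d t ω)).real {q t ω})⌉₊ : ℝ≥0∞) ∂μ
        ≤ ENNReal.ofReal r := by
  have hloop := h.isWhiteLoop_dither (K := K) (J := J) (C := C) hSys hΔ hV hs
  have hqm := h.measurable_innovIndex hs hq t
  have he := hloop.l2_error t
  have hCe := he.mulVec C
  have hy : (fun ω => latticePoint Δ (q t ω) - d t ω) = fun ω => C *ᵥ ((s t ω).1 - (s t ω).2)
      + ditherError Δ (C *ᵥ ((s t ω).1 - (s t ω).2)) (d t ω) := by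
    funext ω
    rw [hq, latticePoint_innovIndex_sub]
  have hcross := crossMoment_mulVec_left he (hloop.l2_n t) C
  rw [hloop.error_n t, mul_zero] at hcross
  have hlaw : μ.map (fun ω => (d t ω, q t ω)) = uniformVec m Δ ⊗ₘ condDistrib (q t) (d t) μ := by
    rw [← h.law_n t, compProd_map_condDistrib hqm.aemeasurable]
  have hl2 : IsL2 μ fun ω => latticePoint Δ (q t ω) - d t ω := by
    rw [hy]
    exact hCe.add (hloop.l2_n t)
  obtain ⟨r, hr0, hr, hle⟩ := lintegral_natCeil_le hΔ (condDistrib (q t) (d t) μ) hqm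
    (h.measurable_n t) hlaw hG hl2
  refine ⟨r, hr0, ?_, hle⟩
  rw [hy, crossMoment_add_self hCe (hloop.l2_n t) hcross, crossMoment_mulVec_self he,
    hloop.cov_n t] at hr
  exact hr

theorem Plant.IsDriving.exists_marginal_length_le (hSys : Sys.IsAdmissible) (hΔ : 0 < Δ)
    (hV : V = (Δ ^ 2 / 12) • (1 : Matrix (Fin m) (Fin m) ℝ))
    (h : Sys.IsDriving (uniformVec m Δ) μ x₀ w d)
    (hs : ∀ t ω, s t ω = Sys.ditherState K J C Δ (x₀ ω) (fun i => w i ω) (fun i => d i ω) t)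
    (hq : ∀ t ω, q t ω = innovIndex C Δ (s t ω) (d t ω)) (hG : G.PosDef) (t : ℕ) :
    ∃ r : ℝ, 0 ≤ r ∧ r ≤ lengthBound Δ G (C * crossMoment μ (fun ω => (s t ω).1 - (s t ω).2)
        (fun ω => (s t ω).1 - (s t ω).2) * Cᵀ + V) + m ∧
      ∫⁻ ω, (⌈-Real.logb 2 ((μ.map (q t)).real {q t ω})⌉₊ : ℝ≥0∞) ∂μ ≤ ENNReal.ofReal r := by
  have hloop := h.isWhiteLoop_dither (K := K) (J := J) (C := C) hSys hΔ hV hs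
  have hqm := h.measurable_innovIndex hs hq t
  have hdm := h.measurable_n t
  have he := hloop.l2_error t
  have hCe := he.mulVec C
  have hφ : Measurable fun z : (Fin m → ℝ) × (Fin m → ℝ) => C *ᵥ (z.1 - z.2) := by
    have h1 := (measurable_mulVec C).comp
      ((measurable_fst (α := Fin m → ℝ) (β := Fin m → ℝ)).sub measurable_snd)
    exact h1
  have hst : s t = fun ω => Sys.ditherState K J C Δ (x₀ ω) (fun i => w i ω) (fun i => d i ω) t :=
    funext (hs t)
  have hsm : Measurable (s t) := by
    rw [hst]; exact h.measurable_ditherState t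
  have hind : IndepFun (s t) (d t) μ := by
    rw [hst]; exact h.indep_ditherState t
  set X : Ω → Fin m → ℝ := fun ω => C *ᵥ ((s t ω).1 - (s t ω).2) with hX
  have hXm : Measurable X := hφ.comp hsm
  have hXd : IndepFun X (d t) μ := hind.comp hφ measurable_id
  set D := crossMoment μ (fun ω => quantError Δ (X ω) (d t ω))
    (fun ω => quantError Δ (X ω) (d t ω)) with hD
  have hql2 := isL2_quantError hΔ hXm hdm (h.law_n t)
  have hy : (fun ω => latticePoint Δ (q t ω)) = fun ω => X ω + quantError Δ (X ω) (d t ω) := by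
    funext ω
    rw [hq, latticePoint_innovIndex]
  have hl2 : IsL2 μ fun ω => latticePoint Δ (q t ω) := by
    rw [hy]
    exact hCe.add hql2
  have hcov : crossMoment μ (fun ω => latticePoint Δ (q t ω)) (fun ω => latticePoint Δ (q t ω))
      = crossMoment μ X X + D := by
    rw [hy, crossMoment_add_self hCe hql2
      (crossMoment_quantError hΔ hXm hCe hdm hXd (h.law_n t))]
  obtain ⟨r, hr0, hr, hle⟩ := lintegral_natCeil_marginal_le hΔ hqm
    (hG.smul (by norm_num : (0 : ℝ) < 1 / 4)) hl2
  refine ⟨r, hr0, hr.trans ?_, hle⟩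
  rw [hcov, ← hV, ← crossMoment_mulVec_self he]
  refine lengthBound_quarter hG ?_
  have h1 : 0 ≤ (G * crossMoment μ X X).trace := by
    rw [← hCe.integral_quad G]
    exact integral_nonneg fun ω => posSemidef_quad_nonneg hG.posSemidef _
  -- The undithered error has uncorrelated entries of variance at most Δ²/4 = 3 (Δ²/12). With the
  -- fictitious dither the total is at most four times the V contribution.
  have h2 : (G * D).trace ≤ 3 * (G * V).trace := by
    refine (trace_mul_le_of_diagonal hG.posSemidef
      (fun i j hij => crossMoment_quantError_self_of_ne hΔ hXm hdm hXd (h.law_n t) hij)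
      (crossMoment_quantError_self_le hΔ hXm hdm hXd (h.law_n t))).trans (le_of_eq ?_)
    rw [hV]
    simp only [Matrix.mul_smul, Matrix.trace_smul, smul_eq_mul]
    ring
  simp only [Matrix.mul_add, Matrix.trace_add]
  linarith

theorem Plant.IsDriving.tendsto_lengthBound {P : Matrix (Fin m) (Fin m) ℝ} {v : ℝ}
    (hSys : Sys.IsAdmissible) (hv : 0 < v) (hΔv : Δ = √(12 * v))
    (hV : V = v • (1 : Matrix (Fin m) (Fin m) ℝ)) (hC : Sys.Realizes P C V)
    (hJ : J = Sys.filterGain P C V) (h : Sys.IsDriving (uniformVec m Δ) μ x₀ w d)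
    (hs : ∀ t ω, s t ω = Sys.ditherState K J C Δ (x₀ ω) (fun i => w i ω) (fun i => d i ω) t) :
    Tendsto (fun t => lengthBound Δ (C * Sys.pred P * Cᵀ + V)⁻¹
        (C * crossMoment μ (fun ω => (s t ω).1 - (s t ω).2)
          (fun ω => (s t ω).1 - (s t ω).2) * Cᵀ + V)) atTop
      (𝓝 (1 + m / 2 * Real.logb 2 (2 * Real.pi * Real.exp 1 / 12)
        + 1 / 2 * Real.logb 2 ((Sys.pred P).det / P.det))) := by
  have hΔ : 0 < Δ := hΔv ▸ Real.sqrt_pos.2 (by positivity)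
  have hV' : V = (Δ ^ 2 / 12) • (1 : Matrix (Fin m) (Fin m) ℝ) := by
    rw [hΔv, Real.sq_sqrt (by positivity), mul_div_cancel_left₀ _ (by norm_num), hV]
  have hcov := (h.isWhiteLoop_dither (K := K) (J := J) (C := C) hSys hΔ hV' hs).tendsto_cov_error
    hSys hC hJ
  have hlim := LQG.tendsto_lengthBound Δ (C * Sys.pred P * Cᵀ + V)⁻¹
    (((tendsto_const_nhds (x := C)).mul hcov).mul (tendsto_const_nhds (x := Cᵀ)) |>.add
      (tendsto_const_nhds (x := V)))
  rw [lengthBound_inv_self hv hΔv (Plant.innovation_posDef hSys hC), hC.det_innovation hSys] at hlim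
  have hdet : V.det = v ^ m := by
    rw [hV, Matrix.det_smul, Matrix.det_one, Fintype.card_fin, mul_one]
  rwa [hdet, mul_div_cancel_left₀ _ (by positivity)] at hlim

theorem Plant.IsMinimizer.add_le_rate_add {S P Pi : Matrix (Fin m) (Fin m) ℝ} {γ : ℝ}
    (hSys : Sys.IsAdmissible) (h : Sys.IsMinimizer S γ P Pi) (hP : P.PosDef) (c : ℝ) :
    ((c + 1 / 2 * Real.logb 2 ((Sys.pred P).det / P.det) : ℝ) : EReal)
      ≤ Sys.rate S γ + (c : EReal) := by
  rw [← h.optimal, add_comm c, EReal.coe_add]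
  exact add_le_add (h.feasible.le_objective hSys hP) le_rfl

end Loop

end LQG

/-! ### The main theorem. -/

open LQG in
theorem theorem2 {m p : ℕ} (Sys : LQG.Plant m p) (hSys : Sys.IsAdmissible)
    -- stabilizing Riccati solution, minimizer of the log-det program, realization with `V = v I`
    (S : Matrix (Fin m) (Fin m) ℝ) (hS : Sys.IsStabilizingDARE S) (γ : ℝ)
    (P Pi : Matrix (Fin m) (Fin m) ℝ) (hP : Sys.IsMinimizer S γ P Pi)
    (C V : Matrix (Fin m) (Fin m) ℝ) (v : ℝ) (hv : 0 < v)
    (hV : V = v • (1 : Matrix (Fin m) (Fin m) ℝ)) (hC : Sys.Realizes P C V)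
    (Δ : ℝ) (hΔ : Δ = Real.sqrt (12 * v))
    (K : Matrix (Fin p) (Fin m) ℝ) (hK : K = Sys.gain S)
    (J : Matrix (Fin m) (Fin m) ℝ) (hJ : J = Sys.filterGain P C V)
    -- the dithered-quantizer architecture
    {Ω : Type*} [MeasurableSpace Ω] (μ : MeasureTheory.Measure Ω)
    [MeasureTheory.IsProbabilityMeasure μ]
    (x₀ : Ω → Fin m → ℝ) (w d : ℕ → Ω → Fin m → ℝ)
    (hd : Sys.IsDriving (LQG.uniformVec m Δ) μ x₀ w d)
    (x : ℕ → Ω → Fin m → ℝ) (u : ℕ → Ω → Fin p → ℝ) (q : ℕ → Ω → Fin m → ℤ)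
    (hx : ∀ t ω, x t ω = (Sys.ditherState K J C Δ (x₀ ω) (fun i => w i ω) (fun i => d i ω) t).1)
    (hu : ∀ t ω, u t ω = Sys.ditherInput K J C Δ (x₀ ω) (fun i => w i ω) (fun i => d i ω) t)
    (hq : ∀ t ω, q t ω = Sys.ditherIndex K J C Δ (x₀ ω) (fun i => w i ω) (fun i => d i ω) t)
    -- the three-stage Gaussian test channel
    {Ω' : Type*} [MeasurableSpace Ω'] (μ' : MeasureTheory.Measure Ω')
    [MeasureTheory.IsProbabilityMeasure μ']
    (x₀' : Ω' → Fin m → ℝ) (w' v' : ℕ → Ω' → Fin m → ℝ)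
    (hv' : Sys.IsDriving (LQG.gaussianVec V) μ' x₀' w' v')
    (x' : ℕ → Ω' → Fin m → ℝ) (u' : ℕ → Ω' → Fin p → ℝ)
    (hx' : ∀ t ω, x' t ω = (Sys.testState K J C (x₀' ω) (fun i => w' i ω) (fun i => v' i ω) t).1)
    (hu' : ∀ t ω, u' t ω = Sys.testInput K J C (x₀' ω) (fun i => w' i ω) (fun i => v' i ω) t) :
    -- control performance
    (∃ c : ℝ, c = (S * Sys.W).trace + (P * Sys.theta S).trace ∧ c ≤ γ ∧
      Sys.HasLQGCost μ' x' u' c ∧ Sys.HasLQGCost μ x u c) ∧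
    -- sorted code with the dither as side information
    ((∃ s, LQG.IsSideInfoSorting μ q d s) ∧
      ∀ s, LQG.IsSideInfoSorting μ q d s →
        ∀ a : ℕ → Ω → List Bool, a = LQG.sideInfoCodeword μ q d s →
          (∀ t, Measurable (a t)) ∧
          (∃ dec : ℕ → List Bool × (Fin m → ℝ) → (Fin m → ℤ), (∀ t, Measurable (dec t)) ∧
            ∀ t, ∀ᵐ ω ∂μ, dec t (a t ω, d t ω) = q t ω) ∧
          LQG.PrefixConstraint1 μ a d u ∧
          (LQG.commCost μ a : EReal) ≤ Sys.rate S γ +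
            ((1 + (m : ℝ) / 2 * Real.logb 2 (2 * Real.pi * Real.exp 1 / 12) : ℝ) : EReal)) ∧
    -- sorted code that ignores the dither
    ((∃ s, LQG.IsMarginalSorting μ q s) ∧
      ∀ s, LQG.IsMarginalSorting μ q s →
        ∀ a : ℕ → Ω → List Bool, a = LQG.marginalCodeword μ q s →
          (∀ t, Measurable (a t)) ∧
          (∃ dec : ℕ → List Bool → (Fin m → ℤ), (∀ t, Measurable (dec t)) ∧
            ∀ t, ∀ᵐ ω ∂μ, dec t (a t ω) = q t ω) ∧
          LQG.PrefixConstraint2 μ a ∧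
          (LQG.commCost μ a : EReal) ≤ Sys.rate S γ +
            ((1 + (m : ℝ) * (1 + 1 / 2 * Real.logb 2 (2 * Real.pi * Real.exp 1 / 12)) : ℝ) :
              EReal)) := by
  have hΔ0 : 0 < Δ := hΔ ▸ Real.sqrt_pos.2 (by positivity)
  have hV' : V = (Δ ^ 2 / 12) • (1 : Matrix (Fin m) (Fin m) ℝ) := by
    rw [hΔ, Real.sq_sqrt (by positivity), mul_div_cancel_left₀ _ (by norm_num), hV]
  set s : ℕ → Ω → (Fin m → ℝ) × (Fin m → ℝ) := fun t ω =>
    Sys.ditherState K J C Δ (x₀ ω) (fun i => w i ω) (fun i => d i ω) t with hsdef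
  have hs : ∀ t ω, s t ω = Sys.ditherState K J C Δ (x₀ ω) (fun i => w i ω) (fun i => d i ω) t :=
    fun _ _ => rfl
  have hqs : ∀ t ω, q t ω = innovIndex C Δ (s t ω) (d t ω) := hq
  have hqm : ∀ t, Measurable (q t) := hd.measurable_innovIndex hs hqs
  have hdm := hd.measurable_n
  have hum : ∀ t, Measurable (u t) := by
    intro t
    have h1 := (measurable_mulVec K).comp ((measurable_ditherPosterior J C Δ).comp
      ((measurable_snd.comp
        (hd.measurable_ditherState (K := K) (J := J) (C := C) (Δ := Δ) t)).prodMk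
        ((hqm t).prodMk (hdm t))))
    have h2 : u t = fun ω => K *ᵥ ditherPosterior J C Δ (s t ω).2 (q t ω) (d t ω) := by
      funext ω
      rw [hu, hq]
      rfl
    rw [h2]
    exact h1
  -- The reference Gaussian has the limiting covariance of q - d, fixed for all times; this choice
  -- is asymptotically tight in the quadratic term.
  have hG : (C * Sys.pred P * Cᵀ + V)⁻¹.PosDef := (Plant.innovation_posDef hSys hC).inv
  have hlim := hd.tendsto_lengthBound hSys hv hΔ hV hC hJ hs
  refine ⟨⟨_, rfl, ?_, ?_, ?_⟩, ⟨exists_isSideInfoSorting q d, ?_⟩,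
    ⟨exists_isMarginalSorting hqm, ?_⟩⟩
  · have h1 := hP.feasible.cost_le
    rw [Matrix.trace_mul_comm S, Matrix.trace_mul_comm P]
    linarith
  · have h1 := (hv'.isWhiteLoop_test (K := K) (J := J) (C := C) hSys hC.V_posDef).hasLQGCost
      hSys hS hK hC hJ
    have hx'' : x' = fun t ω =>
        (Sys.testState K J C (x₀' ω) (fun i => w' i ω) (fun i => v' i ω) t).1 := by
      funext t ω; exact hx' t ω
    have hu'' : u' = fun t ω => K *ᵥ testPosterior J C
        (Sys.testState K J C (x₀' ω) (fun i => w' i ω) (fun i => v' i ω) t) (v' t ω) := by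
      funext t ω; exact hu' t ω
    rw [hx'', hu'']
    exact h1
  · have h1 := (hd.isWhiteLoop_dither (K := K) (J := J) (C := C) hSys hΔ0 hV' hs).hasLQGCost
      hSys hS hK hC hJ
    have hx'' : x = fun t ω => (s t ω).1 := by
      funext t ω; exact hx t ω
    have hu'' : u = fun t ω => K *ᵥ testPosterior J C (s t ω)
        (ditherError Δ (C *ᵥ ((s t ω).1 - (s t ω).2)) (d t ω)) := by
      funext t ω
      rw [← ditherPosterior_eq_testPosterior, hu]
      rfl
    rw [hx'', hu'']
    exact h1
  · rintro σ hσ a rfl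
    refine ⟨measurable_sideInfoCodeword hqm hdm hσ, sideInfoCodeword_decodable hqm hdm hσ,
      sideInfoCodeword_prefixConstraint hqm hdm hσ hum,
      (commCost_le hlim fun t => ?_).trans (hP.add_le_rate_add hSys hC.P_posDef _)⟩
    simp only [sideInfoCodeword, length_shannonCode]
    exact hd.exists_sideInfo_length_le hSys hΔ0 hV' hs hqs hG t
  · rintro σ hσ a rfl
    refine ⟨measurable_marginalCodeword hqm σ, marginalCodeword_decodable hqm hσ,
      marginalCodeword_prefixConstraint hqm hσ,
      (commCost_le (hlim.add_const (m : ℝ)) fun t => ?_).trans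
        (le_trans (le_of_eq ?_) (hP.add_le_rate_add hSys hC.P_posDef _))⟩
    · simp only [marginalCodeword, length_shannonCode]
      exact hd.exists_marginal_length_le hSys hΔ0 hV' hs hqs hG t
    -- The m bits for the ignored dither combine with the (m/2) log₂ term into m (1 + ½ log₂
    -- (2πe/12)).
    · congr 1
      ring
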